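/- Let $d\ge 1$, $H_0\in[1/2,1]$, $H=(H_1,\dots,H_d)\in(0,1)^d$ and $|H|:=H_1+\cdots+H_d$. Let $W=(W(t,x))_{t\ge 0,\,x\in\mathbb{R}^d}$ be a centered Gaussian random field on a probability space $(\Omega,\mathcal F,\mathbb P)$ with covariance $$\mathbb E[W(t,x)W(s,y)]=R_{H_0}(t,s)\prod_{i=1}^d R_{H_i}(x_i,y_i),\qquad R_a(\xi,\eta)=\tfrac12\left(|\xi|^{2a}+|\eta|^{2a}-|\xi-\eta|^{2a}\right).$$ Write $\mathcal F g(\xi)=\int_{\mathbb R^d} e^{-i\xi\cdot x}g(x)\,dx$ for the Fourier transform in space, and let $$\|g\|_{\mathfrak H}^2=\int_{\mathbb R_+^2\times\mathbb R^d}\phi_{H_0}(r-s)\,\mathcal F g(r,\xi)\,\overline{\mathcal F g(s,\xi)}\,\prod_{k=1}^d\frac{\Gamma(2H_k+1)\sin(\pi H_k)}{2\pi}|\xi_k|^{1-2H_k}\,dr\,ds\,d\xi ,$$ where $\phi_{1/2}=\delta$ is the Dirac mass at $0$ and $\phi_{H_0}(r)=H_0(2H_0-1)|r|^{2H_0-2}$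 for $1/2<H_0\le 1$. For a finite real linear combination $g$ of indicator functions of boxes $(a,b]\times\prod_{i=1}^d(c_i,e_i]\subset\mathbb R_+\times\mathbb R^d$, let $\int g\,dW$ be the corresponding linear combination of the rectangular increments of $W$. For other deterministic integrands $g$, let $\int g\,dW$ be the $L^2(\Omega)$-limit of $\int g_n\,dW$ for step functions $g_n$ of this kind with $\|g_n-g\|_{\mathfrak H}\to 0$. Let $G_t$ be the Green's function of the wave equation on $\mathbb R^d$, given by $\mathcal F G_t(\xi)=\sin(t|\xi|)/|\xi|$, and let $p_\varepsilon(x)=(2\pi\varepsilon)^{-d/2}e^{-|x|^2/(2\varepsilon)}$. For $\varepsilon>0$, $t\ge0$ and $x\in\mathbb R^d$, consider the solution $$u_\varepsilon(t,x)=\int_0^t\int_{\mathbb R^d}(G_{t-s}*p_\varepsilon)(x-y)\,W(ds,dy)$$ of the wave equation $\partial_t^2u_\varepsilon=\Delta u_\varepsilon+p_\varepsilon*\dot W$ with zero initial data. The stochastic wave equation $\partial_t^2u=\Delta u+\dot W$ with zero initial data is called solvable if, for every $t\ge0$ and $x\in\mathbb R^d$, the family $u_\varepsilon(t,x)$ is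 Cauchy in $L^2(\Omega,\mathcal F,\mathbb P)$ as $\varepsilon\to0^+$. Then the stochastic integrals $u_\varepsilon(t,x)$ exist for all $\varepsilon>0$, $t\ge0$ and $x\in\mathbb R^d$, and the stochastic wave equation is solvable if and only if $$\begin{cases}|H|>d-1 & \text{if } H_0=1/2,\\ |H|>d-2 & \text{if } H_0=1,\\ |H|+H_0>d-1/2 & \text{if } 1/2<H_0<1.\end{cases}$$ -/

import Mathlib

open MeasureTheory ProbabilityTheory Filter Topology
open scoped NNReal ENNReal ComplexConjugate

namespace FracWave

/-- The Euclidean space `ℝ^d`. -/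
abbrev Sp (d : ℕ) : Type := EuclideanSpace ℝ (Fin d)

/-! ### The fractional Brownian field -/

/-- `R_a(ξ, η) = (|ξ|^{2a} + |η|^{2a} - |ξ - η|^{2a}) / 2`, the covariance of fractional Brownian
motion with Hurst parameter `a`. For `a = 1/2` and `ξ, η ≥ 0` it is `min ξ η`; for `a = 1` it is
`ξ * η`. -/
noncomputable def fbmCov (a ξ η : ℝ) : ℝ :=
  (|ξ| ^ (2 * a) + |η| ^ (2 * a) - |ξ - η| ^ (2 * a)) / 2

/-- `W = (W(t, x))`, `t ≥ 0`, `x ∈ ℝ^d`, is a centered Gaussian random field with covariance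
`E[W(t,x) W(s,y)] = R_{H₀}(t,s) ∏ᵢ R_{Hᵢ}(xᵢ,yᵢ)`. -/
structure IsFractionalField {d : ℕ} {Ω : Type*} [MeasurableSpace Ω] (P : Measure Ω)
    (H₀ : ℝ) (H : Fin d → ℝ) (W : ℝ≥0 → Sp d → Ω → ℝ) : Prop where
  gaussian : IsGaussianProcess (fun p : ℝ≥0 × Sp d => W p.1 p.2) P
  mean : ∀ t x, ∫ ω, W t x ω ∂P = 0
  cov : ∀ t x s y, ∫ ω, W t x ω * W s y ω ∂P = fbmCov H₀ t s * ∏ i, fbmCov (H i) (x i) (y i)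

/-! ### Elementary integrands and their integrals -/

/-- A bounded half-open box `(a, b] × ∏ᵢ (loᵢ, hiᵢ]` in `ℝ₊ × ℝ^d`. -/
structure Box (d : ℕ) where
  a : ℝ≥0
  b : ℝ≥0
  lo : Sp d
  hi : Sp d
  a_lt_b : a < b
  lo_lt_hi : ∀ i, lo i < hi i

/-- The part of a box in `ℝ^d`. -/
def Box.side {d : ℕ} (B : Box d) : Set (Sp d) := {y | ∀ i, B.lo i < y i ∧ y i ≤ B.hi i}

/-- The indicator function of a box. -/
noncomputable def Box.ind {d : ℕ} (B : Box d) (s : ℝ) (y : Sp d) : ℝ :=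
  (Set.Ioc (B.a : ℝ) B.b).indicator 1 s * B.side.indicator 1 y

/-- The vertex of the spatial part of a box with coordinates `loᵢ` for `i ∈ A`, `hiᵢ` otherwise. -/
noncomputable def Box.vertex {d : ℕ} (B : Box d) (A : Finset (Fin d)) : Sp d :=
  WithLp.toLp 2 (fun i => if i ∈ A then B.lo i else B.hi i)

/-- The increment of `W` over a box: the alternating sum of the values of `W` at its vertices. -/
noncomputable def Box.increment {d : ℕ} {Ω : Type*} (W : ℝ≥0 → Sp d → Ω → ℝ) (B : Box d)
    (ω : Ω) : ℝ :=
  ∑ A : Finset (Fin d), (-1 : ℝ) ^ A.card * (W B.b (B.vertex A) ω - W B.a (B.vertex A) ω)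

/-- A (deterministic) elementary integrand: a finite real linear combination of boxes. -/
abbrev Elem (d : ℕ) : Type := Box d →₀ ℝ

/-- The step function on `ℝ₊ × ℝ^d` given by an elementary integrand. -/
noncomputable def Elem.toFun {d : ℕ} (e : Elem d) (s : ℝ) (y : Sp d) : ℝ :=
  e.sum fun B c => c * B.ind s y

/-- The stochastic integral of an elementary integrand with respect to `W`. -/
noncomputable def Elem.integral {d : ℕ} {Ω : Type*} (W : ℝ≥0 → Sp d → Ω → ℝ) (e : Elem d)
    (ω : Ω) : ℝ :=
  e.sum fun B c => c * B.increment W ω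

/-! ### The Hilbert space of integrands, in spatial Fourier mode -/

/-- The spatial Fourier transform `ℱφ(ξ) = ∫ e^{-i ξ·y} φ(y) dy`. -/
noncomputable def fourier {d : ℕ} (φ : Sp d → ℝ) (ξ : Sp d) : ℂ :=
  ∫ y, Complex.exp (-(Complex.I * (inner ℝ ξ y : ℝ))) * (φ y : ℂ)

/-- The temporal covariance `φ_{H₀}(r - s) dr ds` of the noise as a measure on `ℝ₊ × ℝ₊`, where
`φ_{1/2} = δ` (so that the measure is `dr` on the diagonal) and
`φ_{H₀}(r - s) = H₀ (2 H₀ - 1) |r - s|^{2 H₀ - 2}` otherwise. -/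
noncomputable def temporalMeasure (H₀ : ℝ) : Measure (ℝ × ℝ) :=
  open Classical in
  if H₀ = 1 / 2 then (volume.restrict (Set.Ioi (0 : ℝ))).map (fun r => (r, r))
  else ((volume.restrict (Set.Ioi (0 : ℝ))).prod (volume.restrict (Set.Ioi (0 : ℝ)))).withDensity
    fun p => ENNReal.ofReal (H₀ * (2 * H₀ - 1) * |p.1 - p.2| ^ (2 * H₀ - 2))

/-- The spatial spectral measure `∏ₖ C_{Hₖ} |ξₖ|^{1 - 2 Hₖ} dξ`, with
`C_h = Γ(2h + 1) sin(π h) / (2π)`. -/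
noncomputable def spectralMeasure {d : ℕ} (H : Fin d → ℝ) : Measure (Sp d) :=
  volume.withDensity fun ξ => ENNReal.ofReal (∏ k,
    (Real.Gamma (2 * H k + 1) * Real.sin (Real.pi * H k) / (2 * Real.pi)) *
      |ξ k| ^ (1 - 2 * H k))

/-- The integrand `ĝ(r, ξ) conj ĝ(s, ξ)` of the squared norm of `g`, with `ĝ` the spatial Fourier
transform of `g`. -/
noncomputable def energyDensity {d : ℕ} (g : ℝ → Sp d → ℂ) (p : (ℝ × ℝ) × Sp d) : ℂ :=
  g p.1.1 p.2 * conj (g p.1.2 p.2)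

/-- The element with spatial Fourier transform `g` has an absolutely convergent squared norm. -/
def FiniteEnergy {d : ℕ} (H₀ : ℝ) (H : Fin d → ℝ) (g : ℝ → Sp d → ℂ) : Prop :=
  Integrable (energyDensity g) ((temporalMeasure H₀).prod (spectralMeasure H))

/-- The squared norm
`∫ ∫ ∫ φ_{H₀}(r - s) ĝ(r, ξ) conj ĝ(s, ξ) ∏ₖ C_{Hₖ} |ξₖ|^{1 - 2 Hₖ} dr ds dξ`
of the element with spatial Fourier transform `ĝ`. -/
noncomputable def energy {d : ℕ} (H₀ : ℝ) (H : Fin d → ℝ) (g : ℝ → Sp d → ℂ) : ℝ :=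
  (∫ p, energyDensity g p ∂((temporalMeasure H₀).prod (spectralMeasure H))).re

/-- `X` is (a version of) the stochastic integral with respect to `W` of the deterministic
integrand with spatial Fourier transform `g`: the limit in `L²(Ω)` of the integrals of
elementary integrands that converge to it in the Hilbert space of integrands. The integrand
is given by its spatial Fourier transform because it may be a distribution in the space variable. -/
def IsWienerIntegral {d : ℕ} {Ω : Type*} [MeasurableSpace Ω] (P : Measure Ω)
    (H₀ : ℝ) (H : Fin d → ℝ) (W : ℝ≥0 → Sp d → Ω → ℝ) (g : ℝ → Sp d → ℂ) (X : Ω → ℝ) : Prop :=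
  MemLp X 2 P ∧ ∃ e : ℕ → Elem d,
    (∀ n, FiniteEnergy H₀ H (fun r ξ => fourier ((e n).toFun r) ξ - g r ξ)) ∧
    Tendsto (fun n => energy H₀ H (fun r ξ => fourier ((e n).toFun r) ξ - g r ξ)) atTop (𝓝 0) ∧
    Tendsto (fun n => eLpNorm (fun ω => (e n).integral W ω - X ω) 2 P) atTop (𝓝 0)

/-! ### The mollified wave equation -/

/-- The Fourier transform `sin(t|ξ|) / |ξ|` of the Green's function `G_t` of the wave equation
(the value at the single point `ξ = 0` is immaterial). -/
noncomputable def greenFourier {d : ℕ} (t : ℝ) (ξ : Sp d) : ℝ := Real.sin (t * ‖ξ‖) / ‖ξ‖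

/-- The heat kernel `p_ε(x) = (2πε)^{-d/2} e^{-|x|²/(2ε)}`. -/
noncomputable def heatKernel {d : ℕ} (ε : ℝ) (x : Sp d) : ℝ :=
  (2 * Real.pi * ε) ^ (-(d : ℝ) / 2) * Real.exp (-‖x‖ ^ 2 / (2 * ε))

/-- The spatial Fourier transform in `y` of the integrand `1_{[0,t]}(s) (G_{t-s} * p_ε)(x - y)`.
Integrating `G_{t-s}(x - ·)` against the mollified noise `p_ε * Ẇ` is integrating this
function of `(s, y)` against `Ẇ`. -/
noncomputable def mollifiedKernel {d : ℕ} (ε t : ℝ) (x : Sp d) (s : ℝ) (ξ : Sp d) : ℂ :=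
  (Set.Icc 0 t).indicator
    (fun s => Complex.exp (-(Complex.I * (inner ℝ ξ x : ℝ))) * (greenFourier (t - s) ξ : ℂ) *
      fourier (heatKernel ε) ξ) s

/-- `u ε t x` is, for all `ε > 0`, `t ≥ 0` and `x ∈ ℝ^d`, the mild solution
`∫₀ᵗ ∫ G_{t-s}(x - y) W_ε(ds, dy)` of the wave equation with zero initial data and mollified noise
`Ẇ_ε = p_ε * Ẇ`. -/
def IsMollifiedSolution {d : ℕ} {Ω : Type*} [MeasurableSpace Ω] (P : Measure Ω)
    (H₀ : ℝ) (H : Fin d → ℝ) (W : ℝ≥0 → Sp d → Ω → ℝ) (u : ℝ → ℝ≥0 → Sp d → Ω → ℝ) : Prop :=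
  ∀ ε > 0, ∀ (t : ℝ≥0) (x : Sp d), IsWienerIntegral P H₀ H W (mollifiedKernel ε t x) (u ε t x)

/-- The wave equation driven by `Ẇ` is solvable: for every `(t, x)` the mollified solutions
`u_ε(t, x)` form a Cauchy family in `L²(Ω)` as `ε → 0`. -/
def Solvable {d : ℕ} {Ω : Type*} [MeasurableSpace Ω] (P : Measure Ω)
    (H₀ : ℝ) (H : Fin d → ℝ) (W : ℝ≥0 → Sp d → Ω → ℝ) : Prop :=
  ∃ u : ℝ → ℝ≥0 → Sp d → Ω → ℝ, IsMollifiedSolution P H₀ H W u ∧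
    ∀ (t : ℝ≥0) (x : Sp d),
      Tendsto (fun p : ℝ × ℝ => eLpNorm (fun ω => u p.1 t x ω - u p.2 t x ω) 2 P)
        (𝓝[>] 0 ×ˢ 𝓝[>] 0) (𝓝 0)

end FracWave

/-! Write μ for the spectral measure and N_t(ρ) for `temporalEnergy`, the squared norm in time of r
↦ sin((t-r)ρ)/ρ on [0,t]. The Wiener integral is an isometry, and the phase e^{-iξ·x} has modulus
one, so E|u_ε(t,x) - u_δ(t,x)|² = ∫ (e^{-ε|ξ|²/2} - e^{-δ|ξ|²/2})² N_t(|ξ|) μ(dξ)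
(`eLpNorm_mollified_sub_sq`). Dominated convergence in one direction and Fatou in the other show
that the family is Cauchy exactly when ∫ N_t(|ξ|) μ(dξ) < ∞ for every t (`solvable_iff_lintegral`).

The density of μ is homogeneous, so its radial part is a multiple of ρ^{β-1} dρ with β = 2d - 2|H|
(`lintegral_norm_spectralMeasure`). N_t is bounded, and at high frequency it has size ρ^{-p}, up to
oscillation, with p = 2 for H₀ = 1/2, p = 1 + 2H₀ for 1/2 < H₀ < 1, and p = 4 for H₀ = 1. Hence
solvability means β < p (`solvable_iff_specDim_lt`), which is the stated trichotomy. The exponent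
jumps from the limiting value 3 to 4 at H₀ = 1 because the energy is then the square of a single
oscillating integral.

Everything in time rests on writing the temporal covariance as a mixture ∫ κ_l ⊗ κ_l m(dl)
(`isMixture_temporalMeasure`): Dirac masses for H₀ = 1/2, one copy of Lebesgue measure for H₀ = 1,
and windows (v, v+l] weighted by l^{2H₀-4} dv dl in between. This gives positivity, an isometric map
of the integrands into an L² space (`exists_isometry_of_isMixture`), and the two-sided estimate of
N_t, since the integral of a sine over a window is explicit.

Two more facts link this to W. The spectral representation of fractional Brownian increments
(`integral_specDensity_mul`) gives the isometry on step functions. Density of translates of a cube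
in L²(μ) (`span_cubeFourier_dense`) gives existence of the mollified integrals
(`exists_isMollifiedSolution`). -/

namespace FracWave

/-! ### Mixtures of product measures -/

section Mixture

variable {X Λ : Type*} [MeasurableSpace X] [MeasurableSpace Λ]

/-- The mixture `∫ κ_l ⊗ κ_l m(dl)`. -/
noncomputable def mixture (m : Measure Λ) (κ : Kernel Λ X) : Measure (X × X) := (κ ×ₖ κ) ∘ₘ m

/-- The map `g ↦ (l ↦ ∫ g dκ_l)`. -/
noncomputable def mixtureMap (κ : Kernel Λ X) (g : X → ℂ) (l : Λ) : ℂ := ∫ x, g x ∂κ l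

lemma measurable_mixtureMap {κ : Kernel Λ X} {g : X → ℂ} (hg : Measurable g) : Measurable (mixtureMap κ g) :=
  hg.stronglyMeasurable.integral_kernel.measurable

variable {m : Measure Λ} {κ : Kernel Λ X} [IsSFiniteKernel κ]

lemma lintegral_mixture {f : X × X → ℝ≥0∞} (hf : Measurable f) :
    ∫⁻ p, f p ∂mixture m κ = ∫⁻ l, ∫⁻ x, ∫⁻ y, f (x, y) ∂κ l ∂κ l ∂m := by
  rw [mixture, Measure.lintegral_bind (Kernel.aemeasurable _) hf.aemeasurable]
  refine lintegral_congr fun l => ?_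
  rw [Kernel.prod_apply, lintegral_prod _ hf.aemeasurable]

/-- `g(x) conj g(y)`. -/
noncomputable def selfTensor (g : X → ℂ) (p : X × X) : ℂ := g p.1 * conj (g p.2)

lemma measurable_selfTensor {g : X → ℂ} (hg : Measurable g) : Measurable (selfTensor g) := by
  unfold selfTensor
  exact (hg.comp measurable_fst).mul (Complex.continuous_conj.measurable.comp
    (hg.comp measurable_snd))

lemma lintegral_enorm_selfTensor_mixture {g : X → ℂ} (hg : Measurable g) :
    ∫⁻ p, ‖selfTensor g p‖ₑ ∂mixture m κ = ∫⁻ l, (∫⁻ x, ‖g x‖ₑ ∂κ l) ^ 2 ∂m := by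
  rw [lintegral_mixture (measurable_selfTensor hg).enorm]
  refine lintegral_congr fun l => ?_
  simp only [selfTensor, enorm_mul, RCLike.enorm_conj]
  simp_rw [lintegral_const_mul _ hg.enorm]
  rw [lintegral_mul_const _ hg.enorm, sq]

/-- `FiniteEnergy` demands absolute convergence of a double integral, a condition not visibly stable
under differences. For a mixture it becomes square integrability of the L¹(κ_l) norm, which is
stable by the triangle inequality. -/
lemma integrable_selfTensor_iff {g : X → ℂ} (hg : Measurable g) :
    Integrable (selfTensor g) (mixture m κ) ↔ ∫⁻ l, (∫⁻ x, ‖g x‖ₑ ∂κ l) ^ 2 ∂m < ∞ := by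
  rw [← lintegral_enorm_selfTensor_mixture hg]
  exact ⟨fun h => h.2, fun h => ⟨(measurable_selfTensor hg).aestronglyMeasurable, h⟩⟩

lemma integrable_selfTensor_sub {g h : X → ℂ} (hg : Measurable g) (hh : Measurable h)
    (hg' : Integrable (selfTensor g) (mixture m κ))
    (hh' : Integrable (selfTensor h) (mixture m κ)) :
    Integrable (selfTensor (fun x => g x - h x)) (mixture m κ) := by
  rw [integrable_selfTensor_iff hg] at hg'
  rw [integrable_selfTensor_iff hh] at hh'
  rw [integrable_selfTensor_iff (show Measurable fun x => g x - h x from hg.sub hh)]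
  have hm : Measurable fun l => (∫⁻ x, ‖g x‖ₑ ∂κ l) ^ 2 := (hg.enorm.lintegral_kernel).pow_const 2
  calc ∫⁻ l, (∫⁻ x, ‖g x - h x‖ₑ ∂κ l) ^ 2 ∂m
      ≤ ∫⁻ l, 2 * ((∫⁻ x, ‖g x‖ₑ ∂κ l) ^ 2 + (∫⁻ x, ‖h x‖ₑ ∂κ l) ^ 2) ∂m := by
        refine lintegral_mono fun l => ?_
        have h1 : ∫⁻ x, ‖g x - h x‖ₑ ∂κ l ≤ (∫⁻ x, ‖g x‖ₑ ∂κ l) + ∫⁻ x, ‖h x‖ₑ ∂κ l := by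
          rw [← lintegral_add_left hg.enorm]
          exact lintegral_mono fun x => enorm_sub_le
        calc _ ≤ ((∫⁻ x, ‖g x‖ₑ ∂κ l) + ∫⁻ x, ‖h x‖ₑ ∂κ l) ^ 2 := by gcongr
          _ ≤ _ := by
            have := ENNReal.rpow_add_le_mul_rpow_add_rpow (∫⁻ x, ‖g x‖ₑ ∂κ l)
              (∫⁻ x, ‖h x‖ₑ ∂κ l) (p := 2) (by norm_num)
            norm_num at this
            exact this
    _ < ∞ := by
        rw [lintegral_const_mul _ (by fun_prop), lintegral_add_left hm]
        exact ENNReal.mul_lt_top (by norm_num) (ENNReal.add_lt_top.2 ⟨hg', hh'⟩)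

lemma ae_integrable_of_selfTensor {g : X → ℂ} (hg : Measurable g)
    (hg' : Integrable (selfTensor g) (mixture m κ)) : ∀ᵐ l ∂m, Integrable g (κ l) := by
  rw [integrable_selfTensor_iff hg] at hg'
  have hm : Measurable fun l => (∫⁻ x, ‖g x‖ₑ ∂κ l) ^ 2 := (hg.enorm.lintegral_kernel).pow_const 2
  filter_upwards [ae_lt_top hm hg'.ne] with l hl
  refine ⟨hg.aestronglyMeasurable, ?_⟩
  rw [HasFiniteIntegral]
  by_contra h
  simp only [not_lt, top_le_iff] at h
  simp [h] at hl

lemma mixtureMap_sub {g h : X → ℂ} (hg : Measurable g) (hh : Measurable h)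
    (hg' : Integrable (selfTensor g) (mixture m κ))
    (hh' : Integrable (selfTensor h) (mixture m κ)) :
    mixtureMap κ (fun x => g x - h x) =ᵐ[m] fun l => mixtureMap κ g l - mixtureMap κ h l := by
  filter_upwards [ae_integrable_of_selfTensor hg hg', ae_integrable_of_selfTensor hh hh']
    with l h1 h2 using integral_sub h1 h2

/-- Against κ_l ⊗ κ_l the double integral factors into a number times its conjugate. This is the
source of all positivity below. -/
lemma integral_selfTensor_mixture {g : X → ℂ} 
    (hg' : Integrable (selfTensor g) (mixture m κ)) :
    ∫ p, selfTensor g p ∂mixture m κ = ((∫ l, ‖mixtureMap κ g l‖ ^ 2 ∂m : ℝ) : ℂ) := by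
  rw [mixture, Measure.comp_eq_comp_const_apply, Kernel.integral_comp]
  · rw [Kernel.const_apply, ← integral_complex_ofReal]
    refine integral_congr_ae (Eventually.of_forall fun l => ?_)
    simp only [Kernel.prod_apply, selfTensor, mixtureMap]
    rw [integral_prod_mul (μ := κ l) (ν := κ l) g (fun y => conj (g y)), integral_conj,
      Complex.mul_conj, Complex.normSq_eq_norm_sq]
  · rwa [mixture, Measure.comp_eq_comp_const_apply] at hg'

lemma eLpNorm_mixtureMap_lt_top {g : X → ℂ} (hg : Measurable g)
    (hg' : Integrable (selfTensor g) (mixture m κ)) :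
    MemLp (mixtureMap κ g) 2 m := by
  refine ⟨(measurable_mixtureMap hg).aestronglyMeasurable, ?_⟩
  rw [integrable_selfTensor_iff hg] at hg'
  rw [eLpNorm_lt_top_iff_lintegral_rpow_enorm_lt_top (by norm_num) (by norm_num)]
  refine lt_of_le_of_lt (lintegral_mono fun l => ?_) hg'
  simp only [ENNReal.toReal_ofNat, ENNReal.rpow_ofNat]
  gcongr
  exact enorm_integral_le_lintegral_enorm _

lemma eLpNorm_mixtureMap_sq {g : X → ℂ} (hg : Measurable g)
    (hg' : Integrable (selfTensor g) (mixture m κ)) :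
    eLpNorm (mixtureMap κ g) 2 m ^ 2
      = ENNReal.ofReal (∫ p, selfTensor g p ∂mixture m κ).re := by
  rw [integral_selfTensor_mixture hg', Complex.ofReal_re]
  have h := (eLpNorm_mixtureMap_lt_top hg hg').eLpNorm_eq_integral_rpow_norm (by norm_num)
    (by norm_num)
  rw [h, ← ENNReal.ofReal_pow (by positivity), ENNReal.toReal_ofNat, ← Real.rpow_natCast,
    ← Real.rpow_mul (by positivity)]
  norm_num

end Mixture

/-! ### The Hilbert space of integrands as a subspace of an `L²` space -/

section Lift

variable {Λ : Type*} [MeasurableSpace Λ] {d : ℕ}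

/-- Reordering `((r, s), ξ) ↦ ((r, ξ), (s, ξ))`. -/
def spread (d : ℕ) (p : (ℝ × ℝ) × Sp d) : (ℝ × Sp d) × (ℝ × Sp d) :=
  ((p.1.1, p.2), (p.1.2, p.2))

lemma measurable_spread (d : ℕ) : Measurable (spread d) := by unfold spread; fun_prop

/-- The frequency joins the mixing parameter: both copies of (r, ξ) share the same ξ, so its kernel
is a Dirac mass. After this the energy density is literally a `selfTensor`. -/
lemma map_spread_mixture (m : Measure Λ) [SFinite m] (κ : Kernel Λ ℝ) [IsSFiniteKernel κ]
    (ν : Measure (Sp d)) [SFinite ν] :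
    ((mixture m κ).prod ν).map (spread d)
      = mixture (m.prod ν) (κ ∥ₖ (Kernel.id : Kernel (Sp d) (Sp d))) := by
  have : SFinite (mixture m κ) := by unfold mixture; infer_instance
  refine Measure.ext_of_lintegral _ fun f hf => ?_
  have hf' : Measurable fun p => f (spread d p) := hf.comp (measurable_spread d)
  rw [lintegral_map hf (measurable_spread d), lintegral_prod_symm _ hf'.aemeasurable,
    lintegral_mixture hf]
  have h1 : ∀ q : Λ × Sp d, ∫⁻ x, ∫⁻ y, f (x, y) ∂(κ ∥ₖ (Kernel.id : Kernel (Sp d) (Sp d))) q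
      ∂(κ ∥ₖ (Kernel.id : Kernel (Sp d) (Sp d))) q
      = ∫⁻ r, ∫⁻ s, f ((r, q.2), (s, q.2)) ∂κ q.1 ∂κ q.1 := by
    intro q
    have hq : ∀ g : ℝ × Sp d → ℝ≥0∞, Measurable g →
        ∫⁻ x, g x ∂(κ ∥ₖ (Kernel.id : Kernel (Sp d) (Sp d))) q = ∫⁻ r, g (r, q.2) ∂κ q.1 := by
      intro g hg
      rw [Kernel.lintegral_parallelComp _ hg]
      refine lintegral_congr fun r => ?_
      rw [Kernel.id_apply, lintegral_dirac' _ (by fun_prop)]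
    rw [hq _ (by fun_prop)]
    refine lintegral_congr fun r => ?_
    rw [hq _ (by fun_prop)]
  simp_rw [h1]
  have hF : Measurable fun q : Λ × Sp d =>
      ∫⁻ r, ∫⁻ s, f ((r, q.2), (s, q.2)) ∂κ q.1 ∂κ q.1 := by
    simp_rw [← h1]
    exact Measurable.lintegral_kernel_prod_right (κ := κ ∥ₖ (Kernel.id : Kernel (Sp d) (Sp d)))
      (f := fun q x => ∫⁻ y, f (x, y) ∂(κ ∥ₖ (Kernel.id : Kernel (Sp d) (Sp d))) q)
      (Measurable.lintegral_kernel_prod_right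
        (κ := (κ ∥ₖ (Kernel.id : Kernel (Sp d) (Sp d))).comap Prod.fst measurable_fst)
        (f := fun (q : (Λ × Sp d) × (ℝ × Sp d)) y => f (q.2, y)) (by fun_prop))
  rw [lintegral_prod_symm _ hF.aemeasurable]
  refine lintegral_congr fun ξ => ?_
  rw [lintegral_mixture (f := fun p => f (spread d (p, ξ))) (hf'.comp (measurable_id.prodMk measurable_const))]
  rfl

end Lift

/-- The temporal covariance is a mixture of product measures. -/
def IsMixture (μ : Measure (ℝ × ℝ)) : Prop :=
  ∃ (Λ : Type) (_ : MeasurableSpace Λ) (m : Measure Λ) (κ : Kernel Λ ℝ),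
    SFinite m ∧ IsSFiniteKernel κ ∧ μ = mixture m κ

/-- The integrands of finite energy embed isometrically into an `L²` space. -/
theorem exists_isometry_of_isMixture {d : ℕ} {H₀ : ℝ} {H : Fin d → ℝ}
    (hμ : IsMixture (temporalMeasure H₀)) :
    ∃ (Λ : Type) (_ : MeasurableSpace Λ) (m : Measure Λ) (T : (ℝ → Sp d → ℂ) → Λ → ℂ),
      (∀ g, Measurable (Function.uncurry g) → FiniteEnergy H₀ H g → MemLp (T g) 2 m ∧
        eLpNorm (T g) 2 m ^ 2 = ENNReal.ofReal (energy H₀ H g) ∧ 0 ≤ energy H₀ H g) ∧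
      (∀ g h, Measurable (Function.uncurry g) → Measurable (Function.uncurry h) →
        FiniteEnergy H₀ H g → FiniteEnergy H₀ H h →
        FiniteEnergy H₀ H (fun r ξ => g r ξ - h r ξ) ∧
        T (fun r ξ => g r ξ - h r ξ) =ᵐ[m] fun l => T g l - T h l) := by
  obtain ⟨Λ, _, m, κ, _, _, hμ⟩ := hμ
  have hν : SFinite (spectralMeasure H) := by unfold spectralMeasure; infer_instance
  have hmap : ((temporalMeasure H₀).prod (spectralMeasure H)).map (spread d)
      = mixture (m.prod (spectralMeasure H)) (κ ∥ₖ (Kernel.id : Kernel (Sp d) (Sp d))) := by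
    rw [hμ, map_spread_mixture]
  have hE : ∀ g : ℝ → Sp d → ℂ, energyDensity g
      = fun p => selfTensor (Function.uncurry g) (spread d p) := fun g => rfl
  have hfin : ∀ g : ℝ → Sp d → ℂ, Measurable (Function.uncurry g) →
      (FiniteEnergy H₀ H g ↔ Integrable (selfTensor (Function.uncurry g))
        (mixture (m.prod (spectralMeasure H)) (κ ∥ₖ (Kernel.id : Kernel (Sp d) (Sp d))))) := by
    intro g hg
    rw [← hmap, integrable_map_measure (measurable_selfTensor hg).aestronglyMeasurable
      (measurable_spread d).aemeasurable, FiniteEnergy, hE]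
    rfl
  have hen : ∀ g : ℝ → Sp d → ℂ, Measurable (Function.uncurry g) →
      energy H₀ H g = (∫ p, selfTensor (Function.uncurry g) p ∂(mixture
        (m.prod (spectralMeasure H)) (κ ∥ₖ (Kernel.id : Kernel (Sp d) (Sp d))))).re := by
    intro g hg
    rw [← hmap, integral_map (measurable_spread d).aemeasurable
      (measurable_selfTensor hg).aestronglyMeasurable, energy, hE]
  -- The isometry sends g to (l, ξ) ↦ ∫ g(r, ξ) κ_l(dr).
  refine ⟨Λ × Sp d, inferInstance, m.prod (spectralMeasure H), fun g =>
    mixtureMap (κ ∥ₖ (Kernel.id : Kernel (Sp d) (Sp d))) (Function.uncurry g), ?_, ?_⟩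
  · intro g hg hg'
    rw [hfin g hg] at hg'
    refine ⟨eLpNorm_mixtureMap_lt_top hg hg', ?_, ?_⟩
    · rw [eLpNorm_mixtureMap_sq hg hg', hen g hg]
    · rw [hen g hg, integral_selfTensor_mixture hg', Complex.ofReal_re]
      positivity
  · intro g h hg hh hg' hh'
    rw [hfin g hg] at hg'
    rw [hfin h hh] at hh'
    refine ⟨?_, mixtureMap_sub hg hh hg' hh'⟩
    rw [hfin (fun r ξ => g r ξ - h r ξ) (hg.sub hh)]
    exact integrable_selfTensor_sub hg hh hg' hh'


/-! ### The temporal covariance -/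

/-- The covariance of the increments of fractional Brownian motion over `(c, e]` and
`(c', e']`. -/
noncomputable def incCov (a c e c' e' : ℝ) : ℝ :=
  fbmCov a e e' - fbmCov a e c' - fbmCov a c e' + fbmCov a c c'

lemma intervalIntegrable_abs_rpow {p : ℝ} (hp : -1 < p) (a b : ℝ) :
    IntervalIntegrable (fun x : ℝ => |x| ^ p) volume a b := by
  have h : ∀ c, IntervalIntegrable (fun x : ℝ => |x| ^ p) volume 0 c := by
    have hpos : ∀ c, 0 ≤ c → IntervalIntegrable (fun x : ℝ => |x| ^ p) volume 0 c := by
      intro c hc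
      refine (intervalIntegral.intervalIntegrable_rpow' (a := 0) (b := c) hp).congr ?_
      intro x hx
      rw [Set.uIoc_of_le hc] at hx
      simp [abs_of_pos hx.1]
    intro c
    rcases le_total 0 c with hc | hc
    · exact hpos c hc
    · rw [IntervalIntegrable.iff_comp_neg]
      simpa using hpos (-c) (by linarith)
  exact (h a).symm.trans (h b)

lemma hasDerivAt_mul_abs_rpow {p x : ℝ} (hx : x ≠ 0) :
    HasDerivAt (fun x => x * |x| ^ p) ((p + 1) * |x| ^ p) x := by
  have habs : HasDerivAt (fun y : ℝ => |y|) (SignType.sign x : ℝ) x := hasDerivAt_abs hx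
  have h := (hasDerivAt_id x).mul (habs.rpow_const (p := p) (Or.inl (abs_ne_zero.2 hx)))
  refine h.congr_deriv ?_
  have h2 : |x| ^ p = |x| ^ (p - 1) * |x| := by
    rw [← Real.rpow_add_one (abs_ne_zero.2 hx)]; ring_nf
  have h3 : x * (SignType.sign x : ℝ) = |x| := by
    rw [mul_comm]; exact sign_mul_self x
  simp only [id, one_mul]
  rw [h2]
  linear_combination (p * |x| ^ (p - 1)) * h3

lemma continuous_mul_abs_rpow {p : ℝ} (hp : -1 < p) : Continuous fun x : ℝ => x * |x| ^ p := by
  rw [continuous_iff_continuousAt]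
  intro x
  by_cases hx : x = 0
  · subst hx
    rw [ContinuousAt, tendsto_iff_norm_sub_tendsto_zero]
    have h : Tendsto (fun x : ℝ => |x| ^ (p + 1)) (𝓝 0) (𝓝 0) := by
      have h2 : ContinuousAt (fun x : ℝ => |x| ^ (p + 1)) 0 :=
        (continuous_abs.continuousAt).rpow_const (Or.inr (by linarith))
      have := h2.tendsto
      simpa [Real.zero_rpow (by linarith : p + 1 ≠ 0)] using this
    refine h.congr fun y => ?_
    by_cases hy : y = 0
    · simp [hy, Real.zero_rpow (by linarith : p + 1 ≠ 0)]
    · rw [Real.rpow_add_one (abs_ne_zero.2 hy)]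
      simp [abs_of_nonneg (Real.rpow_nonneg (abs_nonneg y) p), mul_comm]
  · exact (hasDerivAt_mul_abs_rpow hx).continuousAt

lemma integral_abs_rpow {p : ℝ} (hp : -1 < p) (a b : ℝ) :
    ∫ x in a..b, (p + 1) * |x| ^ p = b * |b| ^ p - a * |a| ^ p := by
  -- For p < 0 the antiderivative x|x|^p is continuous but not differentiable at 0, so that point is
  -- excluded.
  refine MeasureTheory.integral_eq_of_hasDerivAt_off_countable (fun x => x * |x| ^ p)
    (fun x => (p + 1) * |x| ^ p) (s := {0}) (Set.countable_singleton 0)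
    (continuous_mul_abs_rpow hp).continuousOn ?_ ?_
  · intro x hx
    exact hasDerivAt_mul_abs_rpow hx.2
  · exact (intervalIntegrable_abs_rpow hp a b).const_mul _

lemma integral_mul_abs_rpow {p : ℝ} (hp : -1 < p) (a b : ℝ) :
    ∫ x in a..b, (p + 2) * (x * |x| ^ p) = |b| ^ (p + 2) - |a| ^ (p + 2) := by
  refine intervalIntegral.integral_eq_sub_of_hasDerivAt (f := fun x : ℝ => |x| ^ (p + 2))
    (fun x _ => ?_) ((continuous_mul_abs_rpow hp).const_smul (p + 2)).continuousOn.intervalIntegrable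
  refine (hasDerivAt_abs_rpow x (by linarith : 1 < p + 2)).congr_deriv ?_
  rw [add_sub_cancel_right]; ring

lemma temporalMeasure_half :
    temporalMeasure (1 / 2) = (volume.restrict (Set.Ioi (0 : ℝ))).map (fun r => (r, r)) := by
  simp [temporalMeasure]

lemma temporalMeasure_of_ne {H₀ : ℝ} (h : H₀ ≠ 1 / 2) : temporalMeasure H₀ =
    ((volume.restrict (Set.Ioi (0 : ℝ))).prod (volume.restrict (Set.Ioi (0 : ℝ)))).withDensity
    fun p => ENNReal.ofReal (H₀ * (2 * H₀ - 1) * |p.1 - p.2| ^ (2 * H₀ - 2)) := by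
  simp only [temporalMeasure, if_neg h]

lemma measurable_temporal_density (H₀ : ℝ) : Measurable fun p : ℝ × ℝ =>
    ENNReal.ofReal (H₀ * (2 * H₀ - 1) * |p.1 - p.2| ^ (2 * H₀ - 2)) := by
  fun_prop

/-- Increments of Brownian motion covary by the length of the overlap of the two intervals. -/
lemma incCov_nonneg_half {a b a' b' : ℝ} (ha : 0 ≤ a) (hab : a ≤ b) (ha' : 0 ≤ a')
    (hab' : a' ≤ b') : incCov (1 / 2) a b a' b' = max (min b b' - max a a') 0 := by
  have hb := ha.trans hab
  have hb' := ha'.trans hab'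
  have h : ∀ x y : ℝ, 0 ≤ x → 0 ≤ y → fbmCov (1 / 2) x y = min x y := by
    intro x y hx hy
    simp only [fbmCov]
    norm_num
    rw [abs_of_nonneg hx, abs_of_nonneg hy]
    rcases le_total x y with h | h
    · rw [abs_of_nonpos (by linarith), min_eq_left h]; ring
    · rw [abs_of_nonneg (by linarith), min_eq_right h]; ring
  rw [incCov, h _ _ hb hb', h _ _ hb ha', h _ _ ha hb', h _ _ ha ha']
  rcases le_total b b' with h1 | h1 <;> rcases le_total b a' with h2 | h2 <;>
  rcases le_total a b' with h3 | h3 <;> rcases le_total a a' with h4 | h4 <;>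
  simp only [h1, h2, h3, h4, min_eq_left, min_eq_right, max_eq_left, max_eq_right] <;>
  first
  | rw [max_eq_left (by linarith)]; linarith
  | rw [max_eq_right (by linarith)]; linarith

/-- The temporal covariance of two bounded intervals. -/
lemma temporalMeasure_rectangle {H₀ : ℝ} (hH₀ : 1 / 2 ≤ H₀) {a b a' b' : ℝ} (ha : 0 ≤ a)
    (hab : a ≤ b) (ha' : 0 ≤ a') (hab' : a' ≤ b') :
    0 ≤ incCov H₀ a b a' b' ∧ temporalMeasure H₀ (Set.Ioc a b ×ˢ Set.Ioc a' b')
      = ENNReal.ofReal (incCov H₀ a b a' b') := by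
  rcases hH₀.eq_or_lt with rfl | h
  · rw [incCov_nonneg_half ha hab ha' hab']
    refine ⟨le_max_right _ _, ?_⟩
    rw [temporalMeasure_half, Measure.map_apply (by fun_prop)
      (measurableSet_Ioc.prod measurableSet_Ioc)]
    have : (fun r : ℝ => (r, r)) ⁻¹' (Set.Ioc a b ×ˢ Set.Ioc a' b')
        = Set.Ioc (max a a') (min b b') := by
      ext x; simp only [Set.mem_preimage, Set.mem_prod, Set.mem_Ioc, max_lt_iff, le_min_iff]; tauto
    rw [this, Measure.restrict_apply measurableSet_Ioc, Set.inter_eq_left.2, Real.volume_Ioc,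
      ENNReal.ofReal_max, ENNReal.ofReal_zero, max_eq_left zero_le]
    intro x hx
    exact (ha.trans (le_max_left _ _)).trans_lt hx.1
  · set p := 2 * H₀ - 2 with hp
    have hp1 : -1 < p := by linarith
    have hsub : ∀ {a b : ℝ}, 0 ≤ a → Set.Ioc a b ⊆ Set.Ioi (0 : ℝ) := fun ha x hx =>
      ha.trans_lt hx.1
    -- The kernel is H₀(p+1)|r-s|^p. One integration yields differences of H₀ x|x|^p, and a second
    -- one (`e2`) yields differences of |x|^{p+2}/2 = |x|^{2H₀}/2, the terms of `incCov`.
    have hinner : ∀ r : ℝ, ∫⁻ s in Set.Ioc a' b',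
        ENNReal.ofReal (H₀ * (2 * H₀ - 1) * |r - s| ^ p)
        = ENNReal.ofReal (H₀ * ((r - a') * |r - a'| ^ p - (r - b') * |r - b'| ^ p)) ∧
        0 ≤ H₀ * ((r - a') * |r - a'| ^ p - (r - b') * |r - b'| ^ p) := by
      intro r
      have e1 : ∫ s in a'..b', H₀ * (2 * H₀ - 1) * |r - s| ^ p
          = H₀ * ((r - a') * |r - a'| ^ p - (r - b') * |r - b'| ^ p) := by
        rw [intervalIntegral.integral_comp_sub_left
          (fun u => H₀ * (2 * H₀ - 1) * |u| ^ p), ← integral_abs_rpow hp1,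
          ← intervalIntegral.integral_const_mul]
        congr 1; ext u; rw [hp]; ring
      have hint : IntervalIntegrable (fun s => H₀ * (2 * H₀ - 1) * |r - s| ^ p) volume a' b' := by
        have := (intervalIntegrable_abs_rpow hp1 (r - a') (r - b')).comp_sub_left r
        simpa using this.const_mul (H₀ * (2 * H₀ - 1))
      have hnn : ∀ s, 0 ≤ H₀ * (2 * H₀ - 1) * |r - s| ^ p := fun s => by
        have : 0 ≤ 2 * H₀ - 1 := by linarith
        have : 0 ≤ H₀ := by linarith
        positivity
      rw [intervalIntegral.integral_of_le hab'] at e1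
      constructor
      · rw [← e1, ofReal_integral_eq_lintegral_ofReal
          ((intervalIntegrable_iff_integrableOn_Ioc_of_le hab').1 hint)
          (Eventually.of_forall hnn)]
      · rw [← e1]; exact integral_nonneg hnn
    have e2 : ∫ r in a..b, H₀ * ((r - a') * |r - a'| ^ p - (r - b') * |r - b'| ^ p)
        = incCov H₀ a b a' b' := by
      have h1 : ∀ c, ∫ r in a..b, (p + 2) * ((r - c) * |r - c| ^ p)
          = |b - c| ^ (p + 2) - |a - c| ^ (p + 2) := by
        intro c
        rw [intervalIntegral.integral_comp_sub_right (fun u => (p + 2) * (u * |u| ^ p)),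
          integral_mul_abs_rpow hp1]
      have hc : ∀ c, IntervalIntegrable (fun r => (p + 2) * ((r - c) * |r - c| ^ p)) volume a b :=
        fun c => (((continuous_mul_abs_rpow hp1).comp
          (continuous_id.sub continuous_const)).const_smul (p + 2)).intervalIntegrable a b
      have h2 : (fun r => H₀ * ((r - a') * |r - a'| ^ p - (r - b') * |r - b'| ^ p))
          = fun r => (1 / 2) * ((p + 2) * ((r - a') * |r - a'| ^ p)
            - (p + 2) * ((r - b') * |r - b'| ^ p)) := by
        ext r; rw [hp]; ring
      rw [h2, intervalIntegral.integral_const_mul, intervalIntegral.integral_sub (hc _) (hc _),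
        h1, h1]
      have h3 : p + 2 = 2 * H₀ := by rw [hp]; ring
      simp only [incCov, fbmCov, h3]
      ring
    have hcont : Continuous fun r => H₀ * ((r - a') * |r - a'| ^ p - (r - b') * |r - b'| ^ p) := by
      have := continuous_mul_abs_rpow hp1
      exact continuous_const.mul ((this.comp (continuous_id.sub continuous_const)).sub
        (this.comp (continuous_id.sub continuous_const)))
    rw [intervalIntegral.integral_of_le hab] at e2
    refine ⟨by rw [← e2]; exact integral_nonneg fun r => (hinner r).2, ?_⟩
    rw [temporalMeasure_of_ne (ne_of_gt h), withDensity_apply _ (measurableSet_Ioc.prod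
      measurableSet_Ioc), Measure.prod_restrict, Measure.restrict_restrict
      (measurableSet_Ioc.prod measurableSet_Ioc), Set.prod_inter_prod,
      Set.inter_eq_left.2 (hsub ha), Set.inter_eq_left.2 (hsub ha'), ← Measure.prod_restrict,
      lintegral_prod _ (measurable_temporal_density H₀).aemeasurable]
    simp only [← hp, fun r => (hinner r).1]
    rw [← e2, ofReal_integral_eq_lintegral_ofReal _ (Eventually.of_forall fun r => (hinner r).2)]
    exact (intervalIntegrable_iff_integrableOn_Ioc_of_le hab).1 (hcont.intervalIntegrable a b)

instance sFinite_temporalMeasure (H₀ : ℝ) : SFinite (temporalMeasure H₀) := by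
  unfold temporalMeasure; split_ifs <;> infer_instance

lemma integral_indicator_temporalMeasure {H₀ : ℝ} (hH₀ : 1 / 2 ≤ H₀) {a b a' b' : ℝ}
    (ha : 0 ≤ a) (hab : a ≤ b) (ha' : 0 ≤ a') (hab' : a' ≤ b') :
    Integrable (fun p : ℝ × ℝ => (Set.Ioc a b).indicator (1 : ℝ → ℝ) p.1 *
      (Set.Ioc a' b').indicator (1 : ℝ → ℝ) p.2) (temporalMeasure H₀) ∧
    ∫ p : ℝ × ℝ, (Set.Ioc a b).indicator (1 : ℝ → ℝ) p.1 *
      (Set.Ioc a' b').indicator (1 : ℝ → ℝ) p.2 ∂temporalMeasure H₀ = incCov H₀ a b a' b' := by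
  obtain ⟨h0, h1⟩ := temporalMeasure_rectangle hH₀ ha hab ha' hab'
  have he : (fun p : ℝ × ℝ => (Set.Ioc a b).indicator (1 : ℝ → ℝ) p.1 *
      (Set.Ioc a' b').indicator (1 : ℝ → ℝ) p.2)
      = (Set.Ioc a b ×ˢ Set.Ioc a' b').indicator fun _ => 1 := by
    ext p
    simp only [Set.indicator, Set.mem_prod, Pi.one_apply]
    split_ifs <;> simp_all
  have hm := (measurableSet_Ioc (a := a) (b := b)).prod (measurableSet_Ioc (a := a') (b := b'))
  rw [he]
  constructor
  · rw [integrable_indicator_iff hm]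
    exact integrableOn_const (by rw [h1]; exact ENNReal.ofReal_ne_top)
  · rw [integral_indicator_const _ hm, Measure.real, h1, ENNReal.toReal_ofReal h0, smul_eq_mul,
      mul_one]

/-! ### The temporal covariance as a mixture -/

/-- Lebesgue measure on the diagonal is ∫ δ_r ⊗ δ_r dr. -/
lemma isMixture_temporalMeasure_half : IsMixture (temporalMeasure (1 / 2)) := by
  refine ⟨ℝ, inferInstance, volume.restrict (Set.Ioi 0), Kernel.id, inferInstance, inferInstance,
    ?_⟩
  refine Measure.ext_of_lintegral _ fun f hf => ?_
  rw [lintegral_mixture hf, temporalMeasure_half, lintegral_map hf (by fun_prop)]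
  refine lintegral_congr fun r => ?_
  rw [Kernel.id_apply, lintegral_dirac' _ (by
    simp_rw [lintegral_dirac]; fun_prop), lintegral_dirac]

lemma temporalMeasure_one : temporalMeasure 1
    = (volume.restrict (Set.Ioi (0 : ℝ))).prod (volume.restrict (Set.Ioi (0 : ℝ))) := by
  rw [temporalMeasure_of_ne (by norm_num)]
  norm_num

/-- Here the covariance density is constantly 1, so a single product measure suffices. -/
lemma isMixture_temporalMeasure_one : IsMixture (temporalMeasure 1) := by
  refine ⟨Unit, inferInstance, Measure.dirac (), Kernel.const _ (volume.restrict (Set.Ioi 0)),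
    inferInstance, inferInstance, ?_⟩
  refine Measure.ext_of_lintegral _ fun f hf => ?_
  rw [lintegral_mixture hf, temporalMeasure_one, lintegral_dirac,
    lintegral_prod _ hf.aemeasurable]
  simp

/-- The indicator function of the window `(v, v + l]`. -/
noncomputable def window (q : ℝ × ℝ) (r : ℝ) : ℝ≥0∞ :=
  {z : (ℝ × ℝ) × ℝ | z.1.1 < z.2 ∧ z.2 ≤ z.1.1 + z.1.2}.indicator 1 (q, r)

lemma measurable_window : Measurable (Function.uncurry window) := by
  have h1 : MeasurableSet {z : (ℝ × ℝ) × ℝ | z.1.1 < z.2} :=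
    measurableSet_lt (by fun_prop) (by fun_prop)
  have h2 : MeasurableSet {z : (ℝ × ℝ) × ℝ | z.2 ≤ z.1.1 + z.1.2} :=
    measurableSet_le (by fun_prop) (by fun_prop)
  have : MeasurableSet {z : (ℝ × ℝ) × ℝ | z.1.1 < z.2 ∧ z.2 ≤ z.1.1 + z.1.2} := h1.inter h2
  exact measurable_one.indicator this

/-- Lebesgue measure on the part in `(0, ∞)` of the window `(v, v + l]`. -/
noncomputable def windowKernel : Kernel (ℝ × ℝ) ℝ :=
  (Kernel.const (ℝ × ℝ) (volume.restrict (Set.Ioi (0 : ℝ)))).withDensity window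

instance isSFiniteKernel_windowKernel : IsSFiniteKernel windowKernel :=
  Kernel.IsSFiniteKernel.withDensity _ fun q r => by
    unfold window; by_cases h : (q, r) ∈ {z : (ℝ × ℝ) × ℝ | z.1.1 < z.2 ∧ z.2 ≤ z.1.1 + z.1.2} <;>
      simp [h]

/-- The weight of windows of length `l`. -/
noncomputable def windowWeight (H₀ l : ℝ) : ℝ :=
  H₀ * (2 * H₀ - 1) * ((2 - 2 * H₀) * (3 - 2 * H₀)) * l ^ (2 * H₀ - 4)

/-- The measure on windows that yields the temporal covariance. -/
noncomputable def windowMeasure (H₀ : ℝ) : Measure (ℝ × ℝ) :=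
  volume.prod ((volume.restrict (Set.Ioi (0 : ℝ))).withDensity
    fun l => ENNReal.ofReal (windowWeight H₀ l))

instance sFinite_windowMeasure (H₀ : ℝ) : SFinite (windowMeasure H₀) := by
  unfold windowMeasure; infer_instance

/-- The denominators 2H-2 and 2H-3 come from the two power integrals in `lintegral_windowWeight`;
the factors (2-2H)(3-2H) of the weight cancel them. -/
lemma windowWeight_const_eq {H x Y : ℝ} (n3 : 2 * H - 3 ≠ 0) (n4 : 2 * H - 2 ≠ 0) :
    H * (2 * H - 1) * ((2 - 2 * H) * (3 - 2 * H)) *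
      (-(x * Y) / (2 * H - 2) - x * (-Y / (2 * H - 3))) = H * (2 * H - 1) * (x * Y) := by
  rw [show 2 - 2 * H = -(2 * H - 2) by ring, show 3 - 2 * H = -(2 * H - 3) by ring]
  rw [show 2 * H - 2 = (2 * H - 3) + 1 by ring] at n4 ⊢
  generalize 2 * H - 3 = u at *
  generalize 2 * H - 1 = w at *
  field_simp
  ring

/-- A convex function f decaying at infinity satisfies f(x) = ∫ f''(l)(l-x)₊ dl. With f(x) =
H₀(2H₀-1)x^{2H₀-2}, the weight is exactly f''. The positive part is supplied by `ENNReal.ofReal`. -/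
lemma lintegral_windowWeight {H₀ : ℝ} (h : 1 / 2 < H₀) (h' : H₀ < 1) {x : ℝ} (hx : 0 < x) :
    ∫⁻ l in Set.Ioi (0 : ℝ), ENNReal.ofReal (windowWeight H₀ l) * ENNReal.ofReal (l - x)
      = ENNReal.ofReal (H₀ * (2 * H₀ - 1) * x ^ (2 * H₀ - 2)) := by
  set C := H₀ * (2 * H₀ - 1) * ((2 - 2 * H₀) * (3 - 2 * H₀)) with hC
  have hCpos : 0 ≤ C := by
    have h1 : 0 ≤ 2 * H₀ - 1 := by linarith
    have h2 : 0 ≤ 2 - 2 * H₀ := by linarith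
    have h3 : 0 ≤ 3 - 2 * H₀ := by linarith
    have : 0 ≤ H₀ := by linarith
    positivity
  have e1 : ∫⁻ l in Set.Ioi (0 : ℝ), ENNReal.ofReal (windowWeight H₀ l) * ENNReal.ofReal (l - x)
      = ∫⁻ l in Set.Ioi x, ENNReal.ofReal (windowWeight H₀ l) * ENNReal.ofReal (l - x) := by
    rw [← lintegral_indicator measurableSet_Ioi, ← lintegral_indicator measurableSet_Ioi]
    refine lintegral_congr fun l => ?_
    by_cases hl : x < l
    · rw [Set.indicator_of_mem (show l ∈ Set.Ioi (0 : ℝ) from hx.trans hl), Set.indicator_of_mem (show l ∈ Set.Ioi x from hl)]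
    · rw [Set.indicator_of_notMem (s := Set.Ioi x) hl, Set.indicator_apply_eq_zero]
      intro _
      rw [ENNReal.ofReal_of_nonpos (by linarith : l - x ≤ 0), mul_zero]
  have e2 : ∫⁻ l in Set.Ioi x, ENNReal.ofReal (windowWeight H₀ l) * ENNReal.ofReal (l - x)
      = ∫⁻ l in Set.Ioi x,
        ENNReal.ofReal (C * (l ^ (2 * H₀ - 3) - x * l ^ (2 * H₀ - 4))) := by
    refine setLIntegral_congr_fun measurableSet_Ioi fun l hl => ?_
    have hl0 : 0 < l := hx.trans hl
    rw [← ENNReal.ofReal_mul (by unfold windowWeight; positivity), windowWeight, ← hC]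
    congr 1
    have : l ^ (2 * H₀ - 3) = l ^ (2 * H₀ - 4) * l := by
      rw [← Real.rpow_add_one hl0.ne']; ring_nf
    rw [this]; ring
  have i1 := integrableOn_Ioi_rpow_of_lt (by linarith : 2 * H₀ - 3 < -1) hx
  have i2 := integrableOn_Ioi_rpow_of_lt (by linarith : 2 * H₀ - 4 < -1) hx
  have i3 : IntegrableOn (fun l : ℝ => C * (l ^ (2 * H₀ - 3) - x * l ^ (2 * H₀ - 4)))
    (Set.Ioi x) := (i1.sub (i2.const_mul x)).const_mul C
  rw [e1, e2, ← ofReal_integral_eq_lintegral_ofReal i3]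
  · congr 1
    rw [integral_const_mul, integral_sub i1 (i2.const_mul x), integral_const_mul,
      integral_Ioi_rpow_of_lt (by linarith) hx, integral_Ioi_rpow_of_lt (by linarith) hx]
    have e3 : x ^ (2 * H₀ - 2) = x * x ^ (2 * H₀ - 3) := by
      rw [show 2 * H₀ - 2 = 2 * H₀ - 3 + 1 by ring, Real.rpow_add_one hx.ne', mul_comm]
    have n1 : 2 * H₀ - 3 + 1 ≠ 0 := by linarith
    have n2 : 2 * H₀ - 4 + 1 ≠ 0 := by linarith
    rw [show 2 * H₀ - 4 + 1 = 2 * H₀ - 3 by ring, show 2 * H₀ - 3 + 1 = 2 * H₀ - 2 by ring,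
      e3, hC]
    have n3 : 2 * H₀ - 3 ≠ 0 := by linarith
    have n4 : 2 * H₀ - 2 ≠ 0 := by linarith
    exact windowWeight_const_eq n3 n4
  · refine (ae_restrict_iff' measurableSet_Ioi).2 (Eventually.of_forall fun l hl => ?_)
    have hl0 : 0 < l := hx.trans hl
    have : l ^ (2 * H₀ - 3) = l ^ (2 * H₀ - 4) * l := by
      rw [← Real.rpow_add_one hl0.ne']; ring_nf
    simp only [Pi.zero_apply]
    rw [this, mul_comm x, ← mul_sub]
    have : 0 ≤ l - x := by linarith [Set.mem_Ioi.1 hl]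
    positivity

/-- Both r and s lie in (v, v+l] exactly for v in [max r s - l, min r s), which is empty when l ≤
|r-s|. -/
lemma volume_window_inter (r s l : ℝ) :
    ∫⁻ v, window (v, l) r * window (v, l) s = ENNReal.ofReal (l - |r - s|) := by
  have h : (fun v => window (v, l) r * window (v, l) s)
      = (Set.Ico (max r s - l) (min r s)).indicator 1 := by
    ext v
    simp only [window, Set.indicator, Set.mem_ofPred_eq, Set.mem_Ico, Pi.one_apply,
      sub_le_iff_le_add, lt_min_iff, max_le_iff]
    split_ifs <;> simp_all
  rw [h, lintegral_indicator_one measurableSet_Ico, Real.volume_Ico]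
  congr 1
  rcases le_total r s with h | h
  · rw [max_eq_right h, min_eq_left h, abs_of_nonpos (by linarith)]; ring
  · rw [max_eq_left h, min_eq_right h, abs_of_nonneg (by linarith)]; ring

lemma measurable_windowWeight (H₀ : ℝ) : Measurable (windowWeight H₀) := by
  unfold windowWeight; fun_prop

/-- By Tonelli, the mixture has density ∫ weight(l) (l - |r-s|)₊ dl with respect to Lebesgue measure
on the quadrant, and `lintegral_windowWeight` evaluates it. -/
lemma temporalMeasure_eq_mixture {H₀ : ℝ} (h : 1 / 2 < H₀) (h' : H₀ < 1) :
    temporalMeasure H₀ = mixture (windowMeasure H₀) windowKernel := by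
  refine Measure.ext_of_lintegral _ fun f hf => ?_
  rw [lintegral_mixture hf, temporalMeasure_of_ne (ne_of_gt h),
    lintegral_withDensity_eq_lintegral_mul _ (measurable_temporal_density H₀) hf]
  set μ₀ := volume.restrict (Set.Ioi (0 : ℝ))
  have hw : ∀ q, Measurable (window q) := fun q =>
    measurable_window.comp (measurable_const.prodMk measurable_id)
  have hk : ∀ q (g : ℝ → ℝ≥0∞), Measurable g →
      ∫⁻ r, g r ∂windowKernel q = ∫⁻ r, window q r * g r ∂μ₀ := by
    intro q g hg
    rw [windowKernel, Kernel.lintegral_withDensity _ measurable_window _ hg, Kernel.const_apply]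
  have e1 : ∀ q, ∫⁻ r, ∫⁻ s, f (r, s) ∂windowKernel q ∂windowKernel q
      = ∫⁻ p, window q p.1 * window q p.2 * f p ∂(μ₀.prod μ₀) := by
    intro q
    have hq := hw q
    rw [lintegral_prod _ (by fun_prop), hk _ _ (hf.lintegral_prod_right')]
    refine lintegral_congr fun r => ?_
    rw [hk _ _ (by fun_prop), ← lintegral_const_mul _ (by fun_prop)]
    simp_rw [mul_assoc]
  simp_rw [e1]
  have hm1 : Measurable fun z : (ℝ × ℝ) × (ℝ × ℝ) => window z.1 z.2.1 :=
    measurable_window.comp (measurable_fst.prodMk (measurable_fst.comp measurable_snd))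
  have hm2 : Measurable fun z : (ℝ × ℝ) × (ℝ × ℝ) => window z.1 z.2.2 :=
    measurable_window.comp (measurable_fst.prodMk (measurable_snd.comp measurable_snd))
  rw [lintegral_lintegral_swap (f := fun q p => window q p.1 * window q p.2 * f p)
    ((hm1.mul hm2).mul (hf.comp measurable_snd)).aemeasurable]
  -- On the diagonal the two densities differ: `rpow` gives 0 to a negative power the value 0, while
  -- the window integral diverges. The diagonal is null.
  have hdiag : ∀ᵐ p ∂μ₀.prod μ₀, p.1 ≠ p.2 := by
    rw [Measure.ae_prod_iff_ae_ae]
    · refine Eventually.of_forall fun r => ?_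
      have : ∀ᵐ s ∂μ₀, s ≠ r := ae_restrict_of_ae (Measure.ae_ne volume r)
      filter_upwards [this] with s hs using hs.symm
    · exact (measurableSet_eq_fun measurable_fst measurable_snd).compl
  refine lintegral_congr_ae (hdiag.mono fun p hp => ?_)
  have hp' : 0 < |p.1 - p.2| := abs_pos.2 (sub_ne_zero.2 hp)
  have hm3 : Measurable fun q : ℝ × ℝ => window q p.1 * window q p.2 :=
    (measurable_window.comp (measurable_id.prodMk measurable_const)).mul
    (measurable_window.comp (measurable_id.prodMk measurable_const))
  simp only [Pi.mul_apply]
  rw [lintegral_mul_const _ hm3, windowMeasure, lintegral_prod_symm _ hm3.aemeasurable]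
  simp_rw [volume_window_inter]
  rw [lintegral_withDensity_eq_lintegral_mul _ (measurable_windowWeight H₀).ennreal_ofReal
    (by fun_prop)]
  simp only [Pi.mul_apply]
  rw [lintegral_windowWeight h h' hp']

theorem isMixture_temporalMeasure {H₀ : ℝ} (h : 1 / 2 ≤ H₀) (h' : H₀ ≤ 1) :
    IsMixture (temporalMeasure H₀) := by
  rcases h.eq_or_lt with rfl | h
  · exact isMixture_temporalMeasure_half
  rcases h'.eq_or_lt with rfl | h'
  · exact isMixture_temporalMeasure_one
  · exact ⟨ℝ × ℝ, inferInstance, windowMeasure H₀, windowKernel, inferInstance, inferInstance,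
      temporalMeasure_eq_mixture h h'⟩


/-! ### The spectral representation of fractional Brownian motion -/

/-- Integrability comes for free: a non-integrable function would have Bochner integral 0, not v >
0. -/
lemma setLIntegral_ofReal_Ioi {f : ℝ → ℝ} {v : ℝ} (hf : ∀ x ∈ Set.Ioi (0 : ℝ), 0 ≤ f x)
    (hv : ∫ x in Set.Ioi (0 : ℝ), f x = v) (hv0 : 0 < v) :
    ∫⁻ x in Set.Ioi (0 : ℝ), ENNReal.ofReal (f x) = ENNReal.ofReal v := by
  rw [← hv, ofReal_integral_eq_lintegral_ofReal
    (Integrable.of_integral_ne_zero (by rw [hv]; exact hv0.ne'))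
    ((ae_restrict_iff' measurableSet_Ioi).2 (Eventually.of_forall hf))]

lemma integral_one_sub_cos_mul_exp {u : ℝ} (hu : 0 < u) :
    ∫ x in Set.Ioi (0 : ℝ), (1 - Real.cos x) * Real.exp (-(u * x)) = 1 / (u * (1 + u ^ 2)) := by
  have h1 : (1 + u ^ 2) ≠ 0 := by positivity
  -- The two summands are antiderivatives of e^{-ux} and of -cos(x) e^{-ux}.
  set g : ℝ → ℝ := fun x => - Real.exp (-(u * x)) / u
    - Real.exp (-(u * x)) * (Real.sin x - u * Real.cos x) / (1 + u ^ 2) with hg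
  have hd : ∀ x, HasDerivAt g ((1 - Real.cos x) * Real.exp (-(u * x))) x := by
    intro x
    have he : HasDerivAt (fun x => Real.exp (-(u * x))) (Real.exp (-(u * x)) * (-(u * 1))) x :=
      (((hasDerivAt_id x).const_mul u).neg).exp
    have h := (he.neg.div_const u).sub ((he.mul ((Real.hasDerivAt_sin x).sub
      ((Real.hasDerivAt_cos x).const_mul u))).div_const (1 + u ^ 2))
    refine h.congr_deriv ?_
    simp only [Pi.sub_apply]
    field_simp
    ring
  have he : Tendsto (fun x => Real.exp (-(u * x))) atTop (𝓝 0) :=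
    Real.tendsto_exp_neg_atTop_nhds_zero.comp (tendsto_id.const_mul_atTop hu)
  have hlim : Tendsto g atTop (𝓝 0) := by
    have h2 : Tendsto (fun x => Real.exp (-(u * x)) * (Real.sin x - u * Real.cos x)) atTop
        (𝓝 0) := by
      refine squeeze_zero_norm (a := fun x => Real.exp (-(u * x)) * (1 + u)) (fun x => ?_) ?_
      · rw [norm_mul, Real.norm_of_nonneg (Real.exp_pos _).le]
        gcongr
        refine (norm_sub_le _ _).trans ?_
        rw [norm_mul, Real.norm_of_nonneg hu.le]
        gcongr
        · exact Real.abs_sin_le_one x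
        · exact mul_le_of_le_one_right hu.le (Real.abs_cos_le_one x)
      · simpa using he.mul_const (1 + u)
    simpa using (he.neg.div_const u).sub (h2.div_const (1 + u ^ 2))
  rw [integral_Ioi_of_hasDerivAt_of_nonneg' (fun x _ => hd x) (fun x _ => ?_) hlim]
  · simp only [hg, mul_zero, neg_zero, Real.exp_zero, Real.sin_zero, Real.cos_zero]
    field_simp
    ring
  · exact mul_nonneg (by linarith [Real.cos_le_one x]) (Real.exp_pos _).le

/-- Write 1/(1+u²) = ∫ e^{-v(1+u²)} dv and apply Tonelli: the u-integral is Γ(h)v^{-h}/2, and the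
remaining v-integral is Γ(1-h). -/
lemma lintegral_rpow_div_one_add_sq {h : ℝ} (h0 : 0 < h) (h1 : h < 1) :
    ∫⁻ u in Set.Ioi (0 : ℝ), ENNReal.ofReal (u ^ (2 * h - 1) * (1 / (1 + u ^ 2)))
      = ENNReal.ofReal (1 / 2 * (Real.Gamma h * Real.Gamma (1 - h))) := by
  have e1 : ∀ u ∈ Set.Ioi (0 : ℝ), ENNReal.ofReal (u ^ (2 * h - 1) * (1 / (1 + u ^ 2)))
      = ∫⁻ v in Set.Ioi (0 : ℝ),
        ENNReal.ofReal (Real.exp (-v) * (u ^ (2 * h - 1) * Real.exp (-v * u ^ (2 : ℝ)))) := by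
    intro u hu
    have hu0 : 0 < u := hu
    refine (setLIntegral_ofReal_Ioi (fun v _ => by positivity) ?_ (by positivity)).symm
    have := Real.integral_rpow_mul_exp_neg_mul_Ioi (a := 1) (r := 1 + u ^ 2) one_pos (by positivity)
    simp only [sub_self, Real.rpow_zero, one_mul, Real.rpow_one, Real.Gamma_one, mul_one] at this
    rw [← this, ← integral_const_mul]
    congr 1; ext v
    rw [mul_left_comm, ← Real.exp_add]
    congr 2
    rw [Real.rpow_two]; ring
  rw [setLIntegral_congr_fun measurableSet_Ioi e1, lintegral_lintegral_swap (by
    refine Measurable.aemeasurable ?_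
    change Measurable fun p : ℝ × ℝ =>
      ENNReal.ofReal (Real.exp (-p.2) * (p.1 ^ (2 * h - 1) * Real.exp (-p.2 * p.1 ^ (2 : ℝ))))
    fun_prop)]
  have e2 : ∀ v ∈ Set.Ioi (0 : ℝ), ∫⁻ u in Set.Ioi (0 : ℝ),
      ENNReal.ofReal (Real.exp (-v) * (u ^ (2 * h - 1) * Real.exp (-v * u ^ (2 : ℝ))))
      = ENNReal.ofReal (1 / 2 * Real.Gamma h * (Real.exp (-v) * v ^ ((1 - h) - 1))) := by
    intro v hv
    have hv0 : 0 < v := hv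
    have hG := Real.Gamma_pos_of_pos h0
    refine setLIntegral_ofReal_Ioi (fun u hu => ?_) ?_ (by positivity)
    · have hu0 : 0 < u := hu
      positivity
    · rw [integral_const_mul, integral_rpow_mul_exp_neg_mul_rpow two_pos (by linarith) hv0]
      rw [show (2 * h - 1 + 1) / 2 = h by ring, show -(2 * h - 1 + 1) / 2 = (1 - h) - 1 by ring]
      ring
  rw [setLIntegral_congr_fun measurableSet_Ioi e2]
  have hG := Real.Gamma_pos_of_pos h0
  have hG' := Real.Gamma_pos_of_pos (by linarith : 0 < 1 - h)
  refine setLIntegral_ofReal_Ioi (fun u hu => ?_) ?_ (by positivity)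
  · have hu0 : 0 < u := hu
    positivity
  · rw [integral_const_mul, ← Real.Gamma_eq_integral (by linarith)]; ring

/-- Write x^{-1-2h} = Γ(2h+1)⁻¹ ∫ u^{2h} e^{-xu} du. By Tonelli the x-integral becomes the Laplace
transform of 1 - cos, leaving `lintegral_rpow_div_one_add_sq`; the reflection formula then turns
Γ(h)Γ(1-h) into π/sin(πh). -/
lemma lintegral_one_sub_cos_mul_rpow {h : ℝ} (h0 : 0 < h) (h1 : h < 1) :
    ∫⁻ x in Set.Ioi (0 : ℝ), ENNReal.ofReal ((1 - Real.cos x) * x ^ (-1 - 2 * h))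
      = ENNReal.ofReal (Real.pi / (2 * Real.Gamma (2 * h + 1) * Real.sin (Real.pi * h))) := by
  have hG := Real.Gamma_pos_of_pos (by linarith : 0 < 2 * h + 1)
  have hcos : ∀ x, 0 ≤ 1 - Real.cos x := fun x => by linarith [Real.cos_le_one x]
  have e1 : ∀ x ∈ Set.Ioi (0 : ℝ), ENNReal.ofReal ((1 - Real.cos x) * x ^ (-1 - 2 * h))
      = ENNReal.ofReal (1 / Real.Gamma (2 * h + 1)) * ∫⁻ u in Set.Ioi (0 : ℝ),
        ENNReal.ofReal (1 - Real.cos x) *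
          ENNReal.ofReal (u ^ (2 * h) * Real.exp (-(x * u))) := by
    intro x hx
    have hx0 : 0 < x := hx
    have := Real.integral_rpow_mul_exp_neg_mul_Ioi (a := 2 * h + 1) (r := x) (by linarith) hx0
    rw [add_sub_cancel_right] at this
    rw [lintegral_const_mul _ (by fun_prop), setLIntegral_ofReal_Ioi (fun u hu => ?_) this
      (by positivity), ← ENNReal.ofReal_mul (hcos x), ← ENNReal.ofReal_mul (by positivity)]
    · congr 1
      rw [one_div x, Real.inv_rpow hx0.le, ← Real.rpow_neg hx0.le,
        show -(2 * h + 1) = -1 - 2 * h by ring]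
      field_simp
    · have hu0 : 0 < u := hu
      positivity
  rw [setLIntegral_congr_fun measurableSet_Ioi e1, lintegral_const_mul' _ _ ENNReal.ofReal_ne_top,
    lintegral_lintegral_swap (by
    refine Measurable.aemeasurable ?_
    change Measurable fun p : ℝ × ℝ => ENNReal.ofReal (1 - Real.cos p.1) *
          ENNReal.ofReal (p.2 ^ (2 * h) * Real.exp (-(p.1 * p.2)))
    fun_prop)]
  have e2 : ∀ u ∈ Set.Ioi (0 : ℝ), ∫⁻ x in Set.Ioi (0 : ℝ), ENNReal.ofReal (1 - Real.cos x) *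
          ENNReal.ofReal (u ^ (2 * h) * Real.exp (-(x * u)))
      = ENNReal.ofReal (u ^ (2 * h - 1) * (1 / (1 + u ^ 2))) := by
    intro u hu
    have hu0 : 0 < u := hu
    simp_rw [← fun x => ENNReal.ofReal_mul (q := u ^ (2 * h) * Real.exp (-(x * u))) (hcos x)]
    refine setLIntegral_ofReal_Ioi (fun x _ => mul_nonneg (hcos x) (by positivity)) ?_
      (by positivity)
    have e3 : ∀ x, (1 - Real.cos x) * (u ^ (2 * h) * Real.exp (-(x * u)))
        = u ^ (2 * h) * ((1 - Real.cos x) * Real.exp (-(u * x))) := by intro x; ring_nf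
    simp_rw [e3]
    rw [integral_const_mul, integral_one_sub_cos_mul_exp hu0, Real.rpow_sub_one hu0.ne']
    field_simp
  rw [setLIntegral_congr_fun measurableSet_Ioi e2, lintegral_rpow_div_one_add_sq h0 h1,
    ← ENNReal.ofReal_mul (by positivity), Real.Gamma_mul_Gamma_one_sub]
  congr 1
  have hs : 0 < Real.sin (Real.pi * h) := Real.sin_pos_of_pos_of_lt_pi (by positivity)
    (by nlinarith [Real.pi_pos])
  field_simp

lemma sin_pi_mul_pos {h : ℝ} (h0 : 0 < h) (h1 : h < 1) : 0 < Real.sin (Real.pi * h) :=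
  Real.sin_pos_of_pos_of_lt_pi (by positivity) (by nlinarith [Real.pi_pos])

/-- The constant `C_h = Γ(2h + 1) sin(π h) / (2π)`. -/
noncomputable def specConst (h : ℝ) : ℝ :=
  Real.Gamma (2 * h + 1) * Real.sin (Real.pi * h) / (2 * Real.pi)

lemma specConst_pos {h : ℝ} (h0 : 0 < h) (h1 : h < 1) : 0 < specConst h := by
  have := Real.Gamma_pos_of_pos (by linarith : 0 < 2 * h + 1)
  have := sin_pi_mul_pos h0 h1
  have := Real.pi_pos
  unfold specConst; positivity

/-- The one-dimensional spectral density `C_h |x|^{1 - 2h}`. -/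
noncomputable def specDensity (h x : ℝ) : ℝ := specConst h * |x| ^ (1 - 2 * h)

lemma specDensity_nonneg {h : ℝ} (h0 : 0 < h) (h1 : h < 1) (x : ℝ) : 0 ≤ specDensity h x := by
  have := specConst_pos h0 h1
  unfold specDensity; positivity

lemma measurable_specDensity (h : ℝ) : Measurable (specDensity h) := by
  unfold specDensity; fun_prop

lemma integral_one_sub_cos_Ioi {h a : ℝ} (h0 : 0 < h) (h1 : h < 1) (ha : 0 < a) :
    ∫ x in Set.Ioi (0 : ℝ), (1 - Real.cos (a * x)) * x ^ (-1 - 2 * h)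
      = a ^ (2 * h) * (Real.pi / (2 * Real.Gamma (2 * h + 1) * Real.sin (Real.pi * h))) := by
  have hG := Real.Gamma_pos_of_pos (by linarith : 0 < 2 * h + 1)
  have hs := sin_pi_mul_pos h0 h1
  have hpi := Real.pi_pos
  have hcos : ∀ x, 0 ≤ 1 - Real.cos x := fun x => by linarith [Real.cos_le_one x]
  have e0 : ∫ x in Set.Ioi (0 : ℝ), (1 - Real.cos x) * x ^ (-1 - 2 * h)
      = Real.pi / (2 * Real.Gamma (2 * h + 1) * Real.sin (Real.pi * h)) := by
    rw [integral_eq_lintegral_of_nonneg_ae, lintegral_one_sub_cos_mul_rpow h0 h1,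
      ENNReal.toReal_ofReal (by positivity)]
    · refine (ae_restrict_iff' measurableSet_Ioi).2 (Eventually.of_forall fun x hx => ?_)
      have hx0 : (0 : ℝ) < x := hx
      exact mul_nonneg (hcos x) (by positivity)
    · exact Measurable.aestronglyMeasurable (by fun_prop)
  have e1 := integral_comp_mul_left_Ioi (fun x : ℝ => (1 - Real.cos x) * x ^ (-1 - 2 * h)) 0 ha
  rw [mul_zero, e0] at e1
  have e2 : ∫ x in Set.Ioi (0 : ℝ), (1 - Real.cos (a * x)) * (a * x) ^ (-1 - 2 * h)
      = a ^ (-1 - 2 * h) * ∫ x in Set.Ioi (0 : ℝ), (1 - Real.cos (a * x)) * x ^ (-1 - 2 * h) := by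
    rw [← integral_const_mul]
    refine setIntegral_congr_fun measurableSet_Ioi fun x hx => ?_
    have hx0 : (0 : ℝ) < x := hx
    rw [Real.mul_rpow ha.le hx0.le]; ring
  rw [e2] at e1
  have e3 : a ^ (-1 - 2 * h) * (a ^ (2 * h) * a) = 1 := by
    rw [← Real.rpow_add_one ha.ne', ← Real.rpow_add ha, show -1 - 2 * h + (2 * h + 1) = 0 by ring,
      Real.rpow_zero]
  set K := Real.pi / (2 * Real.Gamma (2 * h + 1) * Real.sin (Real.pi * h))
  set J := ∫ x in Set.Ioi (0 : ℝ), (1 - Real.cos (a * x)) * x ^ (-1 - 2 * h)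
  have e4 : a * (a⁻¹ • K) = K := by rw [smul_eq_mul]; field_simp
  calc J = (a ^ (-1 - 2 * h) * (a ^ (2 * h) * a)) * J := by rw [e3, one_mul]
    _ = a ^ (2 * h) * (a * (a ^ (-1 - 2 * h) * J)) := by ring
    _ = a ^ (2 * h) * K := by rw [e1, e4]

/-- Scaling extracts |a|^{2h}, and evenness doubles the half-line integral. The normalisation C_h
makes the remaining constant 2 · C_h · π/(2Γ(2h+1) sin(πh)) = 1/2. -/
lemma integral_one_sub_cos {h : ℝ} (h0 : 0 < h) (h1 : h < 1) (a : ℝ) :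
    Integrable (fun x : ℝ => specConst h * ((1 - Real.cos (a * x)) * |x| ^ (-1 - 2 * h))) ∧
    ∫ x : ℝ, specConst h * ((1 - Real.cos (a * x)) * |x| ^ (-1 - 2 * h))
      = |a| ^ (2 * h) / 2 := by
  by_cases ha : a = 0
  · subst ha
    simp [Real.zero_rpow (by linarith : 2 * h ≠ 0)]
  have hG := Real.Gamma_pos_of_pos (by linarith : 0 < 2 * h + 1)
  have hs := sin_pi_mul_pos h0 h1
  have hpi := Real.pi_pos
  have ha' : 0 < |a| := abs_pos.2 ha
  have e1 : ∫ x : ℝ, specConst h * ((1 - Real.cos (a * x)) * |x| ^ (-1 - 2 * h))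
      = |a| ^ (2 * h) / 2 := by
    rw [integral_const_mul]
    have : ∀ x : ℝ, (1 - Real.cos (a * x)) * |x| ^ (-1 - 2 * h)
        = (fun y => (1 - Real.cos (|a| * y)) * y ^ (-1 - 2 * h)) |x| := by
      intro x
      simp only [← abs_mul, Real.cos_abs]
    simp_rw [this]
    rw [integral_comp_abs (f := fun y => (1 - Real.cos (|a| * y)) * y ^ (-1 - 2 * h)),
      integral_one_sub_cos_Ioi h0 h1 ha', specConst]
    generalize Real.sin (Real.pi * h) = s at hs
    field_simp
  exact ⟨Integrable.of_integral_ne_zero (by rw [e1]; positivity), e1⟩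

/-- The Fourier transform of the indicator function of `(c, e]`. -/
noncomputable def intervalFourier (c e x : ℝ) : ℂ :=
  ∫ y in Set.Ioc c e, Complex.exp (-(Complex.I * ((x * y : ℝ) : ℂ)))

lemma intervalFourier_eq {c e x : ℝ} (hce : c ≤ e) (hx : x ≠ 0) : intervalFourier c e x
    = (Complex.exp (-(Complex.I * ((x * c : ℝ) : ℂ))) - Complex.exp (-(Complex.I * ((x * e : ℝ) : ℂ))))
      / (Complex.I * x) := by
  have hc : -(Complex.I * (x : ℂ)) ≠ 0 := by
    simp [hx]
  have h := integral_exp_mul_complex (a := c) (b := e) hc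
  rw [intervalIntegral.integral_of_le hce] at h
  have e1 : ∀ y : ℝ, Complex.exp (-(Complex.I * ((x * y : ℝ) : ℂ)))
      = Complex.exp (-(Complex.I * (x : ℂ)) * y) := by
    intro y; push_cast; ring_nf
  unfold intervalFourier
  simp_rw [e1]
  rw [h, ← neg_div_neg_eq, neg_neg, neg_sub]

/-- The product of exponentials yields four cosines whose signs cancel in total, so each cos may be
replaced by cos - 1. This makes every term separately integrable near 0 against |x|^{-1-2h}. -/
lemma intervalFourier_mul_conj {c e c' e' x : ℝ} (hce : c ≤ e) (hce' : c' ≤ e') (hx : x ≠ 0) :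
    (intervalFourier c e x * conj (intervalFourier c' e' x)).re
      = ((1 - Real.cos ((c - e') * x)) + (1 - Real.cos ((e - c') * x))
        - (1 - Real.cos ((c - c') * x)) - (1 - Real.cos ((e - e') * x))) * |x| ^ (-2 : ℝ) := by
  have e1 : ∀ y : ℝ, Complex.exp (-(Complex.I * ((x * y : ℝ) : ℂ)))
      = ((Real.cos (y * x) : ℝ) : ℂ) - ((Real.sin (y * x) : ℝ) : ℂ) * Complex.I := by
    intro y
    rw [show -(Complex.I * ((x * y : ℝ) : ℂ)) = -((y * x : ℝ) : ℂ) * Complex.I by push_cast; ring,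
      Complex.exp_mul_I, Complex.cos_neg, Complex.sin_neg, Complex.ofReal_cos, Complex.ofReal_sin]
    ring
  have h2 : |x| ^ (-2 : ℝ) = (x * x)⁻¹ := by
    rw [Real.rpow_neg (abs_nonneg x), Real.rpow_two, sq_abs, sq]
  rw [intervalFourier_eq hce hx, intervalFourier_eq hce' hx, h2]
  simp only [e1, map_div₀, map_sub, map_mul, Complex.conj_ofReal, Complex.conj_I, sub_mul,
    Real.cos_sub]
  rw [div_mul_div_comm]
  have h3 : Complex.I * (x : ℂ) * (-Complex.I * (x : ℂ)) = ((x * x : ℝ) : ℂ) := by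
    push_cast; linear_combination (-(x : ℂ) * x) * Complex.I_mul_I
  rw [h3, Complex.div_ofReal_re, div_eq_mul_inv]
  simp only [Complex.mul_re, Complex.sub_re, Complex.sub_im, Complex.mul_im, Complex.ofReal_re,
    Complex.ofReal_im, Complex.I_re, Complex.I_im, Complex.neg_re, Complex.neg_im]
  ring


lemma measurable_intervalFourier (c e : ℝ) : Measurable (intervalFourier c e) := by
  unfold intervalFourier
  have h : StronglyMeasurable (Function.uncurry fun x y : ℝ =>
      Complex.exp (-(Complex.I * ((x * y : ℝ) : ℂ)))) := by
    apply Continuous.stronglyMeasurable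
    unfold Function.uncurry
    fun_prop
  exact (h.integral_prod_right (ν := volume.restrict (Set.Ioc c e))).measurable

lemma intervalFourier_neg (c e x : ℝ) :
    intervalFourier c e (-x) = conj (intervalFourier c e x) := by
  unfold intervalFourier
  rw [← integral_conj]
  congr 1; ext y
  rw [← Complex.exp_conj]
  simp

lemma specDensity_mul_rpow_neg_two {h x : ℝ} (hx : x ≠ 0) :
    specDensity h x * |x| ^ (-2 : ℝ) = specConst h * |x| ^ (-1 - 2 * h) := by
  rw [specDensity, mul_assoc, ← Real.rpow_add (abs_pos.2 hx)]
  ring_nf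

lemma integral_specDensity_re {h : ℝ} (h0 : 0 < h) (h1 : h < 1) {c e c' e' : ℝ} (hce : c ≤ e)
    (hce' : c' ≤ e') :
    Integrable (fun x => specDensity h x *
      (intervalFourier c e x * conj (intervalFourier c' e' x)).re) ∧
    ∫ x, specDensity h x * (intervalFourier c e x * conj (intervalFourier c' e' x)).re
      = incCov h c e c' e' := by
  have hae : (fun x => specDensity h x *
      (intervalFourier c e x * conj (intervalFourier c' e' x)).re) =ᵐ[volume] fun x =>
      specConst h * ((1 - Real.cos ((c - e') * x)) * |x| ^ (-1 - 2 * h))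
      + specConst h * ((1 - Real.cos ((e - c') * x)) * |x| ^ (-1 - 2 * h))
      - specConst h * ((1 - Real.cos ((c - c') * x)) * |x| ^ (-1 - 2 * h))
      - specConst h * ((1 - Real.cos ((e - e') * x)) * |x| ^ (-1 - 2 * h)) := by
    filter_upwards [Measure.ae_ne volume (0 : ℝ)] with x hx
    rw [intervalFourier_mul_conj hce hce' hx]
    linear_combination ((1 - Real.cos ((c - e') * x)) + (1 - Real.cos ((e - c') * x))
        - (1 - Real.cos ((c - c') * x)) - (1 - Real.cos ((e - e') * x)))
        * specDensity_mul_rpow_neg_two (h := h) hx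
  have I := fun a => (integral_one_sub_cos h0 h1 a).1
  refine ⟨((((I _).add (I _)).sub (I _)).sub (I _)).congr hae.symm, ?_⟩
  have hsum : ∀ V : ℝ → ℝ → ℝ, (∀ a, Integrable (V a)) → ∀ p q r s,
      ∫ x, (V p x + V q x - V r x - V s x)
        = (∫ x, V p x) + (∫ x, V q x) - (∫ x, V r x) - ∫ x, V s x := by
    intro V hV p q r s
    have i1 : Integrable fun x => V p x + V q x := (hV p).add (hV q)
    have i2 : Integrable fun x => V p x + V q x - V r x := i1.sub (hV r)
    rw [integral_sub i2 (hV s), integral_sub i1 (hV r), integral_add (hV p) (hV q)]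
  rw [integral_congr_ae hae, hsum _ I]
  simp only [fun a => (integral_one_sub_cos h0 h1 a).2, incCov, fbmCov]
  ring

/-- The diagonal cases are integrable by `integral_specDensity_re`, and |z w| ≤ |z|² + |w|² reduces
the general case to them. -/
lemma integrable_specDensity_mul {h : ℝ} (h0 : 0 < h) (h1 : h < 1) {c e c' e' : ℝ} (hce : c ≤ e)
    (hce' : c' ≤ e') :
    Integrable (fun x => (specDensity h x : ℂ) *
      (intervalFourier c e x * conj (intervalFourier c' e' x))) := by
  have hI := ((integral_specDensity_re h0 h1 hce hce).1).add
    (integral_specDensity_re h0 h1 hce' hce').1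
  refine hI.mono' ?_ (Eventually.of_forall fun x => ?_)
  · have := measurable_intervalFourier c e
    have := measurable_intervalFourier c' e'
    have := measurable_specDensity h
    have hc : Measurable (conj : ℂ → ℂ) := Complex.continuous_conj.measurable
    exact Measurable.aestronglyMeasurable (by fun_prop)
  · have hsq : ∀ z : ℂ, (z * conj z).re = ‖z‖ ^ 2 := fun z => by
      rw [Complex.mul_conj, Complex.ofReal_re, Complex.normSq_eq_norm_sq]
    have hs := specDensity_nonneg h0 h1 x
    simp only [Pi.add_apply, hsq, norm_mul, RCLike.norm_conj, Complex.norm_real,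
      Real.norm_of_nonneg hs]
    rw [← mul_add]
    refine mul_le_mul_of_nonneg_left ?_ hs
    nlinarith [sq_nonneg (‖intervalFourier c e x‖ - ‖intervalFourier c' e' x‖),
      norm_nonneg (intervalFourier c e x), norm_nonneg (intervalFourier c' e' x)]

/-- The reflection x ↦ -x conjugates the integrand, so the integral is real and
`integral_specDensity_re` determines it. -/
lemma integral_specDensity_mul {h : ℝ} (h0 : 0 < h) (h1 : h < 1) {c e c' e' : ℝ} (hce : c ≤ e)
    (hce' : c' ≤ e') :
    ∫ x, (specDensity h x : ℂ) * (intervalFourier c e x * conj (intervalFourier c' e' x))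
      = incCov h c e c' e' := by
  set Φ : ℝ → ℂ := fun x => (specDensity h x : ℂ) *
    (intervalFourier c e x * conj (intervalFourier c' e' x)) with hΦ
  have hconj : conj (∫ x, Φ x) = ∫ x, Φ x := by
    rw [← integral_conj, ← integral_neg_eq_self Φ]
    congr 1; ext x
    simp [hΦ, intervalFourier_neg, specDensity]
  rw [← Complex.conj_eq_iff_re.1 hconj]
  congr 1
  have hi := integrable_specDensity_mul h0 h1 hce hce'
  have := integral_re hi
  simp only [RCLike.re_eq_complex_re] at this
  rw [← (integral_specDensity_re h0 h1 hce hce').2, ← this]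
  congr 1; ext x
  rw [Complex.re_ofReal_mul]

/-! ### The spectral measure -/

section Spectral

variable {d : ℕ} {H : Fin d → ℝ}

lemma spectralMeasure_eq (H : Fin d → ℝ) : spectralMeasure H
    = volume.withDensity fun ξ => ENNReal.ofReal (∏ k, specDensity (H k) (ξ k)) := rfl

lemma measurable_prod_specDensity (H : Fin d → ℝ) :
    Measurable fun ξ : Sp d => ∏ k, specDensity (H k) (ξ k) :=
  Finset.measurable_prod _ fun k _ => (measurable_specDensity (H k)).comp (by fun_prop)

lemma prod_specDensity_nonneg (hH : ∀ i, 0 < H i ∧ H i < 1) (ξ : Sp d) :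
    0 ≤ ∏ k, specDensity (H k) (ξ k) :=
  Finset.prod_nonneg fun k _ => specDensity_nonneg (hH k).1 (hH k).2 _

lemma integral_euclidean {E : Type*} [NormedAddCommGroup E] [NormedSpace ℝ E] (g : Sp d → E) :
    ∫ ξ, g ξ = ∫ y : Fin d → ℝ, g (WithLp.toLp 2 y) :=
  ((PiLp.volume_preserving_toLp (Fin d)).integral_comp
    (MeasurableEquiv.toLp 2 (Fin d → ℝ)).measurableEmbedding g).symm

lemma integrable_euclidean {E : Type*} [NormedAddCommGroup E] {g : Sp d → E} :
    Integrable g ↔ Integrable fun y : Fin d → ℝ => g (WithLp.toLp 2 y) :=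
  ((PiLp.volume_preserving_toLp (Fin d)).integrable_comp_emb
    (MeasurableEquiv.toLp 2 (Fin d → ℝ)).measurableEmbedding).symm

lemma integral_spectralMeasure (hH : ∀ i, 0 < H i ∧ H i < 1) (g : Sp d → ℂ) :
    ∫ ξ, g ξ ∂spectralMeasure H = ∫ ξ : Sp d, (∏ k, (specDensity (H k) (ξ k) : ℂ)) * g ξ := by
  rw [spectralMeasure_eq, integral_withDensity_eq_integral_toReal_smul
    (measurable_prod_specDensity H).ennreal_ofReal (by simp)]
  congr 1; ext ξ
  rw [ENNReal.toReal_ofReal (prod_specDensity_nonneg hH ξ), Complex.real_smul]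
  push_cast; rfl

lemma integrable_spectralMeasure (hH : ∀ i, 0 < H i ∧ H i < 1) {g : Sp d → ℂ} :
    Integrable g (spectralMeasure H) ↔
      Integrable fun ξ : Sp d => (∏ k, (specDensity (H k) (ξ k) : ℂ)) * g ξ := by
  rw [spectralMeasure_eq, integrable_withDensity_iff_integrable_smul'
    (measurable_prod_specDensity H).ennreal_ofReal (by simp)]
  refine iff_of_eq (congrArg (fun f => Integrable f volume) ?_)
  ext ξ
  rw [ENNReal.toReal_ofReal (prod_specDensity_nonneg hH ξ), Complex.real_smul]
  push_cast; rfl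

lemma integral_prod_spectralMeasure (hH : ∀ i, 0 < H i ∧ H i < 1) (f : Fin d → ℝ → ℂ) :
    ∫ ξ, ∏ k, f k (ξ k) ∂spectralMeasure H = ∏ k, ∫ x, (specDensity (H k) x : ℂ) * f k x := by
  rw [integral_spectralMeasure hH, integral_euclidean]
  simp_rw [← Finset.prod_mul_distrib]
  exact integral_fintype_prod_volume_eq_prod (fun k x => (specDensity (H k) x : ℂ) * f k x)

lemma integrable_prod_spectralMeasure (hH : ∀ i, 0 < H i ∧ H i < 1) {f : Fin d → ℝ → ℂ}
    (hf : ∀ k, Integrable fun x => (specDensity (H k) x : ℂ) * f k x) :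
    Integrable (fun ξ => ∏ k, f k (ξ k)) (spectralMeasure H) := by
  rw [integrable_spectralMeasure hH, integrable_euclidean]
  simp_rw [← Finset.prod_mul_distrib]
  exact Integrable.fintype_prod hf

/-- The Fourier transform of the indicator function of `∏ᵢ (loᵢ, hiᵢ]`. -/
noncomputable def sideFourier (lo hi ξ : Sp d) : ℂ := ∏ k, intervalFourier (lo k) (hi k) (ξ k)

lemma measurable_sideFourier (lo hi : Sp d) : Measurable (sideFourier lo hi) :=
  Finset.measurable_prod _ fun k _ => (measurable_intervalFourier _ _).comp (by fun_prop)

lemma sideFourier_neg (lo hi ξ : Sp d) : sideFourier lo hi (-ξ) = conj (sideFourier lo hi ξ) := by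
  simp [sideFourier, intervalFourier_neg, map_prod]

lemma exp_mul_side_indicator (B : Box d) (ξ : Sp d) (y : Fin d → ℝ) :
    Complex.exp (-(Complex.I * (inner ℝ ξ (WithLp.toLp 2 y) : ℝ))) *
      ((B.side.indicator (1 : Sp d → ℝ) (WithLp.toLp 2 y) : ℝ) : ℂ)
      = ∏ k, (Set.Ioc (B.lo k) (B.hi k)).indicator
        (fun y : ℝ => Complex.exp (-(Complex.I * ((ξ k * y : ℝ) : ℂ)))) (y k) := by
  by_cases hy : WithLp.toLp 2 y ∈ B.side
  · have hy' : ∀ k, y k ∈ Set.Ioc (B.lo k) (B.hi k) := fun k => hy k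
    rw [Set.indicator_of_mem hy]
    simp only [Set.indicator_of_mem (hy' _)]
    rw [← Complex.exp_sum]
    simp only [Pi.one_apply, Complex.ofReal_one, mul_one]
    congr 1
    rw [Finset.sum_neg_distrib, ← Finset.mul_sum, PiLp.inner_apply]
    push_cast
    congr 2
    refine Finset.sum_congr rfl fun k _ => ?_
    simp [mul_comm]
  · rw [Set.indicator_of_notMem hy]
    have : ∃ k, y k ∉ Set.Ioc (B.lo k) (B.hi k) := by
      by_contra h
      push Not at h
      exact hy h
    obtain ⟨k, hk⟩ := this
    rw [Finset.prod_eq_zero (Finset.mem_univ k)]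
    · simp
    · rw [Set.indicator_of_notMem hk]

lemma integrable_exp_mul_side_indicator (B : Box d) (ξ : Sp d) :
    Integrable fun y : Sp d => Complex.exp (-(Complex.I * (inner ℝ ξ y : ℝ))) *
      ((B.side.indicator (1 : Sp d → ℝ) y : ℝ) : ℂ) := by
  rw [integrable_euclidean]
  simp_rw [exp_mul_side_indicator]
  refine Integrable.fintype_prod (f := fun k => (Set.Ioc (B.lo k) (B.hi k)).indicator
    (fun y : ℝ => Complex.exp (-(Complex.I * ((ξ k * y : ℝ) : ℂ))))) fun k => ?_
  rw [integrable_indicator_iff measurableSet_Ioc]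
  exact (Continuous.integrableOn_Icc (by fun_prop)).mono_set Set.Ioc_subset_Icc_self

lemma fourier_side (B : Box d) (ξ : Sp d) :
    fourier (B.side.indicator 1) ξ = sideFourier B.lo B.hi ξ := by
  unfold fourier sideFourier intervalFourier
  rw [integral_euclidean]
  simp_rw [← integral_indicator measurableSet_Ioc, exp_mul_side_indicator]
  exact integral_fintype_prod_volume_eq_prod (fun k y => (Set.Ioc (B.lo k) (B.hi k)).indicator
    (fun y : ℝ => Complex.exp (-(Complex.I * ((ξ k * y : ℝ) : ℂ)))) y)

/-- Density and Fourier transforms are products over the coordinates, so Fubini reduces the claim to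
dimension one. -/
lemma sideFourier_inner (hH : ∀ i, 0 < H i ∧ H i < 1) {lo hi lo' hi' : Sp d}
    (h : ∀ i, lo i ≤ hi i) (h' : ∀ i, lo' i ≤ hi' i) :
    Integrable (fun ξ => sideFourier lo hi ξ * conj (sideFourier lo' hi' ξ)) (spectralMeasure H) ∧
    ∫ ξ, sideFourier lo hi ξ * conj (sideFourier lo' hi' ξ) ∂spectralMeasure H
      = ((∏ k, incCov (H k) (lo k) (hi k) (lo' k) (hi' k) : ℝ) : ℂ) := by
  set f : Fin d → ℝ → ℂ := fun k x => intervalFourier (lo k) (hi k) x *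
    conj (intervalFourier (lo' k) (hi' k) x) with hf
  have e : (fun ξ : Sp d => sideFourier lo hi ξ * conj (sideFourier lo' hi' ξ))
      = fun ξ => ∏ k, f k (ξ k) := by
    ext ξ; simp [hf, sideFourier, map_prod, Finset.prod_mul_distrib]
  have hI : ∀ k, Integrable fun x => (specDensity (H k) x : ℂ) * f k x := fun k =>
    integrable_specDensity_mul (hH k).1 (hH k).2 (h k) (h' k)
  rw [e]
  constructor
  · exact integrable_prod_spectralMeasure hH hI
  · rw [integral_prod_spectralMeasure hH]
    push_cast
    exact Finset.prod_congr rfl fun k _ =>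
      integral_specDensity_mul (hH k).1 (hH k).2 (h k) (h' k)

instance sFinite_spectralMeasure (H : Fin d → ℝ) : SFinite (spectralMeasure H) := by
  unfold spectralMeasure; infer_instance

lemma memLp_sideFourier (hH : ∀ i, 0 < H i ∧ H i < 1) {lo hi : Sp d} (h : ∀ i, lo i ≤ hi i) :
    MemLp (sideFourier lo hi) 2 (spectralMeasure H) := by
  rw [memLp_two_iff_integrable_sq_norm (measurable_sideFourier lo hi).aestronglyMeasurable]
  have hI : Integrable (fun ξ => sideFourier lo hi ξ * conj (sideFourier lo hi ξ))
    (spectralMeasure H) := (sideFourier_inner hH h h).1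
  refine hI.norm.congr (Eventually.of_forall fun ξ => ?_)
  simp only [norm_mul, RCLike.norm_conj, sq]

end Spectral


/-! ### The isometry of the stochastic integral -/

lemma elem_integral_sub {d : ℕ} {Ω : Type*} (W : ℝ≥0 → Sp d → Ω → ℝ) (e e' : Elem d) (ω : Ω) :
    (e - e').integral W ω = e.integral W ω - e'.integral W ω :=
  Finsupp.sum_sub_index fun B b₁ b₂ => by ring

section Isometry

variable {d : ℕ} {H : Fin d → ℝ} {H₀ : ℝ} {Ω : Type*} [MeasurableSpace Ω] {P : Measure Ω}
  {W : ℝ≥0 → Sp d → Ω → ℝ}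

/-- The spatial Fourier transform of the indicator function of a box. -/
noncomputable def Box.hat (B : Box d) (r : ℝ) (ξ : Sp d) : ℂ :=
  (((Set.Ioc (B.a : ℝ) B.b).indicator (1 : ℝ → ℝ) r : ℝ) : ℂ) * sideFourier B.lo B.hi ξ

/-- The spatial Fourier transform of an elementary integrand. -/
noncomputable def Elem.hat (e : Elem d) (r : ℝ) (ξ : Sp d) : ℂ :=
  e.sum fun B c => (c : ℂ) * B.hat r ξ

lemma fourier_elem (e : Elem d) (r : ℝ) (ξ : Sp d) : fourier (e.toFun r) ξ = e.hat r ξ := by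
  have h : ∀ y : Sp d, Complex.exp (-(Complex.I * (inner ℝ ξ y : ℝ))) * ((e.toFun r y : ℝ) : ℂ)
      = ∑ B ∈ e.support, (((e B * (Set.Ioc (B.a : ℝ) B.b).indicator (1 : ℝ → ℝ) r : ℝ) : ℂ)) *
        (Complex.exp (-(Complex.I * (inner ℝ ξ y : ℝ))) *
          ((B.side.indicator (1 : Sp d → ℝ) y : ℝ) : ℂ)) := by
    intro y
    simp only [Elem.toFun, Finsupp.sum, Box.ind]
    push_cast
    rw [Finset.mul_sum]
    exact Finset.sum_congr rfl fun B _ => by ring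
  unfold fourier
  simp_rw [h]
  rw [integral_finsetSum _ fun B _ => (integrable_exp_mul_side_indicator B ξ).const_mul _]
  simp only [Elem.hat, Finsupp.sum, Box.hat]
  refine Finset.sum_congr rfl fun B _ => ?_
  rw [integral_const_mul, ← fourier_side, fourier]
  push_cast
  ring

lemma measurable_box_hat (B : Box d) : Measurable (Function.uncurry B.hat) := by
  have h1 : Measurable fun r : ℝ => (Set.Ioc (B.a : ℝ) B.b).indicator (1 : ℝ → ℝ) r :=
    measurable_one.indicator measurableSet_Ioc
  exact (Complex.measurable_ofReal.comp (h1.comp measurable_fst)).mul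
    ((measurable_sideFourier _ _).comp measurable_snd)

lemma measurable_elem_hat (e : Elem d) : Measurable (Function.uncurry e.hat) := by
  have : Function.uncurry e.hat
      = fun p => ∑ B ∈ e.support, (e B : ℂ) * Function.uncurry B.hat p := by
    ext p; rfl
  rw [this]
  exact Finset.measurable_sum _ fun B _ => (measurable_box_hat B).const_mul _

/-- The covariance of the increments of the noise over two boxes. -/
noncomputable def boxCov (H₀ : ℝ) (H : Fin d → ℝ) (B B' : Box d) : ℝ :=
  incCov H₀ B.a B.b B'.a B'.b * ∏ i, incCov (H i) (B.lo i) (B.hi i) (B'.lo i) (B'.hi i)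

lemma integral_box_hat (hH₀ : 1 / 2 ≤ H₀) (hH : ∀ i, 0 < H i ∧ H i < 1) (B B' : Box d) :
    Integrable (fun p : (ℝ × ℝ) × Sp d => B.hat p.1.1 p.2 * conj (B'.hat p.1.2 p.2))
      ((temporalMeasure H₀).prod (spectralMeasure H)) ∧
    ∫ p : (ℝ × ℝ) × Sp d, B.hat p.1.1 p.2 * conj (B'.hat p.1.2 p.2)
      ∂((temporalMeasure H₀).prod (spectralMeasure H)) = (boxCov H₀ H B B' : ℂ) := by
  obtain ⟨hs1, hs2⟩ := sideFourier_inner hH (fun i => (B.lo_lt_hi i).le)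
    (fun i => (B'.lo_lt_hi i).le)
  obtain ⟨ht1, ht2⟩ := integral_indicator_temporalMeasure hH₀ B.a.2
    (NNReal.coe_le_coe.2 B.a_lt_b.le) B'.a.2 (NNReal.coe_le_coe.2 B'.a_lt_b.le)
  set τ : ℝ × ℝ → ℝ := fun p => (Set.Ioc (B.a : ℝ) B.b).indicator (1 : ℝ → ℝ) p.1 *
      (Set.Ioc (B'.a : ℝ) B'.b).indicator (1 : ℝ → ℝ) p.2 with hτ
  set σ : Sp d → ℂ := fun ξ => sideFourier B.lo B.hi ξ * conj (sideFourier B'.lo B'.hi ξ) with hσ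
  have e : (fun p : (ℝ × ℝ) × Sp d => B.hat p.1.1 p.2 * conj (B'.hat p.1.2 p.2))
      = fun p => ((τ p.1 : ℝ) : ℂ) * σ p.2 := by
    ext p
    simp only [hτ, hσ, Box.hat, map_mul, Complex.conj_ofReal]
    push_cast; ring
  have ht2' : ∫ p, τ p ∂temporalMeasure H₀ = incCov H₀ B.a B.b B'.a B'.b := ht2
  rw [e]
  refine ⟨ht1.ofReal.mul_prod hs1, ?_⟩
  rw [integral_prod_mul (fun p => ((τ p : ℝ) : ℂ)) σ, hs2, integral_complex_ofReal, ht2', boxCov]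
  push_cast; rfl

lemma energy_elem (hH₀ : 1 / 2 ≤ H₀) (hH : ∀ i, 0 < H i ∧ H i < 1) (e : Elem d) :
    FiniteEnergy H₀ H e.hat ∧ energy H₀ H e.hat
      = ∑ B ∈ e.support, ∑ B' ∈ e.support, e B * e B' * boxCov H₀ H B B' := by
  have h : energyDensity e.hat = fun p : (ℝ × ℝ) × Sp d => ∑ B ∈ e.support, ∑ B' ∈ e.support,
      ((e B * e B' : ℝ) : ℂ) * (B.hat p.1.1 p.2 * conj (B'.hat p.1.2 p.2)) := by
    ext p
    simp only [energyDensity, Elem.hat, Finsupp.sum, map_sum, map_mul, Complex.conj_ofReal]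
    rw [Finset.sum_mul_sum]
    refine Finset.sum_congr rfl fun B _ => Finset.sum_congr rfl fun B' _ => ?_
    push_cast; ring
  have hi := fun B B' => ((integral_box_hat hH₀ hH B B').1).const_mul ((e B * e B' : ℝ) : ℂ)
  constructor
  · rw [FiniteEnergy, h]
    exact integrable_finsetSum _ fun B _ => integrable_finsetSum _ fun B' _ => hi B B'
  · rw [energy, h, integral_finsetSum _ fun B _ => integrable_finsetSum _ fun B' _ => hi B B']
    simp_rw [fun B => integral_finsetSum e.support fun B' _ => hi B B', integral_const_mul,
      (integral_box_hat hH₀ hH _ _).2]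
    norm_cast

/-- Expand the product on the right, A being the set of coordinates where the term with `lo` is
chosen. This turns alternating sums over vertices into products of one-dimensional increments. -/
lemma sum_neg_one_pow_mul_prod (g : Fin d → ℝ → ℝ) (lo hi : Fin d → ℝ) :
    ∑ A : Finset (Fin d), (-1 : ℝ) ^ A.card * ∏ i, g i (if i ∈ A then lo i else hi i)
      = ∏ i, (g i (hi i) - g i (lo i)) := by
  simp_rw [sub_eq_neg_add, Finset.prod_add, Finset.powerset_univ]
  refine Finset.sum_congr rfl fun A _ => ?_
  rw [Finset.prod_neg, mul_assoc]
  congr 1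
  rw [← Finset.prod_sdiff (Finset.subset_univ A), mul_comm]
  congr 1
  · exact Finset.prod_congr rfl fun i hi' => by rw [if_pos hi']
  · exact Finset.prod_congr rfl fun i hi' => by rw [if_neg (Finset.mem_sdiff.1 hi').2]

lemma memLp_field [IsProbabilityMeasure P] (hW : IsFractionalField P H₀ H W) (t : ℝ≥0) (x : Sp d) :
    MemLp (W t x) 2 P :=
  (hW.gaussian.hasGaussianLaw_eval (t, x)).memLp (by norm_num)

lemma memLp_increment [IsProbabilityMeasure P] (hW : IsFractionalField P H₀ H W) (B : Box d) :
    MemLp (B.increment W) 2 P := by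
  have : B.increment W = fun ω => ∑ A : Finset (Fin d),
      (-1 : ℝ) ^ A.card * (W B.b (B.vertex A) ω - W B.a (B.vertex A) ω) := rfl
  rw [this]
  exact memLp_finsetSum _ fun A _ => ((memLp_field hW _ _).sub (memLp_field hW _ _)).const_mul _

/-- The covariance of W is a product over the coordinates, so `sum_neg_one_pow_mul_prod` applies to
the vertices of each box in turn. -/
lemma integral_increment_mul [IsProbabilityMeasure P] (hW : IsFractionalField P H₀ H W)
    (B B' : Box d) : ∫ ω, B.increment W ω * B'.increment W ω ∂P = boxCov H₀ H B B' := by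
  have hi : ∀ t x s y, Integrable (fun ω => W t x ω * W s y ω) P := fun t x s y =>
    (memLp_field hW t x).integrable_mul (memLp_field hW s y)
  have hpair : ∀ x y, Integrable (fun ω => (W B.b x ω - W B.a x ω) * (W B'.b y ω - W B'.a y ω)) P ∧
      ∫ ω, (W B.b x ω - W B.a x ω) * (W B'.b y ω - W B'.a y ω) ∂P
      = incCov H₀ B.a B.b B'.a B'.b * ∏ i, fbmCov (H i) (x i) (y i) := by
    intro x y
    have e : (fun ω => (W B.b x ω - W B.a x ω) * (W B'.b y ω - W B'.a y ω))
        = fun ω => (W B.b x ω * W B'.b y ω - W B.b x ω * W B'.a y ω)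
          - (W B.a x ω * W B'.b y ω - W B.a x ω * W B'.a y ω) := by
      ext ω; ring
    have i1 : Integrable (fun ω => W B.b x ω * W B'.b y ω - W B.b x ω * W B'.a y ω) P :=
      (hi _ _ _ _).sub (hi _ _ _ _)
    have i2 : Integrable (fun ω => W B.a x ω * W B'.b y ω - W B.a x ω * W B'.a y ω) P :=
      (hi _ _ _ _).sub (hi _ _ _ _)
    rw [e]
    refine ⟨i1.sub i2, ?_⟩
    rw [integral_sub i1 i2, integral_sub (hi _ _ _ _) (hi _ _ _ _),
      integral_sub (hi _ _ _ _) (hi _ _ _ _), hW.cov, hW.cov, hW.cov, hW.cov, incCov]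
    ring
  have e : (fun ω => B.increment W ω * B'.increment W ω)
      = fun ω => ∑ A : Finset (Fin d), ∑ A' : Finset (Fin d), (-1 : ℝ) ^ A.card *
        ((-1 : ℝ) ^ A'.card * ((W B.b (B.vertex A) ω - W B.a (B.vertex A) ω) *
          (W B'.b (B'.vertex A') ω - W B'.a (B'.vertex A') ω))) := by
    ext ω
    simp only [Box.increment]
    rw [Finset.sum_mul_sum]
    exact Finset.sum_congr rfl fun A _ => Finset.sum_congr rfl fun A' _ => by ring
  have hI : ∀ A A' : Finset (Fin d), Integrable (fun ω => (-1 : ℝ) ^ A.card *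
        ((-1 : ℝ) ^ A'.card * ((W B.b (B.vertex A) ω - W B.a (B.vertex A) ω) *
          (W B'.b (B'.vertex A') ω - W B'.a (B'.vertex A') ω)))) P := fun A A' =>
    (((hpair _ _).1).const_mul _).const_mul _
  rw [e, integral_finsetSum _ fun A _ => integrable_finsetSum _ fun A' _ => hI A A']
  simp_rw [fun A => integral_finsetSum (Finset.univ : Finset (Finset (Fin d)))
    fun A' _ => hI A A', integral_const_mul, (hpair _ _).2]
  have h1 : ∀ A : Finset (Fin d), ∑ A' : Finset (Fin d), (-1 : ℝ) ^ A.card *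
      ((-1 : ℝ) ^ A'.card * (incCov H₀ B.a B.b B'.a B'.b *
        ∏ i, fbmCov (H i) (B.vertex A i) (B'.vertex A' i)))
      = incCov H₀ B.a B.b B'.a B'.b * ((-1 : ℝ) ^ A.card *
        ∏ i, (fbmCov (H i) (B.vertex A i) (B'.hi i) - fbmCov (H i) (B.vertex A i) (B'.lo i))) := by
    intro A
    rw [← sum_neg_one_pow_mul_prod (fun i z => fbmCov (H i) (B.vertex A i) z), Finset.mul_sum,
      Finset.mul_sum]
    refine Finset.sum_congr rfl fun A' _ => ?_
    simp only [Box.vertex]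
    ring
  simp_rw [h1]
  rw [← Finset.mul_sum]
  have h2 := sum_neg_one_pow_mul_prod (fun i z => fbmCov (H i) z (B'.hi i)
    - fbmCov (H i) z (B'.lo i)) B.lo B.hi
  simp only [Box.vertex] at h2 ⊢
  rw [h2, boxCov]
  congr 1
  exact Finset.prod_congr rfl fun i _ => by rw [incCov]; ring

lemma memLp_elem_integral [IsProbabilityMeasure P] (hW : IsFractionalField P H₀ H W) (e : Elem d) :
    MemLp (e.integral W) 2 P := by
  have : e.integral W = fun ω => ∑ B ∈ e.support, e B * B.increment W ω := rfl
  rw [this]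
  exact memLp_finsetSum _ fun B _ => (memLp_increment hW B).const_mul _

lemma eLpNorm_two_sq {f : Ω → ℝ} (hf : MemLp f 2 P) :
    eLpNorm f 2 P ^ 2 = ENNReal.ofReal (∫ ω, f ω ^ 2 ∂P) := by
  rw [hf.eLpNorm_eq_integral_rpow_norm (by norm_num) (by norm_num),
    ← ENNReal.ofReal_pow (by positivity), ENNReal.toReal_ofNat, ← Real.rpow_natCast,
    ← Real.rpow_mul (by positivity)]
  norm_num

/-- The isometry for elementary integrands. -/
theorem eLpNorm_elem_integral_sq [IsProbabilityMeasure P] (hW : IsFractionalField P H₀ H W)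
    (hH₀ : 1 / 2 ≤ H₀) (hH : ∀ i, 0 < H i ∧ H i < 1) (e : Elem d) :
    eLpNorm (e.integral W) 2 P ^ 2 = ENNReal.ofReal (energy H₀ H e.hat) := by
  rw [eLpNorm_two_sq (memLp_elem_integral hW e), (energy_elem hH₀ hH e).2]
  congr 1
  have h : (fun ω => e.integral W ω ^ 2) = fun ω => ∑ B ∈ e.support, ∑ B' ∈ e.support,
      (e B * e B') * (B.increment W ω * B'.increment W ω) := by
    ext ω
    simp only [Elem.integral, Finsupp.sum]
    rw [sq, Finset.sum_mul_sum]
    exact Finset.sum_congr rfl fun B _ => Finset.sum_congr rfl fun B' _ => by ring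
  have hi := fun B B' => ((memLp_increment hW B).integrable_mul
    (memLp_increment hW B')).const_mul (e B * e B')
  simp only [Pi.mul_apply] at hi
  rw [h, integral_finsetSum _ fun B _ => integrable_finsetSum _ fun B' _ => hi B B']
  simp_rw [fun B => integral_finsetSum e.support fun B' _ => hi B B', integral_const_mul,
    integral_increment_mul hW]

lemma elem_hat_sub (e e' : Elem d) (r : ℝ) (ξ : Sp d) :
    (e - e').hat r ξ = e.hat r ξ - e'.hat r ξ :=
  Finsupp.sum_sub_index fun B b₁ b₂ => by push_cast; ring

end Isometry


/-! ### Wiener integrals -/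

lemma tendsto_eLpNorm_of_tendsto_sub {α E : Type*} [MeasurableSpace α] [NormedAddCommGroup E]
    {μ : Measure α} {f : ℕ → α → E} {g : α → E} (hf : ∀ n, MemLp (f n) 2 μ) (hg : MemLp g 2 μ)
    (h : Tendsto (fun n => eLpNorm (f n - g) 2 μ) atTop (𝓝 0)) :
    Tendsto (fun n => eLpNorm (f n) 2 μ) atTop (𝓝 (eLpNorm g 2 μ)) := by
  have h1 := (Lp.tendsto_Lp_iff_tendsto_eLpNorm'' f hf g hg).2 h
  have h2 := h1.enorm
  simpa only [Lp.enorm_toLp] using h2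

lemma tendsto_eLpNorm_sub {α E : Type*} [MeasurableSpace α] [NormedAddCommGroup E] {μ : Measure α}
    {f f' : ℕ → α → E} {h h' : α → E} (hf : ∀ n, MemLp (f n) 2 μ) (hf' : ∀ n, MemLp (f' n) 2 μ)
    (hh : MemLp h 2 μ) (hh' : MemLp h' 2 μ)
    (h1 : Tendsto (fun n => eLpNorm (f n - h) 2 μ) atTop (𝓝 0))
    (h2 : Tendsto (fun n => eLpNorm (f' n - h') 2 μ) atTop (𝓝 0)) :
    Tendsto (fun n => eLpNorm (f n - f' n) 2 μ) atTop (𝓝 (eLpNorm (h - h') 2 μ)) := by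
  refine tendsto_eLpNorm_of_tendsto_sub (fun n => (hf n).sub (hf' n)) (hh.sub hh') ?_
  refine tendsto_of_tendsto_of_tendsto_of_le_of_le tendsto_const_nhds
    (by simpa using h1.add h2) (fun n => zero_le) fun n => ?_
  simp only
  rw [sub_sub_sub_comm]
  exact eLpNorm_sub_le ((hf n).sub hh).1 ((hf' n).sub hh').1 (by norm_num)

lemma ENNReal_eq_of_sq_eq {a b : ℝ≥0∞} (h : a ^ 2 = b ^ 2) : a = b :=
  (ENNReal.pow_right_strictMono two_ne_zero).injective h

lemma ENNReal_tendsto_zero_of_sq {f : ℕ → ℝ≥0∞} (h : Tendsto (fun n => f n ^ 2) atTop (𝓝 0)) :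
    Tendsto f atTop (𝓝 0) := by
  have h1 := (ENNReal.continuous_rpow_const (y := 1 / 2)).tendsto 0 |>.comp h
  rw [ENNReal.zero_rpow_of_pos (by norm_num)] at h1
  refine h1.congr fun n => ?_
  simp only [Function.comp]
  rw [← ENNReal.rpow_natCast, ← ENNReal.rpow_mul]
  norm_num

section Wiener

variable {d : ℕ} {H : Fin d → ℝ} {H₀ : ℝ} {Ω : Type*} [MeasurableSpace Ω] {P : Measure Ω}
  {W : ℝ≥0 → Sp d → Ω → ℝ}

lemma isWienerIntegral_iff {g : ℝ → Sp d → ℂ} {X : Ω → ℝ} : IsWienerIntegral P H₀ H W g X ↔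
    MemLp X 2 P ∧ ∃ e : ℕ → Elem d,
    (∀ n, FiniteEnergy H₀ H (fun r ξ => (e n).hat r ξ - g r ξ)) ∧
    Tendsto (fun n => energy H₀ H (fun r ξ => (e n).hat r ξ - g r ξ)) atTop (𝓝 0) ∧
    Tendsto (fun n => eLpNorm (fun ω => (e n).integral W ω - X ω) 2 P) atTop (𝓝 0) := by
  simp only [IsWienerIntegral, fourier_elem]

lemma measurable_uncurry_sub {f g : ℝ → Sp d → ℂ} (hf : Measurable (Function.uncurry f))
    (hg : Measurable (Function.uncurry g)) :
    Measurable (Function.uncurry fun r ξ => f r ξ - g r ξ) := hf.sub hg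

lemma eLpNorm_elem_integral_sub_sq [IsProbabilityMeasure P] (hW : IsFractionalField P H₀ H W)
    (hH₀ : 1 / 2 ≤ H₀) (hH : ∀ i, 0 < H i ∧ H i < 1) (e e' : Elem d) :
    eLpNorm (e.integral W - e'.integral W) 2 P ^ 2
      = ENNReal.ofReal (energy H₀ H fun r ξ => e.hat r ξ - e'.hat r ξ) := by
  have h5 : (e - e').integral W = e.integral W - e'.integral W := by
    ext ω; exact elem_integral_sub W _ _ ω
  have h6 : (e - e').hat = fun r ξ => e.hat r ξ - e'.hat r ξ := by
    ext r ξ; exact elem_hat_sub _ _ r ξ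
  rw [← h5, eLpNorm_elem_integral_sq hW hH₀ hH (e - e'), h6]

/-- For elementary integrands both sides agree. The integrals converge to X and X' in L²(P), their
images under T converge to T g and T g' in L²(m), and norms pass to the limit. -/
theorem eLpNorm_wiener_sub_sq [IsProbabilityMeasure P] (hW : IsFractionalField P H₀ H W)
    (hH₀ : 1 / 2 ≤ H₀) (hH₀' : H₀ ≤ 1) (hH : ∀ i, 0 < H i ∧ H i < 1)
    {g g' : ℝ → Sp d → ℂ} (hg : Measurable (Function.uncurry g))
    (hg' : Measurable (Function.uncurry g')) {X X' : Ω → ℝ}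
    (hX : IsWienerIntegral P H₀ H W g X) (hX' : IsWienerIntegral P H₀ H W g' X') :
    FiniteEnergy H₀ H (fun r ξ => g r ξ - g' r ξ) ∧
    eLpNorm (fun ω => X ω - X' ω) 2 P ^ 2
      = ENNReal.ofReal (energy H₀ H (fun r ξ => g r ξ - g' r ξ)) := by
  obtain ⟨Λ, _, m, T, hT1, hT2⟩ :=
    exists_isometry_of_isMixture (H := H) (isMixture_temporalMeasure hH₀ hH₀')
  have key : ∀ {g : ℝ → Sp d → ℂ} {X : Ω → ℝ}, Measurable (Function.uncurry g) →
      IsWienerIntegral P H₀ H W g X → MemLp X 2 P ∧ FiniteEnergy H₀ H g ∧ ∃ e : ℕ → Elem d,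
        Tendsto (fun n => eLpNorm (T (e n).hat - T g) 2 m) atTop (𝓝 0) ∧
        Tendsto (fun n => eLpNorm ((e n).integral W - X) 2 P) atTop (𝓝 0) := by
    intro g X hg hX
    obtain ⟨hX, e, he1, he2, he3⟩ := isWienerIntegral_iff.1 hX
    have hm : ∀ n, Measurable (Function.uncurry fun r ξ => (e n).hat r ξ - g r ξ) := fun n =>
      (measurable_elem_hat (e n)).sub hg
    -- Finite energy of g itself follows from g = e₀ - (e₀ - g).
    have hfin : FiniteEnergy H₀ H g := by
      have := (hT2 _ _ (measurable_elem_hat (e 0)) (hm 0) (energy_elem hH₀ hH (e 0)).1 (he1 0)).1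
      simpa using this
    refine ⟨hX, hfin, e, ?_, he3⟩
    refine ENNReal_tendsto_zero_of_sq ?_
    have h1 : ∀ n, eLpNorm (T (e n).hat - T g) 2 m ^ 2
        = ENNReal.ofReal (energy H₀ H (fun r ξ => (e n).hat r ξ - g r ξ)) := by
      intro n
      rw [← (hT1 _ (hm n) (he1 n)).2.1, eLpNorm_congr_ae (hT2 _ _ (measurable_elem_hat (e n)) hg
        (energy_elem hH₀ hH (e n)).1 hfin).2]
      rfl
    simp_rw [h1]
    simpa using ENNReal.tendsto_ofReal he2
  obtain ⟨hXm, hgf, e, he, heX⟩ := key hg hX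
  obtain ⟨hXm', hgf', e', he', heX'⟩ := key hg' hX'
  have hfin := hT2 _ _ hg hg' hgf hgf'
  have hgm : Measurable (Function.uncurry fun r ξ => g r ξ - g' r ξ) := hg.sub hg'
  refine ⟨hfin.1, ?_⟩
  rw [← (hT1 _ hgm hfin.1).2.1, eLpNorm_congr_ae hfin.2]
  congr 1
  have hmT : ∀ {g}, Measurable (Function.uncurry g) → FiniteEnergy H₀ H g → MemLp (T g) 2 m :=
    fun hg hf => (hT1 _ hg hf).1
  have hmE : ∀ e : Elem d, MemLp (T e.hat) 2 m := fun e =>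
    hmT (measurable_elem_hat e) (energy_elem hH₀ hH e).1
  have l1 := tendsto_eLpNorm_sub (fun n => memLp_elem_integral hW (e n)) (fun n => memLp_elem_integral hW (e' n))
    hXm hXm' heX heX'
  have l2 := tendsto_eLpNorm_sub (fun n => hmE (e n)) (fun n => hmE (e' n)) (hmT hg hgf) (hmT hg' hgf') he he'
  refine tendsto_nhds_unique l1 (l2.congr fun n => ENNReal_eq_of_sq_eq ?_)
  have h3 := hT2 _ _ (measurable_elem_hat (e n)) (measurable_elem_hat (e' n))
    (energy_elem hH₀ hH (e n)).1 (energy_elem hH₀ hH (e' n)).1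
  rw [eLpNorm_elem_integral_sub_sq hW hH₀ hH, ← (hT1 _ (measurable_uncurry_sub
    (measurable_elem_hat (e n)) (measurable_elem_hat (e' n))) h3.1).2.1, eLpNorm_congr_ae h3.2]
  rfl

/-- The images T e_n converge in L²(m), hence are Cauchy. The integrals of e_n have the same mutual
distances, so completeness of L²(P) provides X. -/
theorem exists_isWienerIntegral [IsProbabilityMeasure P] (hW : IsFractionalField P H₀ H W)
    (hH₀ : 1 / 2 ≤ H₀) (hH₀' : H₀ ≤ 1) (hH : ∀ i, 0 < H i ∧ H i < 1)
    {g : ℝ → Sp d → ℂ} (hg : Measurable (Function.uncurry g))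
    (happ : ∀ η > 0, ∃ e : Elem d, FiniteEnergy H₀ H (fun r ξ => e.hat r ξ - g r ξ) ∧
      energy H₀ H (fun r ξ => e.hat r ξ - g r ξ) ≤ η) :
    ∃ X, IsWienerIntegral P H₀ H W g X := by
  obtain ⟨Λ, _, m, T, hT1, hT2⟩ :=
    exists_isometry_of_isMixture (H := H) (isMixture_temporalMeasure hH₀ hH₀')
  choose e he1 he2 using fun n : ℕ => happ (1 / ((n : ℝ) + 1)) (by positivity)
  have hm : ∀ n, Measurable (Function.uncurry fun r ξ => (e n).hat r ξ - g r ξ) := fun n =>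
    (measurable_elem_hat (e n)).sub hg
  have hE := fun n => (energy_elem hH₀ hH (e n)).1
  have hfin : FiniteEnergy H₀ H g := by
    simpa using (hT2 _ _ (measurable_elem_hat (e 0)) (hm 0) (hE 0) (he1 0)).1
  have hen : Tendsto (fun n => energy H₀ H (fun r ξ => (e n).hat r ξ - g r ξ)) atTop (𝓝 0) :=
    squeeze_zero (fun n => (hT1 _ (hm n) (he1 n)).2.2) he2 tendsto_one_div_add_atTop_nhds_zero_nat
  have hTE : ∀ n, MemLp (T (e n).hat) 2 m := fun n => (hT1 _ (measurable_elem_hat (e n)) (hE n)).1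
  have hTg : MemLp (T g) 2 m := (hT1 _ hg hfin).1
  have h1 : ∀ n, eLpNorm (T (e n).hat - T g) 2 m ^ 2
      = ENNReal.ofReal (energy H₀ H (fun r ξ => (e n).hat r ξ - g r ξ)) := by
    intro n
    rw [← (hT1 _ (hm n) (he1 n)).2.1,
      eLpNorm_congr_ae (hT2 _ _ (measurable_elem_hat (e n)) hg (hE n) hfin).2]
    rfl
  have h2 : Tendsto (fun n => eLpNorm (T (e n).hat - T g) 2 m) atTop (𝓝 0) := by
    refine ENNReal_tendsto_zero_of_sq ?_
    simp_rw [h1]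
    simpa using ENNReal.tendsto_ofReal hen
  have h3 := ((Lp.tendsto_Lp_iff_tendsto_eLpNorm'' _ hTE _ hTg).2 h2).cauchySeq
  have hI := fun n => memLp_elem_integral hW (e n)
  have hdist : ∀ n k, edist ((hI n).toLp _) ((hI k).toLp _)
      = edist ((hTE n).toLp _) ((hTE k).toLp _) := by
    intro n k
    rw [Lp.edist_toLp_toLp, Lp.edist_toLp_toLp]
    refine ENNReal_eq_of_sq_eq ?_
    have h3 := hT2 _ _ (measurable_elem_hat (e n)) (measurable_elem_hat (e k)) (hE n) (hE k)
    rw [eLpNorm_elem_integral_sub_sq hW hH₀ hH, ← (hT1 _ (measurable_uncurry_sub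
      (measurable_elem_hat (e n)) (measurable_elem_hat (e k))) h3.1).2.1, eLpNorm_congr_ae h3.2]
    rfl
  have hc : CauchySeq fun n => (hI n).toLp _ := by
    rw [EMetric.cauchySeq_iff] at h3 ⊢
    simpa only [hdist] using h3
  obtain ⟨X, hX⟩ := cauchySeq_tendsto_of_complete hc
  refine ⟨X, isWienerIntegral_iff.2 ⟨Lp.memLp X, e, he1, hen, ?_⟩⟩
  have hX' : Tendsto (fun n => (hI n).toLp _) atTop (𝓝 ((Lp.memLp X).toLp X)) := by
    rwa [Lp.toLp_coeFn]
  exact (Lp.tendsto_Lp_iff_tendsto_eLpNorm'' _ hI _ (Lp.memLp X)).1 hX'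

end Wiener


/-! ### Polar coordinates for the spectral measure -/

section Polar

variable {d : ℕ} {H : Fin d → ℝ}

/-- The homogeneity degree `2d - 2|H|` of the spectral measure. -/
noncomputable def specDim (H : Fin d → ℝ) : ℝ := ∑ k, (2 - 2 * H k)

lemma specDim_eq (H : Fin d → ℝ) : specDim H = 2 * d - 2 * ∑ k, H k := by
  rw [specDim, Finset.sum_sub_distrib, ← Finset.mul_sum]
  simp [mul_comm]

lemma specDim_pos (hd : 1 ≤ d) (hH : ∀ i, 0 < H i ∧ H i < 1) : 0 < specDim H := by
  have : Nonempty (Fin d) := ⟨⟨0, hd⟩⟩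
  exact Finset.sum_pos (fun k _ => by linarith [(hH k).2]) Finset.univ_nonempty

/-- The ball lies in the cube [-1,1]^d, where the integral factors, and |x|^{1-2h} is integrable at
0 because h < 1. -/
lemma spectralMeasure_closedBall_one_lt_top (hH : ∀ i, 0 < H i ∧ H i < 1) :
    spectralMeasure H (Metric.closedBall 0 1) < ∞ := by
  set f : Fin d → ℝ → ℂ := fun _ => (Set.Icc (-1) 1).indicator 1 with hf
  have hI : Integrable (fun ξ => ∏ k, f k (ξ k)) (spectralMeasure H) := by
    refine integrable_prod_spectralMeasure hH fun k => ?_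
    have h1 : IntegrableOn (specDensity (H k)) (Set.Icc (-1) 1) := by
      have := intervalIntegrable_abs_rpow (p := 1 - 2 * H k) (by linarith [(hH k).2]) (-1) 1
      rw [intervalIntegrable_iff_integrableOn_Icc_of_le (by norm_num)] at this
      exact this.const_mul _
    have h2 : (fun x => (specDensity (H k) x : ℂ) * f k x)
        = (Set.Icc (-1 : ℝ) 1).indicator fun x => (specDensity (H k) x : ℂ) := by
      ext x
      simp only [hf, Set.indicator]
      split_ifs <;> simp
    rw [h2, integrable_indicator_iff measurableSet_Icc]
    exact h1.ofReal
  refine lt_of_le_of_lt ?_ hI.2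
  rw [← lintegral_indicator_one Metric.isClosed_closedBall.measurableSet]
  refine lintegral_mono fun ξ => ?_
  by_cases h : ξ ∈ Metric.closedBall (0 : Sp d) 1
  · have : ∏ k, f k (ξ k) = 1 := by
      refine Finset.prod_eq_one fun k _ => ?_
      have h1 : ‖ξ k‖ ≤ 1 := (PiLp.norm_apply_le ξ k).trans (by simpa using h)
      rw [hf]
      exact Set.indicator_of_mem (s := Set.Icc (-1 : ℝ) 1) (abs_le.1 h1) 1
    simp [this, h]
  · simp [h]

lemma prod_specDensity_smul {R : ℝ} (hR : 0 < R) (ξ : Sp d) :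
    ∏ k, specDensity (H k) ((R • ξ) k)
      = R ^ (∑ k, (1 - 2 * H k)) * ∏ k, specDensity (H k) (ξ k) := by
  rw [Real.rpow_sum_of_pos hR, ← Finset.prod_mul_distrib]
  refine Finset.prod_congr rfl fun k _ => ?_
  rw [PiLp.smul_apply, smul_eq_mul, specDensity, specDensity, abs_mul, abs_of_pos hR,
    Real.mul_rpow hR.le (abs_nonneg _)]
  ring

/-- Dilation by R contributes the Jacobian R^d and the factor R^{Σ(1-2H_k)} from the density; the
exponents add up to `specDim`. -/
lemma spectralMeasure_closedBall {R : ℝ} (hR : 0 < R) :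
    spectralMeasure H (Metric.closedBall 0 R)
      = ENNReal.ofReal (R ^ specDim H) * spectralMeasure H (Metric.closedBall 0 1) := by
  have hm := (measurable_prod_specDensity H).ennreal_ofReal
  have hb : ∀ r, MeasurableSet (Metric.closedBall (0 : Sp d) r) := fun r =>
    Metric.isClosed_closedBall.measurableSet
  rw [spectralMeasure_eq, withDensity_apply _ (hb R), withDensity_apply _ (hb 1),
    ← lintegral_indicator (hb R), ← lintegral_indicator (hb 1)]
  set F : Sp d → ℝ≥0∞ := (Metric.closedBall (0 : Sp d) R).indicator
    fun ξ => ENNReal.ofReal (∏ k, specDensity (H k) (ξ k)) with hF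
  have hFm : Measurable F := hm.indicator (hb R)
  have h1 : ∫⁻ ξ, F ξ = ENNReal.ofReal (R ^ d) * ∫⁻ ξ, F (R • ξ) := by
    have hmap := Measure.map_addHaar_smul (volume : Measure (Sp d)) hR.ne'
    have h2 : ∫⁻ ξ, F (R • ξ) = ∫⁻ ξ, F ξ ∂(Measure.map (R • ·) (volume : Measure (Sp d))) :=
      (lintegral_map hFm (by fun_prop)).symm
    rw [h2, hmap, lintegral_smul_measure, finrank_euclideanSpace_fin, smul_eq_mul, ← mul_assoc,
      ← ENNReal.ofReal_mul (by positivity), abs_of_pos (by positivity),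
      mul_inv_cancel₀ (by positivity), ENNReal.ofReal_one, one_mul]
  rw [h1, ← lintegral_const_mul' _ _ ENNReal.ofReal_ne_top,
    ← lintegral_const_mul' _ _ ENNReal.ofReal_ne_top]
  refine lintegral_congr fun ξ => ?_
  by_cases h : ξ ∈ Metric.closedBall (0 : Sp d) 1
  · have h' : R • ξ ∈ Metric.closedBall (0 : Sp d) R := by
      simp only [mem_closedBall_zero_iff, norm_smul, Real.norm_of_nonneg hR.le] at h ⊢
      exact mul_le_of_le_one_right hR.le h
    rw [hF, Set.indicator_of_mem h', Set.indicator_of_mem h, prod_specDensity_smul hR,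
      ENNReal.ofReal_mul (by positivity), ← mul_assoc, ← ENNReal.ofReal_mul (by positivity),
      ← Real.rpow_natCast, ← Real.rpow_add hR]
    congr 3
    rw [specDim]
    simp only [Finset.sum_sub_distrib, Finset.sum_const, Finset.card_univ, Fintype.card_fin,
      nsmul_eq_mul]
    ring
  · have h' : R • ξ ∉ Metric.closedBall (0 : Sp d) R := by
      simp only [mem_closedBall_zero_iff, norm_smul, Real.norm_of_nonneg hR.le, not_le] at h ⊢
      nlinarith
    rw [hF, Set.indicator_of_notMem h', Set.indicator_of_notMem h]
    simp

/-- The Fourier transform of the unit cube has squared norm 1 under this measure, the variance of an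
increment over unit intervals. -/
lemma spectralMeasure_ne_zero (hH : ∀ i, 0 < H i ∧ H i < 1) : spectralMeasure H ≠ 0 := by
  intro h0
  have h := (sideFourier_inner hH (lo := 0) (hi := WithLp.toLp 2 1) (lo' := 0)
    (hi' := WithLp.toLp 2 1) (fun i => by simp) (fun i => by simp)).2
  rw [h0, integral_zero_measure] at h
  have h1 : ∏ k, incCov (H k) ((0 : Sp d) k) ((WithLp.toLp 2 (1 : Fin d → ℝ) : Sp d) k)
      ((0 : Sp d) k) ((WithLp.toLp 2 (1 : Fin d → ℝ) : Sp d) k) = 1 := by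
    refine Finset.prod_eq_one fun k _ => ?_
    have : 2 * H k ≠ 0 := by linarith [(hH k).1]
    simp [incCov, fbmCov, Real.zero_rpow this]
  rw [h1] at h
  simp at h

/-- If the unit ball were null, scaling would make every ball null, and so the whole measure zero.
-/
lemma spectralMeasure_closedBall_one_pos (hH : ∀ i, 0 < H i ∧ H i < 1) :
    0 < spectralMeasure H (Metric.closedBall 0 1) := by
  rw [pos_iff_ne_zero]
  intro h
  apply spectralMeasure_ne_zero hH
  rw [← Measure.measure_univ_eq_zero]
  have hU : (Set.univ : Set (Sp d)) = ⋃ n : ℕ, Metric.closedBall 0 ((n : ℝ) + 1) := by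
    symm
    rw [Set.eq_univ_iff_forall]
    intro ξ
    obtain ⟨n, hn⟩ := exists_nat_ge ‖ξ‖
    exact Set.mem_iUnion.2 ⟨n, by simp; linarith⟩
  rw [hU, measure_iUnion_null_iff]
  intro n
  rw [spectralMeasure_closedBall (by positivity), h, mul_zero]

/-- The mass of the unit ball under the spectral measure. -/
noncomputable def ballMass (H : Fin d → ℝ) : ℝ :=
  (spectralMeasure H (Metric.closedBall 0 1)).toReal

lemma ballMass_pos (hH : ∀ i, 0 < H i ∧ H i < 1) : 0 < ballMass H :=
  ENNReal.toReal_pos (spectralMeasure_closedBall_one_pos hH).ne'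
    (spectralMeasure_closedBall_one_lt_top hH).ne

lemma spectralMeasure_absolutelyContinuous (H : Fin d → ℝ) : spectralMeasure H ≪ volume :=
  withDensity_absolutelyContinuous _ _

/-- The radial density of the spectral measure. -/
noncomputable def radialDensity (H : Fin d → ℝ) (ρ : ℝ) : ℝ :=
  ballMass H * (specDim H * ρ ^ (specDim H - 1))

/-- By homogeneity the distribution function of |ξ| is a constant times R^β on R > 0. Its derivative
is the radial density, and both measures are determined by half-open intervals. -/
lemma map_norm_spectralMeasure (hd : 1 ≤ d) (hH : ∀ i, 0 < H i ∧ H i < 1) :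
    (spectralMeasure H).map norm = (volume.restrict (Set.Ioi (0 : ℝ))).withDensity
      fun ρ => ENNReal.ofReal (radialDensity H ρ) := by
  have hβ := specDim_pos hd hH
  have hc := ballMass_pos hH
  set F : ℝ → ℝ := fun R => if R ≤ 0 then 0 else ballMass H * R ^ specDim H with hF
  have hpre : ∀ R : ℝ, norm ⁻¹' Set.Iic R = Metric.closedBall (0 : Sp d) R := by
    intro R; ext ξ; simp
  have h1 : ∀ R, (spectralMeasure H).map norm (Set.Iic R) = ENNReal.ofReal (F R) := by
    intro R
    rw [Measure.map_apply measurable_norm measurableSet_Iic, hpre]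
    simp only [hF]
    split_ifs with h
    -- The origin is a null set only because d ≥ 1.
    · have : Nontrivial (Sp d) := by
        have : Nonempty (Fin d) := ⟨⟨0, hd⟩⟩
        infer_instance
      have hs : Metric.closedBall (0 : Sp d) R ⊆ {0} := by
        intro ξ hξ
        have : ‖ξ‖ ≤ R := by simpa using hξ
        exact norm_eq_zero.1 (le_antisymm (this.trans h) (norm_nonneg _))
      rw [ENNReal.ofReal_zero]
      exact spectralMeasure_absolutelyContinuous H (measure_mono_null hs (measure_singleton 0))
    · rw [not_le] at h
      rw [spectralMeasure_closedBall h, mul_comm (ballMass H), ENNReal.ofReal_mul (by positivity),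
        ballMass, ENNReal.ofReal_toReal (spectralMeasure_closedBall_one_lt_top hH).ne]
  have h2 : ∀ R, (volume.restrict (Set.Ioi (0 : ℝ))).withDensity
      (fun ρ => ENNReal.ofReal (radialDensity H ρ)) (Set.Iic R) = ENNReal.ofReal (F R) := by
    intro R
    rw [withDensity_apply _ measurableSet_Iic, Measure.restrict_restrict measurableSet_Iic,
      Set.inter_comm, Set.Ioi_inter_Iic]
    simp only [hF]
    split_ifs with h
    · simp [Set.Ioc_eq_empty (not_lt.2 h)]
    · rw [not_le] at h
      have hi : IntervalIntegrable (radialDensity H) volume 0 R :=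
        ((intervalIntegral.intervalIntegrable_rpow' (by linarith)).const_mul _).const_mul _
      rw [← ofReal_integral_eq_lintegral_ofReal
        ((intervalIntegrable_iff_integrableOn_Ioc_of_le h.le).1 hi),
        ← intervalIntegral.integral_of_le h.le]
      · congr 1
        simp only [radialDensity]
        rw [intervalIntegral.integral_const_mul, intervalIntegral.integral_const_mul,
          integral_rpow (Or.inl (by linarith)), sub_add_cancel, Real.zero_rpow hβ.ne']
        field_simp
        ring
      · refine (ae_restrict_iff' measurableSet_Ioc).2 (Eventually.of_forall fun ρ hρ => ?_)
        have := hρ.1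
        simp only [radialDensity, Pi.zero_apply]
        positivity
  have hfin : ∀ R, (spectralMeasure H).map norm (Set.Iic R) < ∞ := fun R => by
    rw [h1]; exact ENNReal.ofReal_lt_top
  have : IsLocallyFiniteMeasure ((spectralMeasure H).map norm) :=
    ⟨fun x => ⟨Set.Iic (x + 1), Iic_mem_nhds (by linarith), hfin _⟩⟩
  refine Measure.ext_of_Ioc _ _ fun a b hab => ?_
  have hd : Set.Ioc a b = Set.Iic b \ Set.Iic a := by
    ext x; simp [and_comm]
  rw [hd, measure_sdiff (Set.Iic_subset_Iic.2 hab.le)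
    measurableSet_Iic.nullMeasurableSet (hfin a).ne, measure_sdiff (Set.Iic_subset_Iic.2 hab.le)
    measurableSet_Iic.nullMeasurableSet (by rw [h2]; exact ENNReal.ofReal_ne_top), h1, h1, h2, h2]

lemma measurable_radialDensity (H : Fin d → ℝ) : Measurable (radialDensity H) := by
  unfold radialDensity; fun_prop

/-- Integration of radial functions against the spectral measure. -/
theorem lintegral_norm_spectralMeasure (hd : 1 ≤ d) (hH : ∀ i, 0 < H i ∧ H i < 1)
    {f : ℝ → ℝ≥0∞} (hf : Measurable f) : ∫⁻ ξ, f ‖ξ‖ ∂spectralMeasure H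
      = ∫⁻ ρ in Set.Ioi (0 : ℝ), ENNReal.ofReal (radialDensity H ρ) * f ρ := by
  rw [← lintegral_map hf measurable_norm, map_norm_spectralMeasure hd hH,
    lintegral_withDensity_eq_lintegral_mul _ (measurable_radialDensity H).ennreal_ofReal hf]
  rfl

lemma integrable_gaussian_spectralMeasure (hd : 1 ≤ d) (hH : ∀ i, 0 < H i ∧ H i < 1) {b : ℝ}
    (hb : 0 < b) : Integrable (fun ξ : Sp d => Real.exp (-b * ‖ξ‖ ^ 2)) (spectralMeasure H) := by
  have hβ := specDim_pos hd hH
  refine ⟨Measurable.aestronglyMeasurable (by fun_prop), ?_⟩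
  rw [HasFiniteIntegral]
  simp_rw [Real.enorm_of_nonneg (Real.exp_pos _).le]
  rw [lintegral_norm_spectralMeasure hd hH (f := fun ρ => ENNReal.ofReal (Real.exp (-b * ρ ^ 2)))
    (by fun_prop)]
  have hi := (integrableOn_rpow_mul_exp_neg_mul_sq hb
    (by linarith : -1 < specDim H - 1)).const_mul (ballMass H * specDim H)
  refine lt_of_eq_of_lt ?_ (Integrable.lintegral_lt_top hi)
  refine setLIntegral_congr_fun measurableSet_Ioi fun ρ hρ => ?_
  have hρ0 : 0 < ρ := hρ
  have := ballMass_pos hH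
  rw [← ENNReal.ofReal_mul (by unfold radialDensity; positivity), radialDensity]
  congr 1
  ring

end Polar


/-! ### Density of step functions in the space variable -/

section Density

variable {d : ℕ} {H : Fin d → ℝ}

open scoped FourierTransform SchwartzMap ContDiff in
/-- An integrable function whose Fourier transform vanishes is zero almost everywhere. -/
lemma ae_eq_zero_of_fourier_eq_zero {F : Sp d → ℂ} (hF : Integrable F)
    (h : ∀ y : Sp d, ∫ ξ, Complex.exp (Complex.I * (inner ℝ ξ y : ℝ)) * F ξ = 0) :
    ∀ᵐ ξ, F ξ = 0 := by
  have hz : ∀ w, 𝓕 F w = 0 := by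
    intro w
    -- The hypothesis at -2πw is the Fourier transform at w in the convention with e^{-2πi⟨ξ,w⟩}.
    rw [Real.fourier_eq', ← h ((-2 * Real.pi) • w)]
    congr 1; ext ξ
    rw [smul_eq_mul, inner_smul_right]
    congr 2
    push_cast; ring
  -- A smooth compactly supported test function is the Fourier transform of a Schwartz function, and
  -- in the pairing with F the transform can be moved onto F, where it vanishes.
  refine ae_eq_zero_of_integral_contDiff_smul_eq_zero hF.locallyIntegrable fun g hg hgs => ?_
  have hgc : HasCompactSupport fun ξ => (g ξ : ℂ) := hgs.comp_left Complex.ofReal_zero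
  set φ : 𝓢(Sp d, ℂ) := hgc.toSchwartzMap (Complex.ofRealCLM.contDiff.comp hg) with hφ
  have hφg : ∀ ξ, φ ξ = (g ξ : ℂ) := fun ξ => rfl
  have h1 : (𝓕 ((𝓕⁻ φ : 𝓢(Sp d, ℂ)) : Sp d → ℂ)) = φ := by
    rw [← SchwartzMap.fourier_coe, FourierTransform.fourier_fourierInv_eq]
  have h2 := VectorFourier.integral_fourierIntegral_smul_eq_flip (L := innerₗ (Sp d))
    (μ := volume) (ν := volume) Real.continuous_fourierChar continuous_inner
    (𝓕⁻ φ : 𝓢(Sp d, ℂ)).integrable hF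
  have h3 : ∀ w, VectorFourier.fourierIntegral Real.fourierChar volume (innerₗ (Sp d)).flip F w
      = 0 := by
    intro w
    rw [flip_innerₗ]
    exact hz w
  simp only [h3, smul_zero, integral_zero] at h2
  rw [← h2]
  congr 1; ext ξ
  have : VectorFourier.fourierIntegral Real.fourierChar volume (innerₗ (Sp d))
      (𝓕⁻ φ : 𝓢(Sp d, ℂ)) ξ = φ ξ := congrFun h1 ξ
  rw [this, hφg, smul_eq_mul, Complex.real_smul]

lemma intervalFourier_add (c e y x : ℝ) : intervalFourier (y + c) (y + e) x
    = Complex.exp (-(Complex.I * ((x * y : ℝ) : ℂ))) * intervalFourier c e x := by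
  by_cases h : c ≤ e
  · unfold intervalFourier
    rw [← intervalIntegral.integral_of_le h, ← intervalIntegral.integral_of_le (by linarith),
      ← intervalIntegral.integral_comp_add_left, ← intervalIntegral.integral_const_mul]
    congr 1; ext z
    rw [← Complex.exp_add]
    congr 1; push_cast; ring
  · unfold intervalFourier
    rw [Set.Ioc_eq_empty (by linarith), Set.Ioc_eq_empty (by linarith)]
    simp

/-- The Fourier transform of the indicator function of the unit cube with corner `y`. -/
noncomputable def cubeFourier (y ξ : Sp d) : ℂ :=
  sideFourier y (y + WithLp.toLp 2 1) ξ

lemma cubeFourier_eq (y ξ : Sp d) : cubeFourier y ξ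
    = Complex.exp (-(Complex.I * (inner ℝ ξ y : ℝ))) * cubeFourier 0 ξ := by
  have h : Complex.exp (-(Complex.I * (inner ℝ ξ y : ℝ)))
      = ∏ k, Complex.exp (-(Complex.I * ((ξ k * y k : ℝ) : ℂ))) := by
    rw [← Complex.exp_sum, Finset.sum_neg_distrib, ← Finset.mul_sum, PiLp.inner_apply]
    push_cast
    congr 3
    refine Finset.sum_congr rfl fun k _ => ?_
    simp [mul_comm]
  rw [h, cubeFourier, cubeFourier, sideFourier, sideFourier, ← Finset.prod_mul_distrib]
  refine Finset.prod_congr rfl fun k _ => ?_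
  rw [← intervalFourier_add]
  simp

lemma ae_euclidean {p : ℝ → Prop} (hp : ∀ᵐ x, p x) (k : Fin d) : ∀ᵐ ξ : Sp d, p (ξ k) :=
  ((Measure.quasiMeasurePreserving_eval (fun _ : Fin d => (volume : Measure ℝ)) k).comp
    (PiLp.volume_preserving_ofLp (Fin d)).quasiMeasurePreserving).ae hp

lemma ae_cos_ne_one : ∀ᵐ x : ℝ, Real.cos x ≠ 1 := by
  have : {x : ℝ | Real.cos x = 1} = Set.range fun n : ℤ => (n : ℝ) * (2 * Real.pi) := by
    ext x
    exact Real.cos_eq_one_iff x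
  rw [ae_iff]
  simp only [not_not]
  rw [this]
  exact (Set.countable_range _).measure_zero _

/-- In one variable the squared modulus is 2(1 - cos x)/x², which for x ≠ 0 vanishes only where cos
x = 1, a countable set. -/
lemma ae_cubeFourier_ne_zero : ∀ᵐ ξ : Sp d, cubeFourier 0 ξ ≠ 0 ∧ ∀ k, ξ k ≠ 0 := by
  have h : ∀ᵐ ξ : Sp d, ∀ k, Real.cos (ξ k) ≠ 1 := ae_all_iff.2 fun k => ae_euclidean ae_cos_ne_one k
  filter_upwards [h] with ξ hξ
  have h0 : ∀ k, ξ k ≠ 0 := fun k hk => hξ k (by rw [hk, Real.cos_zero])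
  refine ⟨?_, h0⟩
  rw [cubeFourier, sideFourier, Finset.prod_ne_zero_iff]
  intro k _ hk
  have h1 := intervalFourier_mul_conj (c := 0) (e := 1) (c' := 0) (e' := 1) (by norm_num)
    (by norm_num) (h0 k)
  have hk' : intervalFourier 0 1 (ξ k) = 0 := by simpa using hk
  rw [hk'] at h1
  have h2 : 0 < |ξ k| ^ (-2 : ℝ) := Real.rpow_pos_of_pos (abs_pos.2 (h0 k)) _
  simp only [zero_mul, Complex.zero_re, zero_sub, sub_zero, sub_self, neg_mul, one_mul,
    Real.cos_neg, Real.cos_zero] at h1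
  rcases mul_eq_zero.1 h1.symm with h3 | h3
  · exact hξ k (by linarith)
  · exact h2.ne' h3

lemma memLp_cubeFourier (hH : ∀ i, 0 < H i ∧ H i < 1) (y : Sp d) :
    MemLp (cubeFourier y) 2 (spectralMeasure H) :=
  memLp_sideFourier hH fun i => by simp

/-- Translating the cube by y multiplies its transform by e^{-iξ·y}. Hence f orthogonal to all
translates means that the integrable function f · conj(`cubeFourier 0`) · density has zero Fourier
transform. It vanishes almost everywhere, and the two factors beside f are almost everywhere
nonzero. -/
lemma span_cubeFourier_dense (hH : ∀ i, 0 < H i ∧ H i < 1) :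
    (Submodule.span ℂ (Set.range fun y => (memLp_cubeFourier hH y).toLp _)).topologicalClosure
      = ⊤ := by
  rw [Submodule.topologicalClosure_eq_top_iff, Submodule.eq_bot_iff]
  intro f hf
  rw [Submodule.mem_orthogonal] at hf
  have h1 : ∀ y, ∫ ξ, f ξ * conj (cubeFourier y ξ) ∂spectralMeasure H = 0 := by
    intro y
    have := hf _ (Submodule.subset_span ⟨y, rfl⟩)
    rw [L2.inner_def] at this
    rw [← this]
    refine integral_congr_ae ?_
    filter_upwards [(memLp_cubeFourier hH y).coeFn_toLp] with ξ hξ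
    rw [hξ]
    rfl
  set G : Sp d → ℂ := fun ξ => (∏ k, (specDensity (H k) (ξ k) : ℂ)) *
    (f ξ * conj (cubeFourier 0 ξ)) with hG
  have hGi : Integrable G := by
    rw [hG, ← integrable_spectralMeasure hH]
    exact (Lp.memLp f).integrable_mul (memLp_cubeFourier hH 0).star
  have h2 : ∀ᵐ ξ, G ξ = 0 := by
    refine ae_eq_zero_of_fourier_eq_zero hGi fun y => ?_
    rw [← h1 y, integral_spectralMeasure hH]
    congr 1; ext ξ
    rw [cubeFourier_eq y ξ, map_mul, ← Complex.exp_conj, hG]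
    simp only [map_neg, map_mul, Complex.conj_I, Complex.conj_ofReal, neg_mul, neg_neg]
    ring
  have h3 : ∀ᵐ ξ, f ξ = 0 := by
    filter_upwards [h2, ae_cubeFourier_ne_zero] with ξ hξ h0
    have hw : ∏ k, (specDensity (H k) (ξ k) : ℂ) ≠ 0 := by
      rw [Finset.prod_ne_zero_iff]
      intro k _
      have : 0 < specDensity (H k) (ξ k) := mul_pos (specConst_pos (hH k).1 (hH k).2)
        (Real.rpow_pos_of_pos (abs_pos.2 (h0.2 k)) _)
      exact_mod_cast this.ne'
    have hc : conj (cubeFourier 0 ξ) ≠ 0 := (map_ne_zero _).2 h0.1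
    simpa [hG, hw, hc] using hξ
  refine Lp.ext ?_
  filter_upwards [(spectralMeasure_absolutelyContinuous H).ae_le h3, Lp.coeFn_zero ℂ 2
    (spectralMeasure H)] with ξ h4 h5
  rw [h4, h5]; rfl

/-- `ψ` is the Fourier transform of a spatial step function `f` such that `1_{(a,b]} ⊗ f` is an
elementary integrand. -/
def IsStep (a b : ℝ≥0) (ψ : Sp d → ℂ) : Prop :=
  ∃ e : Elem d, ∀ r ξ, e.hat r ξ
    = (((Set.Ioc (a : ℝ) b).indicator (1 : ℝ → ℝ) r : ℝ) : ℂ) * ψ ξ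

lemma elem_hat_add (e e' : Elem d) (r : ℝ) (ξ : Sp d) :
    (e + e').hat r ξ = e.hat r ξ + e'.hat r ξ :=
  Finsupp.sum_add_index' (fun B => by simp) fun B b₁ b₂ => by push_cast; ring

lemma elem_hat_smul (c : ℝ) (e : Elem d) (r : ℝ) (ξ : Sp d) :
    (c • e).hat r ξ = c * e.hat r ξ := by
  rw [Elem.hat, Elem.hat, Finsupp.sum_smul_index (fun B => by simp), Finsupp.mul_sum]
  simp only [Complex.ofReal_mul, mul_assoc]

lemma IsStep.add {a b : ℝ≥0} {ψ ψ' : Sp d → ℂ} (h : IsStep a b ψ) (h' : IsStep a b ψ') :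
    IsStep a b (fun ξ => ψ ξ + ψ' ξ) := by
  obtain ⟨e, he⟩ := h
  obtain ⟨e', he'⟩ := h'
  exact ⟨e + e', fun r ξ => by rw [elem_hat_add, he, he']; ring⟩

lemma IsStep.smul {a b : ℝ≥0} {ψ : Sp d → ℂ} (c : ℝ) (h : IsStep a b ψ) :
    IsStep a b (fun ξ => c * ψ ξ) := by
  obtain ⟨e, he⟩ := h
  exact ⟨c • e, fun r ξ => by rw [elem_hat_smul, he]; ring⟩

lemma isStep_zero (a b : ℝ≥0) : IsStep a b (fun _ : Sp d => 0) :=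
  ⟨0, fun r ξ => by simp [Elem.hat]⟩

lemma isStep_cubeFourier {a b : ℝ≥0} (hab : a < b) (y : Sp d) : IsStep a b (cubeFourier y) := by
  refine ⟨Finsupp.single ⟨a, b, y, y + WithLp.toLp 2 1, hab, fun i => by simp⟩ 1, fun r ξ => ?_⟩
  rw [Elem.hat, Finsupp.sum_single_index (by simp)]
  simp [Box.hat, cubeFourier]

lemma elem_hat_neg (e : Elem d) (r : ℝ) (ξ : Sp d) : e.hat r (-ξ) = conj (e.hat r ξ) := by
  simp only [Elem.hat, Finsupp.sum, Box.hat, sideFourier_neg, map_sum, map_mul,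
    Complex.conj_ofReal]

lemma memLp_elem_hat (hH : ∀ i, 0 < H i ∧ H i < 1) (e : Elem d) (r : ℝ) :
    MemLp (e.hat r) 2 (spectralMeasure H) := by
  have : e.hat r = fun ξ => ∑ B ∈ e.support, (e B : ℂ) *
      ((((Set.Ioc (B.a : ℝ) B.b).indicator (1 : ℝ → ℝ) r : ℝ) : ℂ) *
        sideFourier B.lo B.hi ξ) := rfl
  rw [this]
  exact memLp_finsetSum _ fun B _ =>
    ((memLp_sideFourier hH fun i => (B.lo_lt_hi i).le).const_mul _).const_mul _

lemma IsStep.eq_hat {a b : ℝ≥0} (hab : a < b) {ψ : Sp d → ℂ} (h : IsStep a b ψ) :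
    ∃ e : Elem d, ψ = e.hat b := by
  obtain ⟨e, he⟩ := h
  refine ⟨e, funext fun ξ => ?_⟩
  -- The right endpoint b belongs to (a, b], so evaluating there isolates ψ.
  rw [he, Set.indicator_of_mem (show (b : ℝ) ∈ Set.Ioc (a : ℝ) b from
    ⟨NNReal.coe_lt_coe.2 hab, le_rfl⟩)]
  simp

lemma measurePreserving_neg_spectralMeasure (H : Fin d → ℝ) :
    MeasurePreserving (fun ξ : Sp d => -ξ) (spectralMeasure H) (spectralMeasure H) := by
  refine ⟨measurable_neg, Measure.ext_of_lintegral _ fun f hf => ?_⟩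
  have hm := (measurable_prod_specDensity H).ennreal_ofReal
  rw [lintegral_map hf measurable_neg, spectralMeasure_eq,
    lintegral_withDensity_eq_lintegral_mul _ hm hf,
    lintegral_withDensity_eq_lintegral_mul _ hm
      (show Measurable fun ξ : Sp d => f (-ξ) from hf.comp measurable_neg),
    ← lintegral_neg_eq_self]
  refine lintegral_congr fun ξ => ?_
  simp [specDensity]

/-- Hermitian functions are limits of Fourier transforms of real step functions. -/
theorem exists_isStep_eLpNorm_le (hH : ∀ i, 0 < H i ∧ H i < 1) {a b : ℝ≥0} (hab : a < b)
    {φ : Sp d → ℂ} (hφ : MemLp φ 2 (spectralMeasure H)) (hφs : ∀ ξ, φ (-ξ) = conj (φ ξ))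
    {η : ℝ} (hη : 0 < η) :
    ∃ ψ, IsStep a b ψ ∧ eLpNorm (fun ξ => φ ξ - ψ ξ) 2 (spectralMeasure H) ≤ ENNReal.ofReal η := by
  have hcl : hφ.toLp φ ∈ (Submodule.span ℂ
      (Set.range fun y => (memLp_cubeFourier hH y).toLp _)).topologicalClosure := by
    rw [span_cubeFourier_dense hH]; trivial
  rw [← SetLike.mem_coe, Submodule.topologicalClosure_coe, EMetric.mem_closure_iff] at hcl
  obtain ⟨x, hx, hxη⟩ := hcl (ENNReal.ofReal η) (by simpa using hη)
  -- The complex span is too large, since elementary integrands have real coefficients; separate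
  -- real and imaginary parts of the coefficients.
  have hrep : ∃ ψ₁ ψ₂, IsStep a b ψ₁ ∧ IsStep a b ψ₂ ∧
      x =ᵐ[spectralMeasure H] fun ξ => ψ₁ ξ + Complex.I * ψ₂ ξ := by
    clear hxη
    rw [SetLike.mem_coe] at hx
    induction hx using Submodule.span_induction with
    | mem x hx =>
      obtain ⟨y, rfl⟩ := hx
      refine ⟨_, _, isStep_cubeFourier hab y, isStep_zero a b, ?_⟩
      filter_upwards [(memLp_cubeFourier hH y).coeFn_toLp] with ξ hξ
      simp [hξ]
    | zero =>
      refine ⟨_, _, isStep_zero a b, isStep_zero a b, ?_⟩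
      filter_upwards [Lp.coeFn_zero ℂ 2 (spectralMeasure H)] with ξ hξ
      rw [hξ]; simp
    | add x y _ _ hx hy =>
      obtain ⟨p, q, hp, hq, h⟩ := hx
      obtain ⟨p', q', hp', hq', h'⟩ := hy
      refine ⟨_, _, hp.add hp', hq.add hq', ?_⟩
      filter_upwards [h, h', Lp.coeFn_add x y] with ξ h1 h2 h3
      rw [h3, Pi.add_apply, h1, h2]; ring
    | smul c x _ hx =>
      obtain ⟨p, q, hp, hq, h⟩ := hx
      refine ⟨_, _, (hp.smul c.re).add (hq.smul (-c.im)), (hp.smul c.im).add (hq.smul c.re), ?_⟩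
      filter_upwards [h, Lp.coeFn_smul c x] with ξ h1 h2
      rw [h2, Pi.smul_apply, h1, smul_eq_mul]
      nth_rewrite 1 [← Complex.re_add_im c]
      push_cast
      linear_combination (c.im * q ξ) * Complex.I_mul_I
  obtain ⟨ψ₁, ψ₂, h₁, h₂, hxe⟩ := hrep
  refine ⟨ψ₁, h₁, ?_⟩
  obtain ⟨e₁, he₁⟩ := h₁.eq_hat hab
  obtain ⟨e₂, he₂⟩ := h₂.eq_hat hab
  have hm₁ : MemLp ψ₁ 2 (spectralMeasure H) := he₁ ▸ memLp_elem_hat hH e₁ b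
  have hm₂ : MemLp ψ₂ 2 (spectralMeasure H) := he₂ ▸ memLp_elem_hat hH e₂ b
  set D : Sp d → ℂ := fun ξ => φ ξ - (ψ₁ ξ + Complex.I * ψ₂ ξ) with hD
  have hDm : MemLp D 2 (spectralMeasure H) := hφ.sub (hm₁.add (hm₂.const_mul _))
  set D' : Sp d → ℂ := fun ξ => conj (D (-ξ)) with hD'
  have hD'm : AEStronglyMeasurable D' (spectralMeasure H) :=
    Complex.continuous_conj.comp_aestronglyMeasurable
      (hDm.1.comp_measurePreserving (measurePreserving_neg_spectralMeasure H))
  have hnorm : eLpNorm D' 2 (spectralMeasure H) = eLpNorm D 2 (spectralMeasure H) := by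
    rw [← eLpNorm_comp_measurePreserving hDm.1 (measurePreserving_neg_spectralMeasure H)]
    refine eLpNorm_congr_norm_ae (Eventually.of_forall fun ξ => ?_)
    simp [hD']
  -- The transforms ψ₁ and ψ₂ are Hermitian, as φ is, so D' = φ - ψ₁ + iψ₂. Averaging with D = φ -
  -- ψ₁ - iψ₂ removes ψ₂ without increasing the norm.
  have hsum : (fun ξ => φ ξ - ψ₁ ξ) = (1 / 2 : ℂ) • (D + D') := by
    ext ξ
    simp only [hD', hD, Pi.smul_apply, Pi.add_apply, hφs, he₁, he₂, elem_hat_neg, map_sub, map_add,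
      map_mul, Complex.conj_conj, Complex.conj_I, smul_eq_mul]
    ring
  have hDη : eLpNorm D 2 (spectralMeasure H) ≤ ENNReal.ofReal η := by
    rw [Lp.edist_def] at hxη
    refine le_trans (le_of_eq (eLpNorm_congr_ae ?_)) hxη.le
    filter_upwards [hφ.coeFn_toLp, hxe] with ξ h3 h4
    rw [Pi.sub_apply, h3, h4]
  rw [hsum, eLpNorm_const_smul]
  calc ‖(1 / 2 : ℂ)‖ₑ * eLpNorm (D + D') 2 (spectralMeasure H)
      ≤ ‖(1 / 2 : ℂ)‖ₑ * (ENNReal.ofReal η + ENNReal.ofReal η) := by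
        gcongr
        refine (eLpNorm_add_le hDm.1 hD'm (by norm_num)).trans ?_
        rw [hnorm]
        gcongr
    _ = ENNReal.ofReal η := by
        rw [← ofReal_norm, ← ENNReal.ofReal_add hη.le hη.le,
          ← ENNReal.ofReal_mul (norm_nonneg _)]
        congr 1
        norm_num
        ring

end Density


/-! ### The mollified Green's function -/

section Mollified

variable {d : ℕ} {H : Fin d → ℝ} {H₀ : ℝ}

/-- The Fourier transform `e^{-ε|ξ|²/2}` of the heat kernel. -/
noncomputable def heatFourier (ε : ℝ) (ξ : Sp d) : ℝ := Real.exp (-(ε / 2) * ‖ξ‖ ^ 2)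

lemma heatFourier_pos (ε : ℝ) (ξ : Sp d) : 0 < heatFourier ε ξ := Real.exp_pos _

lemma measurable_heatFourier (ε : ℝ) : Measurable (heatFourier (d := d) ε) := by
  unfold heatFourier; fun_prop

lemma fourier_heatKernel {ε : ℝ} (hε : 0 < ε) (ξ : Sp d) :
    fourier (heatKernel ε) ξ = heatFourier ε ξ := by
  have hb : 0 < ((1 / (2 * ε) : ℝ) : ℂ).re := by rw [Complex.ofReal_re]; positivity
  have h := GaussianFourier.integral_cexp_neg_mul_sq_norm_add hb (-Complex.I) ξ
  have hpos : 0 < 2 * Real.pi * ε := by positivity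
  unfold fourier heatKernel heatFourier
  have e1 : ∀ y : Sp d, Complex.exp (-(Complex.I * (inner ℝ ξ y : ℝ))) *
      (((2 * Real.pi * ε) ^ (-(d : ℝ) / 2) * Real.exp (-‖y‖ ^ 2 / (2 * ε)) : ℝ) : ℂ)
      = (((2 * Real.pi * ε) ^ (-(d : ℝ) / 2) : ℝ) : ℂ) *
        Complex.exp (-((1 / (2 * ε) : ℝ) : ℂ) * ‖y‖ ^ 2 + -Complex.I * (inner ℝ ξ y : ℝ)) := by
    intro y
    rw [Complex.exp_add]
    push_cast
    rw [mul_comm, mul_assoc]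
    congr 2
    · congr 1; ring
    · congr 1; ring
  simp_rw [e1]
  rw [integral_const_mul, h, finrank_euclideanSpace_fin]
  have e2 : (Real.pi : ℂ) / ((1 / (2 * ε) : ℝ) : ℂ) = ((2 * Real.pi * ε : ℝ) : ℂ) := by
    push_cast; field_simp
  have e3 : (((d : ℂ)) / 2) = (((d : ℝ) / 2 : ℝ) : ℂ) := by push_cast; rfl
  rw [e2, e3, ← Complex.ofReal_cpow hpos.le, ← mul_assoc, ← Complex.ofReal_mul,
    ← Real.rpow_add hpos, show -(d : ℝ) / 2 + d / 2 = 0 by ring, Real.rpow_zero]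
  push_cast
  rw [one_mul, neg_sq, Complex.I_sq]
  congr 1
  field_simp
  ring

/-- The sine is 1-Lipschitz, so the bound is uniform in the frequency ρ, which is what discretising
time requires. At ρ = 0 both quotients are 0 by convention. -/
lemma abs_sin_mul_div_sub_le (t s : ℝ) {ρ : ℝ} (hρ : 0 ≤ ρ) :
    |Real.sin (t * ρ) / ρ - Real.sin (s * ρ) / ρ| ≤ |t - s| := by
  rcases hρ.eq_or_lt with rfl | hρ
  · simp
  · rw [← sub_div, abs_div, abs_of_pos hρ, div_le_iff₀ hρ]
    refine (Real.abs_sin_sub_sin_le _ _).trans ?_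
    rw [← sub_mul, abs_mul, abs_of_pos hρ]

lemma abs_greenFourier_sub_le (t s : ℝ) (ξ : Sp d) :
    |greenFourier t ξ - greenFourier s ξ| ≤ |t - s| :=
  abs_sin_mul_div_sub_le t s (norm_nonneg ξ)

/-- The spatial Fourier transform of `(G_τ * p_ε)(x - ·)`. -/
noncomputable def greenSlice (ε τ : ℝ) (x ξ : Sp d) : ℂ :=
  Complex.exp (-(Complex.I * (inner ℝ ξ x : ℝ))) * (greenFourier τ ξ : ℂ) * (heatFourier ε ξ : ℂ)

lemma mollifiedKernel_eq {ε : ℝ} (hε : 0 < ε) (t : ℝ) (x : Sp d) (s : ℝ) (ξ : Sp d) :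
    mollifiedKernel ε t x s ξ = if s ∈ Set.Icc 0 t then greenSlice ε (t - s) x ξ else 0 := by
  simp only [mollifiedKernel, Set.indicator, fourier_heatKernel hε, greenSlice]

lemma norm_exp_neg_I_mul (r : ℝ) : ‖Complex.exp (-(Complex.I * (r : ℂ)))‖ = 1 := by
  rw [show -(Complex.I * (r : ℂ)) = ((-r : ℝ) : ℂ) * Complex.I by push_cast; ring]
  exact Complex.norm_exp_ofReal_mul_I _

lemma norm_greenSlice_sub_le (ε τ τ' : ℝ) (x ξ : Sp d) :
    ‖greenSlice ε τ x ξ - greenSlice ε τ' x ξ‖ ≤ |τ - τ'| * heatFourier ε ξ := by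
  have e : greenSlice ε τ x ξ - greenSlice ε τ' x ξ = Complex.exp (-(Complex.I * (inner ℝ ξ x : ℝ)))
      * ((greenFourier τ ξ - greenFourier τ' ξ : ℝ) : ℂ) * (heatFourier ε ξ : ℂ) := by
    simp only [greenSlice]; push_cast; ring
  rw [e, norm_mul, norm_mul, norm_exp_neg_I_mul, one_mul, Complex.norm_real, Complex.norm_real,
    Real.norm_of_nonneg (heatFourier_pos ε ξ).le]
  exact mul_le_mul_of_nonneg_right (abs_greenFourier_sub_le τ τ' ξ) (heatFourier_pos ε ξ).le

lemma measurable_greenSlice (ε : ℝ) (x : Sp d) :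
    Measurable fun p : ℝ × Sp d => greenSlice ε p.1 x p.2 := by
  unfold greenSlice greenFourier
  have := measurable_heatFourier (d := d) ε
  fun_prop

lemma measurable_mollifiedKernel {ε : ℝ} (hε : 0 < ε) (t : ℝ) (x : Sp d) :
    Measurable (Function.uncurry (mollifiedKernel ε t x)) := by
  have : Function.uncurry (mollifiedKernel ε t x)
      = fun p : ℝ × Sp d => if p.1 ∈ Set.Icc 0 t then greenSlice ε (t - p.1) x p.2 else 0 := by
    ext p; exact mollifiedKernel_eq hε t x p.1 p.2
  rw [this]
  refine Measurable.ite (measurable_fst measurableSet_Icc) ?_ measurable_const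
  exact (measurable_greenSlice ε x).comp (f := fun p : ℝ × Sp d => (t - p.1, p.2)) (by fun_prop)

lemma memLp_heatFourier (hd : 1 ≤ d) (hH : ∀ i, 0 < H i ∧ H i < 1) {ε : ℝ} (hε : 0 < ε) :
    MemLp (heatFourier (d := d) ε) 2 (spectralMeasure H) := by
  rw [memLp_two_iff_integrable_sq (measurable_heatFourier ε).aestronglyMeasurable]
  refine (integrable_gaussian_spectralMeasure hd hH hε).congr (Eventually.of_forall fun ξ => ?_)
  simp only [heatFourier]
  rw [← Real.exp_nat_mul]
  congr 1; push_cast; ring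

lemma memLp_greenSlice (hd : 1 ≤ d) (hH : ∀ i, 0 < H i ∧ H i < 1) {ε : ℝ} (hε : 0 < ε) (τ : ℝ)
    (x : Sp d) : MemLp (greenSlice ε τ x) 2 (spectralMeasure H) := by
  refine ((memLp_heatFourier hd hH hε).const_mul |τ|).mono
    ((measurable_greenSlice ε x).comp measurable_prodMk_left).aestronglyMeasurable
    (Eventually.of_forall fun ξ => ?_)
  -- The slice at time 0 vanishes, so the Lipschitz bound in time also bounds the slice itself.
  have h := norm_greenSlice_sub_le ε τ 0 x ξ
  have h0 : greenSlice ε 0 x ξ = 0 := by simp [greenSlice, greenFourier]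
  rw [h0, sub_zero, sub_zero] at h
  exact h.trans (le_abs_self _)

/-- This Hermitian symmetry is what `exists_isStep_eLpNorm_le` requires of a target. -/
lemma greenSlice_neg (ε τ : ℝ) (x ξ : Sp d) :
    greenSlice ε τ x (-ξ) = conj (greenSlice ε τ x ξ) := by
  have h1 : greenFourier τ (-ξ) = greenFourier τ ξ := by simp [greenFourier]
  have h2 : heatFourier ε (-ξ) = heatFourier ε ξ := by simp [heatFourier]
  simp only [greenSlice, h1, h2, map_mul, Complex.conj_ofReal, ← Complex.exp_conj, map_neg,
    Complex.conj_I, inner_neg_left, Complex.ofReal_neg]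
  ring_nf

/-! ### Approximation by elementary integrands -/

/-- It lets r = 0 be ignored, where the closed interval [0,t] of the kernel and the half-open boxes
disagree. -/
lemma ae_pos_temporalMeasure (H₀ : ℝ) : ∀ᵐ p ∂temporalMeasure H₀, 0 < p.1 ∧ 0 < p.2 := by
  have hm : MeasurableSet {p : ℝ × ℝ | 0 < p.1 ∧ 0 < p.2} :=
    (measurableSet_lt measurable_const measurable_fst).inter
      (measurableSet_lt measurable_const measurable_snd)
  by_cases h : H₀ = 1 / 2
  · subst h
    rw [temporalMeasure_half, ae_map_iff (by fun_prop) hm]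
    filter_upwards [ae_restrict_mem measurableSet_Ioi] with r hr using ⟨hr, hr⟩
  · rw [temporalMeasure_of_ne h]
    refine (withDensity_absolutelyContinuous _ _).ae_le ?_
    change ∀ᵐ p ∂((volume.restrict (Set.Ioi (0 : ℝ))).prod (volume.restrict (Set.Ioi (0 : ℝ)))),
      0 < p.1 ∧ 0 < p.2
    rw [Measure.ae_prod_iff_ae_ae hm]
    filter_upwards [ae_restrict_mem measurableSet_Ioi] with r hr
    filter_upwards [ae_restrict_mem measurableSet_Ioi] with s hs using ⟨hr, hs⟩

/-- The energy density is dominated by the indicator of (0,M]² times q², whose integral factors and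
is known. -/
lemma finiteEnergy_of_le (hH₀ : 1 / 2 ≤ H₀) {f : ℝ → Sp d → ℂ}
    (hf : Measurable (Function.uncurry f)) {M : ℝ} (hM : 0 ≤ M) {q : Sp d → ℝ}
    (hq : MemLp q 2 (spectralMeasure H))
    (hfq : ∀ r, 0 < r → ∀ ξ, ‖f r ξ‖ ≤ (Set.Ioc 0 M).indicator (1 : ℝ → ℝ) r * q ξ) :
    FiniteEnergy H₀ H f ∧
      energy H₀ H f ≤ incCov H₀ 0 M 0 M * ∫ ξ, q ξ ^ 2 ∂spectralMeasure H := by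
  obtain ⟨h1, h2⟩ := integral_indicator_temporalMeasure hH₀ le_rfl hM le_rfl hM
  have hq2 : Integrable (fun ξ => q ξ ^ 2) (spectralMeasure H) := hq.integrable_sq
  have hI := h1.mul_prod hq2
  have hae : ∀ᵐ p ∂(temporalMeasure H₀).prod (spectralMeasure H),
      ‖energyDensity f p‖ ≤ (Set.Ioc 0 M).indicator (1 : ℝ → ℝ) p.1.1 *
      (Set.Ioc 0 M).indicator (1 : ℝ → ℝ) p.1.2 * q p.2 ^ 2 := by
    filter_upwards [Measure.quasiMeasurePreserving_fst.ae (ae_pos_temporalMeasure H₀)] with p hp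
    rw [energyDensity, norm_mul, RCLike.norm_conj]
    have a1 := hfq _ hp.1 p.2
    have a2 := hfq _ hp.2 p.2
    calc _ ≤ ((Set.Ioc 0 M).indicator (1 : ℝ → ℝ) p.1.1 * q p.2) *
          ((Set.Ioc 0 M).indicator (1 : ℝ → ℝ) p.1.2 * q p.2) :=
          mul_le_mul a1 a2 (norm_nonneg _) ((norm_nonneg _).trans a1)
      _ = _ := by ring
  have hmeas : Measurable (energyDensity f) :=
    (measurable_selfTensor hf).comp (measurable_spread d)
  have hfin : FiniteEnergy H₀ H f := hI.mono' hmeas.aestronglyMeasurable hae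
  refine ⟨hfin, ?_⟩
  calc energy H₀ H f ≤ ‖∫ p, energyDensity f p ∂(temporalMeasure H₀).prod (spectralMeasure H)‖ :=
        Complex.re_le_norm _
    _ ≤ ∫ p, ‖energyDensity f p‖ ∂(temporalMeasure H₀).prod (spectralMeasure H) :=
        norm_integral_le_integral_norm _
    _ ≤ _ := integral_mono_ae hfin.norm hI hae
    _ = _ := by
        rw [integral_prod_mul (fun p : ℝ × ℝ => (Set.Ioc 0 M).indicator (1 : ℝ → ℝ) p.1 *
          (Set.Ioc 0 M).indicator (1 : ℝ → ℝ) p.2) (fun ξ => q ξ ^ 2), h2]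

lemma elem_hat_zero (r : ℝ) (ξ : Sp d) : (0 : Elem d).hat r ξ = 0 := by simp [Elem.hat]

lemma elem_hat_sum {ι : Type*} (s : Finset ι) (e : ι → Elem d) (r : ℝ) (ξ : Sp d) :
    (∑ j ∈ s, e j).hat r ξ = ∑ j ∈ s, (e j).hat r ξ := by
  classical
  induction s using Finset.induction_on with
  | empty => simp [elem_hat_zero]
  | insert a s ha ih => rw [Finset.sum_insert ha, Finset.sum_insert ha, elem_hat_add, ih]

lemma sum_indicator_partition (t : ℝ) (ht : 0 ≤ t) {N : ℕ} (hN : 0 < N) (r : ℝ) :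
    ∑ j ∈ Finset.range N, (Set.Ioc (t * j / N) (t * (j + 1 : ℕ) / N)).indicator (1 : ℝ → ℝ) r
      = (Set.Ioc 0 t).indicator (1 : ℝ → ℝ) r := by
  set F : ℕ → ℝ := fun j => (Set.Iic (t * j / N)).indicator (1 : ℝ → ℝ) r with hF
  have h1 : ∀ a b : ℝ, a ≤ b → (Set.Ioc a b).indicator (1 : ℝ → ℝ) r
      = (Set.Iic b).indicator (1 : ℝ → ℝ) r - (Set.Iic a).indicator (1 : ℝ → ℝ) r := by
    intro a b hab
    simp only [Set.indicator, Set.mem_Ioc, Set.mem_Iic, Pi.one_apply]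
    split_ifs <;> first | linarith | grind
  have h2 : ∀ j : ℕ, t * j / N ≤ t * (j + 1 : ℕ) / N := by
    intro j
    push_cast
    gcongr
    linarith
  have hN' : (N : ℝ) ≠ 0 := by positivity
  rw [Finset.sum_congr rfl fun j _ => h1 _ _ (h2 j), Finset.sum_range_sub F, h1 _ _ ht, hF]
  simp only [Nat.cast_zero, mul_zero, zero_div, mul_div_cancel_right₀ _ hN']

/-- Cut (0,t] into N equal pieces, freeze the kernel at the left end of each piece, and approximate
each frozen slice in L²(μ) by a spatial step function. Freezing costs at most t/N times the norm of
the heat factor; the N slices cost θ/N each. -/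
theorem exists_elem_energy_le (hd : 1 ≤ d) (hH₀ : 1 / 2 ≤ H₀) (hH : ∀ i, 0 < H i ∧ H i < 1)
    {ε : ℝ} (hε : 0 < ε) (t : ℝ≥0) (x : Sp d) {η : ℝ} (hη : 0 < η) :
    ∃ e : Elem d, FiniteEnergy H₀ H (fun r ξ => e.hat r ξ - mollifiedKernel ε t x r ξ) ∧
      energy H₀ H (fun r ξ => e.hat r ξ - mollifiedKernel ε t x r ξ) ≤ η := by
  -- For t = 0 the pieces would be empty, which boxes do not allow, but then the kernel vanishes and
  -- 0 approximates it.
  rcases eq_or_lt_of_le (zero_le : 0 ≤ t) with rfl | ht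
  · have h0 : ∀ r ξ, (0 : Elem d).hat r ξ - mollifiedKernel ε (0 : ℝ≥0) x r ξ = 0 := by
      intro r ξ
      rw [elem_hat_zero, mollifiedKernel_eq hε]
      split_ifs with h
      · have : r = 0 := le_antisymm (by simpa using h.2) h.1
        simp [this, greenSlice, greenFourier]
      · simp
    refine ⟨0, ?_⟩
    simp_rw [h0]
    constructor
    · rw [FiniteEnergy]
      have : energyDensity (fun (_ : ℝ) (_ : Sp d) => (0 : ℂ)) = fun _ => 0 := by
        ext p; simp [energyDensity]
      rw [this]
      exact integrable_zero _ _ _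
    · simp [energy, energyDensity, hη.le]
  have ht' : (0 : ℝ) < t := ht
  obtain ⟨hC, -⟩ := temporalMeasure_rectangle hH₀ le_rfl ht'.le le_rfl ht'.le
  set C := incCov H₀ 0 t 0 t
  set ν := spectralMeasure H
  have hq0 := memLp_heatFourier hd hH hε
  set A := (eLpNorm (heatFourier (d := d) ε) 2 ν).toReal with hA
  have hA' : eLpNorm (heatFourier (d := d) ε) 2 ν = ENNReal.ofReal A :=
    (ENNReal.ofReal_toReal hq0.eLpNorm_ne_top).symm
  have hA0 : 0 ≤ A := ENNReal.toReal_nonneg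
  obtain ⟨θ, hθ0, hθ⟩ : ∃ θ : ℝ, 0 < θ ∧ C * (2 * θ) ^ 2 ≤ η := by
    have hcont : Tendsto (fun θ : ℝ => C * (2 * θ) ^ 2) (𝓝[>] 0) (𝓝 0) := by
      have : Continuous fun θ : ℝ => C * (2 * θ) ^ 2 := by fun_prop
      simpa using (this.tendsto 0).mono_left nhdsWithin_le_nhds
    obtain ⟨θ, h1, h2⟩ := ((hcont.eventually_le_const hη).and self_mem_nhdsWithin).exists
    exact ⟨θ, h2, h1⟩
  obtain ⟨N, hN⟩ := exists_nat_gt (t * A / θ)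
  have hN0 : 0 < N := by
    have : (0 : ℝ) < N := lt_of_le_of_lt (by positivity) hN
    exact_mod_cast this
  have hNr : (0 : ℝ) < N := by exact_mod_cast hN0
  have hmesh : t / N * A ≤ θ := by
    rw [div_lt_iff₀ hθ0] at hN
    rw [div_mul_eq_mul_div, div_le_iff₀ hNr]; linarith
  set τ : ℕ → ℝ≥0 := fun j => t * j / N with hτ
  have hτc : ∀ j : ℕ, (τ j : ℝ) = t * j / N := fun j => by simp [hτ]
  have hτlt : ∀ j, τ j < τ (j + 1) := by
    intro j
    rw [← NNReal.coe_lt_coe, hτc, hτc]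
    push_cast
    gcongr
    linarith
  choose ψ hψ hψe using fun j => exists_isStep_eLpNorm_le hH (hτlt j)
    (memLp_greenSlice hd hH hε (t - τ j) x) (greenSlice_neg ε (t - τ j) x)
    (div_pos hθ0 hNr)
  choose e he using hψ
  have hψm : ∀ j, MemLp (ψ j) 2 ν := fun j => by
    obtain ⟨e', he'⟩ := IsStep.eq_hat (hτlt j) ⟨e j, he j⟩
    rw [he']; exact memLp_elem_hat hH e' _
  set D : ℕ → Sp d → ℝ := fun j ξ => ‖greenSlice ε (t - τ j) x ξ - ψ j ξ‖ with hD
  have hDm : ∀ j, MemLp (D j) 2 ν := fun j =>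
    ((memLp_greenSlice hd hH hε (t - τ j) x).sub (hψm j)).norm
  -- A majorant independent of r: the freezing error plus the sum of all slice errors, of which only
  -- one is active at a given time.
  set q : Sp d → ℝ := fun ξ => t / N * heatFourier ε ξ + ∑ j ∈ Finset.range N, D j ξ with hq
  have hqm : MemLp q 2 ν := (hq0.const_mul _).add (memLp_finsetSum _ fun j _ => hDm j)
  have hqn : eLpNorm q 2 ν ≤ ENNReal.ofReal (2 * θ) := by
    have h1 : eLpNorm (fun ξ : Sp d => t / N * heatFourier ε ξ) 2 ν ≤ ENNReal.ofReal θ := by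
      have : (fun ξ : Sp d => (t : ℝ) / N * heatFourier ε ξ)
          = ((t : ℝ) / N) • heatFourier (d := d) ε := by
        ext ξ; rfl
      rw [this, eLpNorm_const_smul, hA', Real.enorm_of_nonneg (by positivity),
        ← ENNReal.ofReal_mul (by positivity)]
      exact ENNReal.ofReal_le_ofReal hmesh
    have h2 : eLpNorm (fun ξ => ∑ j ∈ Finset.range N, D j ξ) 2 ν ≤ ENNReal.ofReal θ := by
      have : (fun ξ => ∑ j ∈ Finset.range N, D j ξ) = ∑ j ∈ Finset.range N, D j := by
        ext ξ; simp
      rw [this]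
      refine (eLpNorm_sum_le (fun j _ => (hDm j).1) (by norm_num)).trans ?_
      calc ∑ j ∈ Finset.range N, eLpNorm (D j) 2 ν
          ≤ ∑ j ∈ Finset.range N, ENNReal.ofReal (θ / N) :=
            Finset.sum_le_sum fun j _ => by
              rw [hD]
              refine le_trans (le_of_eq ?_) (hψe j)
              exact eLpNorm_norm fun ξ => greenSlice ε (t - τ j) x ξ - ψ j ξ
        _ = ENNReal.ofReal θ := by
            rw [Finset.sum_const, Finset.card_range, nsmul_eq_mul, ← ENNReal.ofReal_natCast,
              ← ENNReal.ofReal_mul hNr.le]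
            congr 1
            field_simp
    refine (eLpNorm_add_le (hq0.const_mul _).1 (memLp_finsetSum _ fun j _ => hDm j).1
      (by norm_num)).trans ?_
    rw [two_mul, ENNReal.ofReal_add hθ0.le hθ0.le]
    exact add_le_add h1 h2
  have hqint : ∫ ξ, q ξ ^ 2 ∂ν ≤ (2 * θ) ^ 2 := by
    have h := eLpNorm_two_sq hqm
    have h3 : ENNReal.ofReal (∫ ξ, q ξ ^ 2 ∂ν) ≤ ENNReal.ofReal ((2 * θ) ^ 2) := by
      rw [← h, ENNReal.ofReal_pow (by positivity)]
      gcongr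
    exact (ENNReal.ofReal_le_ofReal_iff (by positivity)).1 h3
  set E : Elem d := ∑ j ∈ Finset.range N, e j with hE
  have hbound : ∀ r, 0 < r → ∀ ξ, ‖E.hat r ξ - mollifiedKernel ε t x r ξ‖
      ≤ (Set.Ioc (0 : ℝ) t).indicator (1 : ℝ → ℝ) r * q ξ := by
    intro r hr ξ
    set I : ℕ → ℝ := fun j => (Set.Ioc (t * j / N : ℝ) (t * (j + 1 : ℕ) / N)).indicator
      (1 : ℝ → ℝ) r with hI
    have hIsum : ∑ j ∈ Finset.range N, I j = (Set.Ioc (0 : ℝ) t).indicator (1 : ℝ → ℝ) r :=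
      sum_indicator_partition t ht'.le hN0 r
    have hI0 : ∀ j, 0 ≤ I j := fun j => Set.indicator_nonneg (fun _ _ => zero_le_one) _
    have hker : mollifiedKernel ε t x r ξ
        = ∑ j ∈ Finset.range N, (I j : ℂ) * greenSlice ε (t - r) x ξ := by
      rw [← Finset.sum_mul, ← Complex.ofReal_sum, hIsum, mollifiedKernel_eq hε]
      by_cases hrt : r ≤ t
      · rw [if_pos ⟨hr.le, hrt⟩, Set.indicator_of_mem (show r ∈ Set.Ioc (0 : ℝ) t from ⟨hr, hrt⟩)]
        simp
      · rw [if_neg fun h => hrt h.2,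
          Set.indicator_of_notMem (show r ∉ Set.Ioc (0 : ℝ) t from fun h => hrt h.2)]
        simp
    have hhat : E.hat r ξ = ∑ j ∈ Finset.range N, (I j : ℂ) * ψ j ξ := by
      rw [hE, elem_hat_sum]
      refine Finset.sum_congr rfl fun j _ => ?_
      rw [he, hτc, hτc]
    rw [hker, hhat, ← Finset.sum_sub_distrib, ← hIsum, Finset.sum_mul]
    refine (norm_sum_le _ _).trans (Finset.sum_le_sum fun j hj => ?_)
    rw [← mul_sub, norm_mul, Complex.norm_real, Real.norm_of_nonneg (hI0 j)]
    by_cases hrj : r ∈ Set.Ioc (t * j / N : ℝ) (t * (j + 1 : ℕ) / N)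
    · refine mul_le_mul_of_nonneg_left ?_ (hI0 j)
      have h1 : ‖ψ j ξ - greenSlice ε (t - τ j) x ξ‖ ≤ ∑ j ∈ Finset.range N, D j ξ := by
        rw [norm_sub_rev]
        exact Finset.single_le_sum (f := fun j => D j ξ) (fun i _ => norm_nonneg _) hj
      have h2 : ‖greenSlice ε (t - τ j) x ξ - greenSlice ε (t - r) x ξ‖
          ≤ t / N * heatFourier ε ξ := by
        refine (norm_greenSlice_sub_le _ _ _ _ _).trans ?_
        refine mul_le_mul_of_nonneg_right ?_ (heatFourier_pos ε ξ).le
        rw [hτc, show (t : ℝ) - t * j / N - (t - r) = r - t * j / N by ring, abs_of_pos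
          (by linarith [hrj.1])]
        have := hrj.2
        push_cast at this
        have e : (t : ℝ) * (j + 1) / N = t * j / N + t / N := by ring
        linarith
      calc _ = ‖(ψ j ξ - greenSlice ε (t - τ j) x ξ)
            + (greenSlice ε (t - τ j) x ξ - greenSlice ε (t - r) x ξ)‖ := by congr 1; ring
        _ ≤ _ := norm_add_le _ _
        _ ≤ _ := by rw [hq]; linarith
    · have : I j = 0 := Set.indicator_of_notMem hrj _
      rw [this]; simp
  obtain ⟨hf1, hf2⟩ := finiteEnergy_of_le hH₀ (measurable_uncurry_sub (measurable_elem_hat E)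
    (measurable_mollifiedKernel hε t x)) ht'.le hqm hbound
  refine ⟨E, hf1, hf2.trans (le_trans ?_ hθ)⟩
  exact mul_le_mul_of_nonneg_left hqint hC

theorem exists_isMollifiedSolution {Ω : Type*} [MeasurableSpace Ω] {P : Measure Ω}
    [IsProbabilityMeasure P] {W : ℝ≥0 → Sp d → Ω → ℝ} (hW : IsFractionalField P H₀ H W)
    (hd : 1 ≤ d) (hH₀ : 1 / 2 ≤ H₀) (hH₀' : H₀ ≤ 1) (hH : ∀ i, 0 < H i ∧ H i < 1) :
    ∃ u, IsMollifiedSolution P H₀ H W u := by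
  have h : ∀ (ε : ℝ) (t : ℝ≥0) (x : Sp d), ∃ X, 0 < ε →
      IsWienerIntegral P H₀ H W (mollifiedKernel ε t x) X := by
    intro ε t x
    by_cases hε : 0 < ε
    · obtain ⟨X, hX⟩ := exists_isWienerIntegral hW hH₀ hH₀' hH (measurable_mollifiedKernel hε t x)
        fun η hη => exists_elem_energy_le hd hH₀ hH hε t x hη
      exact ⟨X, fun _ => hX⟩
    -- Nothing is required of the solution for ε ≤ 0, so 0 serves as a filler.
    · exact ⟨0, fun h => absurd h hε⟩
  choose u hu using h
  exact ⟨u, fun ε hε t x => hu ε t x hε⟩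

end Mollified


/-! ### Solvability in terms of the temporal energy of the wave propagator -/

section Propagator

variable {d : ℕ} {H : Fin d → ℝ} {H₀ : ℝ}

/-- The wave propagator `1_{[0,t]}(r) sin((t-r)ρ)/ρ` at frequency `ρ`. -/
noncomputable def propagator (t ρ r : ℝ) : ℝ :=
  (Set.Icc 0 t).indicator (fun r => Real.sin ((t - r) * ρ) / ρ) r

/-- The squared norm of the wave propagator at frequency `ρ` for the temporal covariance. -/
noncomputable def temporalEnergy (H₀ t ρ : ℝ) : ℝ :=
  ∫ p, propagator t ρ p.1 * propagator t ρ p.2 ∂temporalMeasure H₀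

lemma measurable_propagator (t : ℝ) : Measurable fun z : ℝ × ℝ => propagator t z.1 z.2 := by
  have : (fun z : ℝ × ℝ => propagator t z.1 z.2) = {z : ℝ × ℝ | z.2 ∈ Set.Icc 0 t}.indicator
      fun z => Real.sin ((t - z.2) * z.1) / z.1 := by
    ext z; simp [propagator, Set.indicator]
  rw [this]
  exact Measurable.indicator (by fun_prop) (measurable_snd measurableSet_Icc)

lemma measurable_propagator_right (t ρ : ℝ) : Measurable (propagator t ρ) := by
  unfold propagator
  exact Measurable.indicator (by fun_prop) measurableSet_Icc

lemma abs_propagator_le {t ρ r : ℝ} (hr : 0 < r) (hρ : 0 ≤ ρ) :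
    |propagator t ρ r| ≤ t * (Set.Ioc 0 t).indicator (1 : ℝ → ℝ) r := by
  by_cases h : r ≤ t
  · rw [Set.indicator_of_mem (show r ∈ Set.Ioc 0 t from ⟨hr, h⟩), propagator,
      Set.indicator_of_mem (show r ∈ Set.Icc 0 t from ⟨hr.le, h⟩)]
    have := abs_sin_mul_div_sub_le (t - r) 0 hρ
    simp only [zero_mul, Real.sin_zero, zero_div, sub_zero] at this
    rw [abs_of_nonneg (sub_nonneg.2 h)] at this
    simp only [Pi.one_apply]
    linarith
  · rw [Set.indicator_of_notMem (fun h' => h h'.2), propagator,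
      Set.indicator_of_notMem (fun h' => h h'.2)]
    simp

lemma measurable_temporalEnergy (H₀ t : ℝ) : Measurable (temporalEnergy H₀ t) := by
  have h : Measurable fun z : ℝ × (ℝ × ℝ) => propagator t z.1 z.2.1 * propagator t z.1 z.2.2 :=
    ((measurable_propagator t).comp (f := fun z : ℝ × (ℝ × ℝ) => (z.1, z.2.1)) (by fun_prop)).mul
    ((measurable_propagator t).comp (f := fun z : ℝ × (ℝ × ℝ) => (z.1, z.2.2)) (by fun_prop))
  exact (h.stronglyMeasurable.integral_prod_right (ν := temporalMeasure H₀)).measurable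

lemma norm_propagator_mul_le (H₀ t : ℝ) {ρ : ℝ} (hρ : 0 ≤ ρ) : ∀ᵐ p ∂temporalMeasure H₀,
    ‖propagator t ρ p.1 * propagator t ρ p.2‖ ≤ t ^ 2 *
      ((Set.Ioc 0 t).indicator (1 : ℝ → ℝ) p.1 * (Set.Ioc 0 t).indicator (1 : ℝ → ℝ) p.2) := by
  filter_upwards [ae_pos_temporalMeasure H₀] with p hp
  rw [norm_mul]
  have h1 := abs_propagator_le (t := t) hp.1 hρ
  have h2 := abs_propagator_le (t := t) hp.2 hρ
  calc _ ≤ _ := mul_le_mul h1 h2 (abs_nonneg _) ((abs_nonneg _).trans h1)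
    _ = _ := by ring

lemma integrable_propagator_mul (hH₀ : 1 / 2 ≤ H₀) {t ρ : ℝ} (ht : 0 ≤ t) (hρ : 0 ≤ ρ) :
    Integrable (fun p : ℝ × ℝ => propagator t ρ p.1 * propagator t ρ p.2) (temporalMeasure H₀) := by
  obtain ⟨h1, -⟩ := integral_indicator_temporalMeasure hH₀ le_rfl ht le_rfl ht
  have hm := measurable_propagator_right t ρ
  exact (h1.const_mul (t ^ 2)).mono' ((hm.comp measurable_fst).mul
    (hm.comp measurable_snd)).aestronglyMeasurable (norm_propagator_mul_le H₀ t hρ)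

/-- The bound is uniform in ρ: it settles low frequencies and integrability against a Gaussian. -/
lemma temporalEnergy_le (hH₀ : 1 / 2 ≤ H₀) {t ρ : ℝ} (ht : 0 ≤ t) (hρ : 0 ≤ ρ) :
    temporalEnergy H₀ t ρ ≤ t ^ 2 * incCov H₀ 0 t 0 t := by
  obtain ⟨h1, h2⟩ := integral_indicator_temporalMeasure hH₀ le_rfl ht le_rfl ht
  have hi := integrable_propagator_mul hH₀ ht hρ
  rw [← h2, ← integral_const_mul]
  refine integral_mono_ae hi (h1.const_mul _) ?_
  filter_upwards [norm_propagator_mul_le H₀ t hρ] with p hp using (le_abs_self _).trans hp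

lemma selfTensor_propagator (t ρ : ℝ) : selfTensor (fun r => (propagator t ρ r : ℂ))
    = fun p => ((propagator t ρ p.1 * propagator t ρ p.2 : ℝ) : ℂ) := by
  ext p; simp [selfTensor]

/-- The temporal energy when the temporal covariance is a mixture of product measures. -/
lemma temporalEnergy_mixture {Λ : Type*} [MeasurableSpace Λ] {m : Measure Λ} {κ : Kernel Λ ℝ}
    [SFinite m] [IsSFiniteKernel κ] (h : temporalMeasure H₀ = mixture m κ) (hH₀ : 1 / 2 ≤ H₀)
    {t ρ : ℝ} (ht : 0 ≤ t) (hρ : 0 ≤ ρ) : temporalEnergy H₀ t ρ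
      = ∫ l, ‖mixtureMap κ (fun r => (propagator t ρ r : ℂ)) l‖ ^ 2 ∂m := by
  have hi := (integrable_propagator_mul hH₀ ht hρ).ofReal (𝕜 := ℂ)
  have hi' : Integrable (selfTensor fun r => (propagator t ρ r : ℂ)) (mixture m κ) := by
    rw [selfTensor_propagator, ← h]; exact hi
  have := integral_selfTensor_mixture hi'
  rw [selfTensor_propagator, ← h] at this
  rw [integral_complex_ofReal] at this
  exact_mod_cast this

lemma temporalEnergy_nonneg (hH₀ : 1 / 2 ≤ H₀) (hH₀' : H₀ ≤ 1) {t ρ : ℝ} (ht : 0 ≤ t)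
    (hρ : 0 ≤ ρ) : 0 ≤ temporalEnergy H₀ t ρ := by
  obtain ⟨Λ, _, m, κ, _, _, h⟩ := isMixture_temporalMeasure hH₀ hH₀'
  rw [temporalEnergy_mixture h hH₀ ht hρ]
  positivity

/-- The phase e^{-iξ·x} cancels against its conjugate, so the point x plays no role in the energy.
-/
lemma energyDensity_propagator {g : ℝ → Sp d → ℂ} {t : ℝ} {x : Sp d} {m : Sp d → ℝ}
    (hg : ∀ r ξ, g r ξ = Complex.exp (-(Complex.I * (inner ℝ ξ x : ℝ))) *
      ((propagator t ‖ξ‖ r * m ξ : ℝ) : ℂ)) (p : (ℝ × ℝ) × Sp d) :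
    energyDensity g p
      = ((propagator t ‖p.2‖ p.1.1 * propagator t ‖p.2‖ p.1.2 * m p.2 ^ 2 : ℝ) : ℂ) := by
  rw [energyDensity, hg, hg, map_mul, Complex.conj_ofReal]
  have h := Complex.mul_conj (Complex.exp (-(Complex.I * (inner ℝ p.2 x : ℝ))))
  rw [Complex.normSq_eq_norm_sq, norm_exp_neg_I_mul] at h
  calc _ = (Complex.exp (-(Complex.I * (inner ℝ p.2 x : ℝ))) *
        conj (Complex.exp (-(Complex.I * (inner ℝ p.2 x : ℝ))))) *
        (((propagator t ‖p.2‖ p.1.1 * m p.2 : ℝ) : ℂ) *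
          ((propagator t ‖p.2‖ p.1.2 * m p.2 : ℝ) : ℂ)) := by ring
    _ = _ := by rw [h]; push_cast; ring

lemma ofReal_energy_propagator (hH₀ : 1 / 2 ≤ H₀) (hH₀' : H₀ ≤ 1) {g : ℝ → Sp d → ℂ} {t : ℝ}
    (ht : 0 ≤ t) {x : Sp d} {m : Sp d → ℝ}
    (hg : ∀ r ξ, g r ξ = Complex.exp (-(Complex.I * (inner ℝ ξ x : ℝ))) *
      ((propagator t ‖ξ‖ r * m ξ : ℝ) : ℂ)) (hfin : FiniteEnergy H₀ H g) :
    ENNReal.ofReal (energy H₀ H g)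
      = ∫⁻ ξ, ENNReal.ofReal (m ξ ^ 2 * temporalEnergy H₀ t ‖ξ‖) ∂spectralMeasure H := by
  set F : (ℝ × ℝ) × Sp d → ℝ := fun p =>
    propagator t ‖p.2‖ p.1.1 * propagator t ‖p.2‖ p.1.2 * m p.2 ^ 2 with hF
  have hE : energyDensity g = fun p => ((F p : ℝ) : ℂ) := by
    ext p; exact energyDensity_propagator hg p
  have hi : Integrable F ((temporalMeasure H₀).prod (spectralMeasure H)) := by
    rw [FiniteEnergy, hE] at hfin
    simpa using hfin.re
  have hN : ∀ ξ, ∫ q, F (q, ξ) ∂temporalMeasure H₀ = m ξ ^ 2 * temporalEnergy H₀ t ‖ξ‖ := by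
    intro ξ
    rw [hF, temporalEnergy, mul_comm, ← integral_mul_const]
  have hi2 : Integrable (fun ξ => m ξ ^ 2 * temporalEnergy H₀ t ‖ξ‖) (spectralMeasure H) := by
    have := hi.integral_prod_right
    simpa only [hN] using this
  rw [energy, hE, integral_complex_ofReal, Complex.ofReal_re, integral_prod_symm F hi]
  simp_rw [hN]
  exact ofReal_integral_eq_lintegral_ofReal hi2 (Eventually.of_forall fun ξ =>
    mul_nonneg (sq_nonneg _) (temporalEnergy_nonneg hH₀ hH₀' ht (norm_nonneg ξ)))

lemma mollifiedKernel_eq_propagator {ε : ℝ} (hε : 0 < ε) (t : ℝ) (x : Sp d) (r : ℝ) (ξ : Sp d) :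
    mollifiedKernel ε t x r ξ = Complex.exp (-(Complex.I * (inner ℝ ξ x : ℝ))) *
      ((propagator t ‖ξ‖ r * heatFourier ε ξ : ℝ) : ℂ) := by
  rw [mollifiedKernel_eq hε, propagator, Set.indicator]
  split_ifs <;> simp [greenSlice, greenFourier, mul_assoc]

lemma mollifiedKernel_sub_eq_propagator {ε δ : ℝ} (hε : 0 < ε) (hδ : 0 < δ) (t : ℝ) (x : Sp d)
    (r : ℝ) (ξ : Sp d) : mollifiedKernel ε t x r ξ - mollifiedKernel δ t x r ξ
      = Complex.exp (-(Complex.I * (inner ℝ ξ x : ℝ))) *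
      ((propagator t ‖ξ‖ r * (heatFourier ε ξ - heatFourier δ ξ) : ℝ) : ℂ) := by
  rw [mollifiedKernel_eq_propagator hε, mollifiedKernel_eq_propagator hδ]
  push_cast; ring

theorem eLpNorm_mollified_sub_sq {Ω : Type*} [MeasurableSpace Ω] {P : Measure Ω}
    [IsProbabilityMeasure P] {W : ℝ≥0 → Sp d → Ω → ℝ} (hW : IsFractionalField P H₀ H W)
    (hH₀ : 1 / 2 ≤ H₀) (hH₀' : H₀ ≤ 1) (hH : ∀ i, 0 < H i ∧ H i < 1)
    {u : ℝ → ℝ≥0 → Sp d → Ω → ℝ} (hu : IsMollifiedSolution P H₀ H W u) {ε δ : ℝ} (hε : 0 < ε)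
    (hδ : 0 < δ) (t : ℝ≥0) (x : Sp d) :
    eLpNorm (fun ω => u ε t x ω - u δ t x ω) 2 P ^ 2 = ∫⁻ ξ, ENNReal.ofReal
      ((heatFourier ε ξ - heatFourier δ ξ) ^ 2 * temporalEnergy H₀ t ‖ξ‖) ∂spectralMeasure H := by
  obtain ⟨h1, h2⟩ := eLpNorm_wiener_sub_sq hW hH₀ hH₀' hH (measurable_mollifiedKernel hε t x)
    (measurable_mollifiedKernel hδ t x) (hu ε hε t x) (hu δ hδ t x)
  rw [h2]
  exact ofReal_energy_propagator hH₀ hH₀' t.2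
    (fun r ξ => mollifiedKernel_sub_eq_propagator hε hδ t x r ξ) h1

lemma heatFourier_le_one {ε : ℝ} (hε : 0 ≤ ε) (ξ : Sp d) : heatFourier ε ξ ≤ 1 := by
  rw [heatFourier, Real.exp_le_one_iff]
  nlinarith [sq_nonneg ‖ξ‖]

lemma tendsto_heatFourier (ξ : Sp d) : Tendsto (fun ε => heatFourier ε ξ) (𝓝[>] 0) (𝓝 1) := by
  have h : Continuous fun ε : ℝ => heatFourier ε ξ := by unfold heatFourier; fun_prop
  have := (h.tendsto 0).mono_left (nhdsWithin_le_nhds (s := Set.Ioi 0))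
  simpa [heatFourier] using this

lemma measurable_temporalEnergy_norm (H₀ t : ℝ) :
    Measurable fun ξ : Sp d => temporalEnergy H₀ t ‖ξ‖ :=
  (measurable_temporalEnergy H₀ t).comp measurable_norm

/-- If the integral is finite, it dominates the squared differences. Conversely, fix δ so that the
differences stay bounded by 1 as ε → 0 and apply Fatou: this controls the part weighted by (1 -
e^{-δ|ξ|²/2})². The complementary part carries a Gaussian weight and is always finite. -/
theorem solvable_iff_lintegral {Ω : Type*} [MeasurableSpace Ω] {P : Measure Ω}
    [IsProbabilityMeasure P] {W : ℝ≥0 → Sp d → Ω → ℝ} (hW : IsFractionalField P H₀ H W)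
    (hd : 1 ≤ d) (hH₀ : 1 / 2 ≤ H₀) (hH₀' : H₀ ≤ 1) (hH : ∀ i, 0 < H i ∧ H i < 1) :
    Solvable P H₀ H W ↔ ∀ t : ℝ≥0,
      ∫⁻ ξ, ENNReal.ofReal (temporalEnergy H₀ t ‖ξ‖) ∂spectralMeasure H < ⊤ := by
  have hN := fun t => measurable_temporalEnergy_norm (d := d) H₀ t
  have hN0 : ∀ (t : ℝ≥0) (ξ : Sp d), 0 ≤ temporalEnergy H₀ t ‖ξ‖ := fun t ξ =>
    temporalEnergy_nonneg hH₀ hH₀' t.2 (norm_nonneg ξ)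
  have hm := fun ε => measurable_heatFourier (d := d) ε
  constructor
  · rintro ⟨u, hu, hc⟩ t
    have hlim := hc t 0
    have hev := hlim.eventually (gt_mem_nhds (show (0 : ℝ≥0∞) < 1 by norm_num))
    rw [eventually_prod_iff] at hev
    obtain ⟨pa, ha, pb, hb, hab⟩ := hev
    obtain ⟨δ, hδb, hδ⟩ := (hb.and self_mem_nhdsWithin).exists
    have hδ0 : (0 : ℝ) < δ := hδ
    obtain ⟨ε, hε0, hεlim⟩ : ∃ ε : ℕ → ℝ, (∀ n, 0 < ε n ∧ pa (ε n)) ∧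
        Tendsto ε atTop (𝓝[>] 0) := by
      have hfreq : ∃ᶠ ε : ℝ in 𝓝[>] 0, 0 < ε ∧ pa ε :=
        ((show ∀ᶠ ε : ℝ in 𝓝[>] 0, 0 < ε from self_mem_nhdsWithin).and ha).frequently
      obtain ⟨ε, h1, h2⟩ := exists_seq_forall_of_frequently hfreq
      exact ⟨ε, h2, h1⟩
    have hle : ∀ n, ∫⁻ ξ, ENNReal.ofReal ((heatFourier (ε n) ξ - heatFourier δ ξ) ^ 2 *
        temporalEnergy H₀ t ‖ξ‖) ∂spectralMeasure H ≤ 1 := by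
      intro n
      rw [← eLpNorm_mollified_sub_sq hW hH₀ hH₀' hH hu (hε0 n).1 hδ0 t 0]
      exact pow_le_one₀ zero_le (hab (hε0 n).2 hδb).le
    have hfatou : ∫⁻ ξ, ENNReal.ofReal ((1 - heatFourier δ ξ) ^ 2 *
        temporalEnergy H₀ t ‖ξ‖) ∂spectralMeasure H ≤ 1 := by
      have hmeas : ∀ n, Measurable fun ξ : Sp d => ENNReal.ofReal
          ((heatFourier (ε n) ξ - heatFourier δ ξ) ^ 2 * temporalEnergy H₀ t ‖ξ‖) := fun n =>
        ((((hm (ε n)).sub (hm δ)).pow_const 2).mul (hN t)).ennreal_ofReal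
      refine le_trans (le_of_eq ?_) ((lintegral_liminf_le (u := atTop) (μ := spectralMeasure H) hmeas).trans
        (liminf_le_of_le (by isBoundedDefault) fun b hb => ?_))
      · refine lintegral_congr fun ξ => (Tendsto.liminf_eq ?_).symm
        refine ENNReal.tendsto_ofReal ?_
        exact ((((tendsto_heatFourier ξ).comp hεlim).sub_const _).pow 2).mul_const _
      · obtain ⟨n, hn⟩ := hb.exists
        exact hn.trans (hle n)
    have hgauss : ∫⁻ ξ, ENNReal.ofReal (heatFourier δ ξ ^ 2 *
        temporalEnergy H₀ t ‖ξ‖) ∂spectralMeasure H < ⊤ := by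
      have hi := (memLp_heatFourier hd hH hδ0).integrable_sq.mul_const
        ((t : ℝ) ^ 2 * incCov H₀ 0 t 0 t)
      refine lt_of_le_of_lt (lintegral_mono fun ξ => ENNReal.ofReal_le_ofReal ?_)
        hi.lintegral_lt_top
      exact mul_le_mul_of_nonneg_left (temporalEnergy_le hH₀ t.2 (norm_nonneg ξ)) (sq_nonneg _)
    calc ∫⁻ ξ, ENNReal.ofReal (temporalEnergy H₀ t ‖ξ‖) ∂spectralMeasure H
        ≤ ∫⁻ ξ, (2 * ENNReal.ofReal ((1 - heatFourier δ ξ) ^ 2 * temporalEnergy H₀ t ‖ξ‖) +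
            2 * ENNReal.ofReal (heatFourier δ ξ ^ 2 * temporalEnergy H₀ t ‖ξ‖))
            ∂spectralMeasure H := by
          refine lintegral_mono fun ξ => ?_
          have h0 := hN0 t ξ
          have e2 : (2 : ℝ≥0∞) = ENNReal.ofReal 2 := by simp
          simp only [e2]
          rw [← ENNReal.ofReal_mul (by norm_num), ← ENNReal.ofReal_mul (by norm_num), ← ENNReal.ofReal_add (by positivity)
            (by positivity)]
          refine ENNReal.ofReal_le_ofReal ?_
          -- The two weights together dominate 1, because 2(1-y)² + 2y² - 1 = (1-2y)².
          have : 1 ≤ 2 * (1 - heatFourier δ ξ) ^ 2 + 2 * heatFourier δ ξ ^ 2 := by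
            nlinarith [sq_nonneg (1 - 2 * heatFourier δ ξ)]
          nlinarith
      _ = 2 * ∫⁻ ξ, ENNReal.ofReal ((1 - heatFourier δ ξ) ^ 2 * temporalEnergy H₀ t ‖ξ‖)
            ∂spectralMeasure H +
          2 * ∫⁻ ξ, ENNReal.ofReal (heatFourier δ ξ ^ 2 * temporalEnergy H₀ t ‖ξ‖)
            ∂spectralMeasure H := by
          have h1 : Measurable fun ξ : Sp d => ENNReal.ofReal
              ((1 - heatFourier δ ξ) ^ 2 * temporalEnergy H₀ t ‖ξ‖) :=
            (((measurable_const.sub (hm δ)).pow_const 2).mul (hN t)).ennreal_ofReal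
          have h2 : Measurable fun ξ : Sp d => ENNReal.ofReal
              (heatFourier δ ξ ^ 2 * temporalEnergy H₀ t ‖ξ‖) :=
            (((hm δ).pow_const 2).mul (hN t)).ennreal_ofReal
          rw [lintegral_add_left (h1.const_mul 2), lintegral_const_mul _ h1,
            lintegral_const_mul _ h2]
      _ < ⊤ := ENNReal.add_lt_top.2 ⟨ENNReal.mul_lt_top (by norm_num)
          (hfatou.trans_lt (by norm_num)), ENNReal.mul_lt_top (by norm_num) hgauss⟩
  · intro hfin
    obtain ⟨u, hu⟩ := exists_isMollifiedSolution hW hd hH₀ hH₀' hH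
    refine ⟨u, hu, fun t x => ?_⟩
    have hpos : ∀ᶠ p : ℝ × ℝ in 𝓝[>] 0 ×ˢ 𝓝[>] 0, 0 < p.1 ∧ 0 < p.2 :=
      (show ∀ᶠ ε : ℝ in 𝓝[>] 0, 0 < ε from self_mem_nhdsWithin).prod_mk
        (show ∀ᶠ ε : ℝ in 𝓝[>] 0, 0 < ε from self_mem_nhdsWithin)
    have hdom : Tendsto (fun p : ℝ × ℝ => ∫⁻ ξ, ENNReal.ofReal
        ((heatFourier p.1 ξ - heatFourier p.2 ξ) ^ 2 * temporalEnergy H₀ t ‖ξ‖)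
        ∂spectralMeasure H) (𝓝[>] 0 ×ˢ 𝓝[>] 0) (𝓝 (∫⁻ _, 0 ∂spectralMeasure H)) := by
      refine tendsto_lintegral_filter_of_dominated_convergence
        (fun ξ => ENNReal.ofReal (temporalEnergy H₀ t ‖ξ‖)) (Eventually.of_forall fun p => ?_)
        (hpos.mono fun p hp => Eventually.of_forall fun ξ => ENNReal.ofReal_le_ofReal ?_)
        (hfin t).ne (Eventually.of_forall fun ξ => ?_)
      · exact ((((hm p.1).sub (hm p.2)).pow_const 2).mul (hN t)).ennreal_ofReal
      · have a1 := heatFourier_pos p.1 ξ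
        have a2 := heatFourier_pos p.2 ξ
        have a3 := heatFourier_le_one hp.1.le ξ
        have a4 := heatFourier_le_one hp.2.le ξ
        have : (heatFourier p.1 ξ - heatFourier p.2 ξ) ^ 2 ≤ 1 := by
          rw [sq_le_one_iff_abs_le_one, abs_le]; constructor <;> linarith
        exact mul_le_of_le_one_left (hN0 t ξ) this
      · have h1 := (tendsto_heatFourier ξ).comp (tendsto_fst (f := 𝓝[>] (0:ℝ)) (g := 𝓝[>] (0:ℝ)))
        have h2 := (tendsto_heatFourier ξ).comp (tendsto_snd (f := 𝓝[>] (0:ℝ)) (g := 𝓝[>] (0:ℝ)))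
        have h3 := ENNReal.tendsto_ofReal
          (((h1.sub h2).pow 2).mul_const (temporalEnergy H₀ t ‖ξ‖))
        simpa using h3
    rw [lintegral_zero] at hdom
    have hsq : Tendsto (fun p : ℝ × ℝ => eLpNorm (fun ω => u p.1 t x ω - u p.2 t x ω) 2 P ^ 2)
        (𝓝[>] 0 ×ˢ 𝓝[>] 0) (𝓝 0) := by
      refine hdom.congr' (hpos.mono fun p hp => ?_)
      exact (eLpNorm_mollified_sub_sq hW hH₀ hH₀' hH hu hp.1 hp.2 t x).symm
    have h := hsq.ennrpow_const (1 / 2)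
    rw [ENNReal.zero_rpow_of_pos (by norm_num)] at h
    refine h.congr fun p => ?_
    rw [← ENNReal.rpow_natCast, ← ENNReal.rpow_mul]
    norm_num

end Propagator


/-! ### Convergence of radial integrals -/

section Radial

variable {d : ℕ} {H : Fin d → ℝ}

lemma radialDensity_nonneg (hd : 1 ≤ d) (hH : ∀ i, 0 < H i ∧ H i < 1) {ρ : ℝ} (hρ : 0 ≤ ρ) :
    0 ≤ radialDensity H ρ := by
  have h1 := ballMass_pos hH
  have h2 := specDim_pos hd hH
  unfold radialDensity; positivity

/-- Near 0 the power ρ^{β-1} is integrable as β > 0; at infinity the integrand is at most of order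
ρ^{β-1-p}, with exponent below -1. -/
lemma lintegral_radialDensity_lt_top (hd : 1 ≤ d) (hH : ∀ i, 0 < H i ∧ H i < 1) {f : ℝ → ℝ}
    {K C p : ℝ} (h1 : ∀ ρ, 0 < ρ → ρ ≤ 1 → f ρ ≤ K) (h2 : ∀ ρ, 1 ≤ ρ → f ρ ≤ C * ρ ^ (-p))
    (hp : specDim H < p) :
    ∫⁻ ρ in Set.Ioi (0 : ℝ), ENNReal.ofReal (radialDensity H ρ) * ENNReal.ofReal (f ρ) < ⊤ := by
  have hβ := specDim_pos hd hH
  have hB := ballMass_pos hH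
  rw [← Set.Ioc_union_Ioi_eq_Ioi (zero_le_one (α := ℝ))]
  refine (lintegral_union_le _ _ _).trans_lt (ENNReal.add_lt_top.2 ⟨?_, ?_⟩)
  · have hi : IntegrableOn (fun ρ => radialDensity H ρ * K) (Set.Ioc 0 1) := by
      have h := intervalIntegral.intervalIntegrable_rpow' (a := 0) (b := 1)
        (by linarith : -1 < specDim H - 1)
      rw [intervalIntegrable_iff_integrableOn_Ioc_of_le zero_le_one] at h
      exact ((h.const_mul (specDim H)).const_mul (ballMass H)).mul_const K
    refine lt_of_le_of_lt (setLIntegral_mono' measurableSet_Ioc fun ρ hρ => ?_) hi.lintegral_lt_top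
    have h0 := radialDensity_nonneg hd hH hρ.1.le
    rw [← ENNReal.ofReal_mul h0]
    exact ENNReal.ofReal_le_ofReal (mul_le_mul_of_nonneg_left (h1 ρ hρ.1 hρ.2) h0)
  · have hi : IntegrableOn (fun ρ => ballMass H * specDim H * C * ρ ^ (specDim H - 1 - p))
        (Set.Ioi 1) := (integrableOn_Ioi_rpow_of_lt (by linarith) one_pos).const_mul _
    refine lt_of_le_of_lt (setLIntegral_mono' measurableSet_Ioi fun ρ hρ => ?_) hi.lintegral_lt_top
    have hρ1 : 1 ≤ ρ := (show (1 : ℝ) < ρ from hρ).le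
    have hρ0 : 0 < ρ := one_pos.trans_le hρ1
    have h0 := radialDensity_nonneg hd hH hρ0.le
    rw [← ENNReal.ofReal_mul h0]
    refine ENNReal.ofReal_le_ofReal ((mul_le_mul_of_nonneg_left (h2 ρ hρ1) h0).trans (le_of_eq ?_))
    rw [sub_eq_add_neg (specDim H - 1), Real.rpow_add hρ0, radialDensity]
    ring

/-- If β ≥ p, then density times ρ^{-p} is at least a multiple of 1/ρ, which is not integrable. The
shift a accommodates an f that has zeros at arbitrarily large ρ, as long as f(ρ) and f(ρ+a) are not
both small. -/
lemma specDim_lt_of_lintegral (hd : 1 ≤ d) (hH : ∀ i, 0 < H i ∧ H i < 1) {f : ℝ → ℝ}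
    (hf : Measurable f) {p c ρ₀ a : ℝ} (hp : 1 ≤ p) (ha : 0 ≤ a) (hc : 0 < c)
    (h : ∀ ρ, ρ₀ ≤ ρ → c * ρ ^ (-p) ≤ f ρ + f (ρ + a))
    (hfin : ∫⁻ ρ in Set.Ioi (0 : ℝ), ENNReal.ofReal (radialDensity H ρ) * ENNReal.ofReal (f ρ) < ⊤) :
    specDim H < p := by
  by_contra! hβp
  have hβ := specDim_pos hd hH
  have hB := ballMass_pos hH
  set g : ℝ → ℝ≥0∞ := fun ρ => ENNReal.ofReal (radialDensity H ρ) * ENNReal.ofReal (f ρ) with hg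
  have hgm : Measurable g := (measurable_radialDensity H).ennreal_ofReal.mul hf.ennreal_ofReal
  set R := max ρ₀ 1
  have hR : (0 : ℝ) ≤ R := zero_le_one.trans (le_max_right _ _)
  have hpt : ∀ ρ ∈ Set.Ioi R, ENNReal.ofReal (c * (ballMass H * specDim H) * ρ⁻¹)
      ≤ g ρ + g (ρ + a) := by
    intro ρ hρ
    have hρR : R ≤ ρ := le_of_lt hρ
    have hρ1 : 1 ≤ ρ := (le_max_right _ _).trans hρR
    have hρ0 : 0 < ρ := one_pos.trans_le hρ1
    have h0 := radialDensity_nonneg hd hH hρ0.le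
    -- Here p ≥ 1 enters: under β ≥ p the exponent β-1 is nonnegative, so the density at ρ is at
    -- most that at ρ+a.
    have hmono : radialDensity H ρ ≤ radialDensity H (ρ + a) := by
      unfold radialDensity
      have : ρ ^ (specDim H - 1) ≤ (ρ + a) ^ (specDim H - 1) :=
        Real.rpow_le_rpow hρ0.le (by linarith) (by linarith)
      gcongr
    have e : c * (ballMass H * specDim H) * ρ⁻¹ ≤ radialDensity H ρ * (c * ρ ^ (-p)) := by
      have : ρ⁻¹ ≤ ρ ^ (specDim H - 1) * ρ ^ (-p) := by
        rw [← Real.rpow_add hρ0, ← Real.rpow_neg_one]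
        exact Real.rpow_le_rpow_of_exponent_le hρ1 (by linarith)
      rw [radialDensity]
      calc _ ≤ c * (ballMass H * specDim H) * (ρ ^ (specDim H - 1) * ρ ^ (-p)) := by gcongr
        _ = _ := by ring
    calc _ ≤ ENNReal.ofReal (radialDensity H ρ * (f ρ + f (ρ + a))) :=
          ENNReal.ofReal_le_ofReal (e.trans (mul_le_mul_of_nonneg_left
            (h ρ ((le_max_left _ _).trans hρR)) h0))
      _ = ENNReal.ofReal (radialDensity H ρ) * ENNReal.ofReal (f ρ + f (ρ + a)) :=
          ENNReal.ofReal_mul h0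
      _ ≤ ENNReal.ofReal (radialDensity H ρ) *
            (ENNReal.ofReal (f ρ) + ENNReal.ofReal (f (ρ + a))) := by
          gcongr; exact ENNReal.ofReal_add_le
      _ ≤ _ := by
          rw [mul_add]
          simp only [hg]
          gcongr
  have hshift : ∫⁻ ρ in Set.Ioi R, g (ρ + a) ≤ ∫⁻ ρ in Set.Ioi (0 : ℝ), g ρ := by
    rw [← lintegral_indicator measurableSet_Ioi, ← lintegral_indicator measurableSet_Ioi,
      ← lintegral_add_right_eq_self ((Set.Ioi (0 : ℝ)).indicator g) a]
    refine lintegral_mono fun ρ => ?_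
    by_cases hρ : ρ ∈ Set.Ioi R
    · have : ρ + a ∈ Set.Ioi (0 : ℝ) := by
        have : R < ρ := hρ
        show 0 < ρ + a
        linarith
      rw [Set.indicator_of_mem hρ, Set.indicator_of_mem this]
    · rw [Set.indicator_of_notMem hρ]; exact zero_le
  have hlt : ∫⁻ ρ in Set.Ioi R, ENNReal.ofReal (c * (ballMass H * specDim H) * ρ⁻¹) < ⊤ := by
    refine (setLIntegral_mono' measurableSet_Ioi hpt).trans_lt ?_
    rw [lintegral_add_left hgm]
    refine ENNReal.add_lt_top.2 ⟨(lintegral_mono_set ?_).trans_lt hfin, hshift.trans_lt hfin⟩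
    exact Set.Ioi_subset_Ioi hR
  refine not_integrableOn_Ioi_inv (a := R) ?_
  have hi : IntegrableOn (fun ρ : ℝ => c * (ballMass H * specDim H) * ρ⁻¹) (Set.Ioi R) := by
    refine ⟨Measurable.aestronglyMeasurable (by fun_prop), ?_⟩
    rw [hasFiniteIntegral_iff_ofReal]
    · exact hlt
    · filter_upwards [ae_restrict_mem measurableSet_Ioi] with ρ hρ
      have : 0 ≤ ρ := hR.trans (le_of_lt hρ)
      have h3 : 0 ≤ ρ⁻¹ := inv_nonneg.2 this
      show 0 ≤ c * (ballMass H * specDim H) * ρ⁻¹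
      positivity
  have hk : c * (ballMass H * specDim H) ≠ 0 := by positivity
  have := hi.const_mul (c * (ballMass H * specDim H))⁻¹
  refine this.congr (Eventually.of_forall fun ρ => ?_)
  field_simp

end Radial

/-! ### Size of the temporal energy at high frequency -/

section HighFrequency

lemma setIntegral_propagator {t ρ a b : ℝ} (hρ : ρ ≠ 0) (hab : a ≤ b) {S : Set ℝ}
    (hS : S ∩ Set.Icc 0 t = Set.Ioc a b) : ∫ r in S, propagator t ρ r
      = (Real.cos (t * ρ - ρ * b) - Real.cos (t * ρ - ρ * a)) / ρ ^ 2 := by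
  simp only [propagator]
  rw [setIntegral_indicator measurableSet_Icc, hS, ← intervalIntegral.integral_of_le hab]
  have : ∀ r, Real.sin ((t - r) * ρ) / ρ = Real.sin (t * ρ - ρ * r) / ρ := by
    intro r; congr 2; ring
  simp_rw [this]
  rw [intervalIntegral.integral_div, intervalIntegral.integral_comp_sub_mul _ hρ, integral_sin]
  simp only [smul_eq_mul]
  field_simp

lemma integral_sin_sub_sq {ρ : ℝ} (hρ : ρ ≠ 0) (c t : ℝ) : ∫ r in (0 : ℝ)..t,
    Real.sin (c - ρ * r) ^ 2 = (Real.sin (c - ρ * t) * Real.cos (c - ρ * t) -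
      Real.sin c * Real.cos c + ρ * t) / (2 * ρ) := by
  rw [intervalIntegral.integral_comp_sub_mul (fun x => Real.sin x ^ 2) hρ, integral_sin_sq]
  simp only [smul_eq_mul, mul_zero, sub_zero]
  field_simp
  ring

lemma abs_sin_mul_cos_le (x : ℝ) : |Real.sin x * Real.cos x| ≤ 1 / 2 := by
  rw [abs_le]
  constructor <;> nlinarith [Real.sin_sq_add_cos_sq x, sq_nonneg (Real.sin x + Real.cos x),
    sq_nonneg (Real.sin x - Real.cos x)]

lemma temporalEnergy_half {t ρ : ℝ} (ht : 0 ≤ t) (hρ : 0 < ρ) : temporalEnergy (1 / 2) t ρ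
    = (ρ * t - Real.sin (t * ρ) * Real.cos (t * ρ)) / (2 * ρ ^ 3) := by
  have hm := measurable_propagator_right t ρ
  have hm2 : Measurable fun p : ℝ × ℝ => propagator t ρ p.1 * propagator t ρ p.2 :=
    (hm.comp measurable_fst).mul (hm.comp measurable_snd)
  rw [temporalEnergy, temporalMeasure_half, integral_map (by fun_prop) hm2.aestronglyMeasurable]
  have e : ∀ r, propagator t ρ r * propagator t ρ r
      = (Set.Icc 0 t).indicator (fun r => Real.sin (t * ρ - ρ * r) ^ 2 / ρ ^ 2) r := by
    intro r
    simp only [propagator, Set.indicator]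
    split_ifs
    · rw [show (t - r) * ρ = t * ρ - ρ * r by ring]; ring
    · ring
  simp_rw [e]
  have hS : Set.Ioi 0 ∩ Set.Icc 0 t = Set.Ioc 0 t := by
    ext r; simp only [Set.mem_inter_iff, Set.mem_Ioi, Set.mem_Icc, Set.mem_Ioc]
    constructor
    · rintro ⟨h1, -, h2⟩; exact ⟨h1, h2⟩
    · rintro ⟨h1, h2⟩; exact ⟨h1, h1.le, h2⟩
  rw [setIntegral_indicator measurableSet_Icc, hS, ← intervalIntegral.integral_of_le ht,
    intervalIntegral.integral_div, integral_sin_sub_sq hρ.ne', show t * ρ - ρ * t = 0 by ring]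
  simp only [Real.sin_zero, zero_mul]
  field_simp
  ring

/-- The covariance is a product measure, so the energy is the square of ∫ sin((t-r)ρ)/ρ dr = (1 -
cos(tρ))/ρ². -/
lemma temporalEnergy_one {t ρ : ℝ} (ht : 0 ≤ t) (hρ : 0 < ρ) : temporalEnergy 1 t ρ
    = (1 - Real.cos (t * ρ)) ^ 2 / ρ ^ 4 := by
  have hS : Set.Ioi 0 ∩ Set.Icc 0 t = Set.Ioc 0 t := by
    ext r; simp only [Set.mem_inter_iff, Set.mem_Ioi, Set.mem_Icc, Set.mem_Ioc]
    constructor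
    · rintro ⟨h1, -, h2⟩; exact ⟨h1, h2⟩
    · rintro ⟨h1, h2⟩; exact ⟨h1, h1.le, h2⟩
  rw [temporalEnergy, temporalMeasure_one, integral_prod_mul, setIntegral_propagator hρ.ne' ht hS]
  rw [show t * ρ - ρ * t = 0 by ring, Real.cos_zero, mul_zero, sub_zero]
  field_simp

lemma windowKernel_apply (v l : ℝ) :
    windowKernel (v, l) = volume.restrict (Set.Ioc v (v + l) ∩ Set.Ioi 0) := by
  rw [windowKernel, Kernel.withDensity_apply _ measurable_window, Kernel.const_apply]
  have : window (v, l) = (Set.Ioc v (v + l)).indicator 1 := by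
    ext r; simp [window, Set.indicator]
  rw [this, withDensity_indicator_one measurableSet_Ioc, Measure.restrict_restrict measurableSet_Ioc]

/-- The integral of the wave propagator over the window `(v, v + l]`. -/
noncomputable def windowValue (t ρ v l : ℝ) : ℝ :=
  (Real.cos (t * ρ - ρ * max (max v 0) (min (v + l) t)) - Real.cos (t * ρ - ρ * max v 0)) / ρ ^ 2

lemma measurable_windowValue (t ρ : ℝ) : Measurable fun q : ℝ × ℝ => windowValue t ρ q.1 q.2 := by
  unfold windowValue; fun_prop

/-- The window meets (0,t] in (max v 0, min (v+l) t]. The outer maximum in `windowValue` collapses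
an empty intersection to equal endpoints, hence to the value 0. -/
lemma mixtureMap_windowKernel {t ρ : ℝ} (hρ : ρ ≠ 0) (v l : ℝ) :
    mixtureMap windowKernel (fun r => (propagator t ρ r : ℂ)) (v, l) = (windowValue t ρ v l : ℂ) := by
  rw [mixtureMap, windowKernel_apply, integral_complex_ofReal,
    setIntegral_propagator hρ (le_max_left (max v 0) (min (v + l) t))]
  · rfl
  · ext r
    simp only [Set.mem_inter_iff, Set.mem_Ioc, Set.mem_Ioi, Set.mem_Icc, max_lt_iff, le_max_iff,
      le_min_iff]
    constructor
    · rintro ⟨⟨⟨h1, h2⟩, h3⟩, h4, h5⟩; exact ⟨⟨h1, h3⟩, Or.inr ⟨h2, h5⟩⟩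
    · rintro ⟨⟨h1, h3⟩, (h | h) | h⟩
      · linarith
      · linarith
      · exact ⟨⟨⟨h1, h.1⟩, h3⟩, h3.le, h.2⟩

lemma ofReal_temporalEnergy {H₀ : ℝ} (h : 1 / 2 < H₀) (h' : H₀ < 1) {t ρ : ℝ} (ht : 0 ≤ t)
    (hρ : 0 < ρ) : ENNReal.ofReal (temporalEnergy H₀ t ρ)
      = ∫⁻ l in Set.Ioi (0 : ℝ), ENNReal.ofReal (windowWeight H₀ l) *
        ∫⁻ v, ENNReal.ofReal (windowValue t ρ v l ^ 2) := by
  have hmix := temporalEnergy_mixture (temporalMeasure_eq_mixture h h') h.le ht hρ.le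
  have hi := (integrable_propagator_mul h.le ht hρ.le).ofReal (𝕜 := ℂ)
  have hi' : Integrable (selfTensor fun r => (propagator t ρ r : ℂ))
      (mixture (windowMeasure H₀) windowKernel) := by
    rw [selfTensor_propagator, ← temporalMeasure_eq_mixture h h']; exact hi
  have hL := (eLpNorm_mixtureMap_lt_top (measurable_propagator_right t ρ).complex_ofReal hi').norm.integrable_sq
  rw [hmix, ofReal_integral_eq_lintegral_ofReal hL (Eventually.of_forall fun _ => sq_nonneg _)]
  have e : ∀ q, ‖mixtureMap windowKernel (fun r => (propagator t ρ r : ℂ)) q‖ ^ 2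
      = windowValue t ρ q.1 q.2 ^ 2 := by
    rintro ⟨v, l⟩
    rw [mixtureMap_windowKernel hρ.ne', Complex.norm_real, Real.norm_eq_abs, sq_abs]
  simp_rw [e]
  have hm : Measurable fun q : ℝ × ℝ => ENNReal.ofReal (windowValue t ρ q.1 q.2 ^ 2) :=
    ((measurable_windowValue t ρ).pow_const 2).ennreal_ofReal
  rw [windowMeasure, lintegral_prod_symm _ hm.aemeasurable,
    lintegral_withDensity_eq_lintegral_mul _ (measurable_windowWeight H₀).ennreal_ofReal
      hm.lintegral_prod_left']
  rfl

/-- This uses only |cos| ≤ 1 and serves for windows longer than 1/ρ; `abs_windowValue_le` uses that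
cos is 1-Lipschitz and serves for shorter ones. -/
lemma abs_windowValue_le_sq (t ρ v l : ℝ) : |windowValue t ρ v l| ≤ 2 / ρ ^ 2 := by
  rw [windowValue, abs_div, abs_of_nonneg (sq_nonneg ρ)]
  gcongr
  refine (abs_sub _ _).trans ?_
  linarith [Real.abs_cos_le_one (t * ρ - ρ * max (max v 0) (min (v + l) t)),
    Real.abs_cos_le_one (t * ρ - ρ * max v 0)]

lemma abs_windowValue_le {t ρ v l : ℝ} (hρ : 0 < ρ) (hl : 0 ≤ l) :
    |windowValue t ρ v l| ≤ l / ρ := by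
  have h1 : max v 0 ≤ max (max v 0) (min (v + l) t) := le_max_left _ _
  have h2 : max (max v 0) (min (v + l) t) ≤ max v 0 + l :=
    max_le (by linarith) ((min_le_left _ _).trans (by gcongr; exact le_max_left _ _))
  rw [windowValue, abs_div, abs_of_nonneg (sq_nonneg ρ), div_le_div_iff₀ (by positivity) hρ]
  have h3 := Real.abs_cos_sub_cos_le (t * ρ - ρ * max (max v 0) (min (v + l) t))
    (t * ρ - ρ * max v 0)
  rw [show t * ρ - ρ * max (max v 0) (min (v + l) t) - (t * ρ - ρ * max v 0)
    = -(ρ * (max (max v 0) (min (v + l) t) - max v 0)) by ring, abs_neg, abs_mul, abs_of_pos hρ,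
    abs_of_nonneg (sub_nonneg.2 h1)] at h3
  have h4 : ρ * (max (max v 0) (min (v + l) t) - max v 0) ≤ ρ * l := by gcongr; linarith
  calc _ ≤ ρ * l * ρ := by gcongr; exact h3.trans h4
    _ = _ := by ring

lemma windowValue_eq_zero {t ρ v l : ℝ} (hv : v ∉ Set.Ioo (-l) t) :
    windowValue t ρ v l = 0 := by
  have : max (max v 0) (min (v + l) t) = max v 0 := by
    refine max_eq_left ?_
    rw [Set.mem_Ioo, not_and_or, not_lt, not_lt] at hv
    rcases hv with hv | hv
    · exact (min_le_left _ _).trans (le_trans (by linarith) (le_max_right _ _))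
    · exact (min_le_right _ _).trans (hv.trans (le_max_left _ _))
  rw [windowValue, this, sub_self, zero_div]

/-- Only windows meeting [0,t] contribute, so v ranges over an interval of length l + t. -/
lemma lintegral_windowValue_le {t ρ l M : ℝ} (hM : 0 ≤ M)
    (h : ∀ v, |windowValue t ρ v l| ≤ M) :
    ∫⁻ v, ENNReal.ofReal (windowValue t ρ v l ^ 2) ≤ ENNReal.ofReal (M ^ 2 * (l + t)) := by
  calc _ ≤ ∫⁻ v, (Set.Ioo (-l) t).indicator (fun _ => ENNReal.ofReal (M ^ 2)) v := by
        refine lintegral_mono fun v => ?_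
        by_cases hv : v ∈ Set.Ioo (-l) t
        · rw [Set.indicator_of_mem hv]
          exact ENNReal.ofReal_le_ofReal (sq_le_sq.2 (by rw [abs_of_nonneg hM]; exact h v))
        · rw [windowValue_eq_zero hv]; simp
    _ = _ := by
        rw [lintegral_indicator_const measurableSet_Ioo, Real.volume_Ioo,
          ENNReal.ofReal_mul (sq_nonneg M)]
        congr 2; ring

/-- The constant in the weight of windows. -/
noncomputable def windowConst (H₀ : ℝ) : ℝ := H₀ * (2 * H₀ - 1) * ((2 - 2 * H₀) * (3 - 2 * H₀))

lemma windowConst_pos {H₀ : ℝ} (h : 1 / 2 < H₀) (h' : H₀ < 1) : 0 < windowConst H₀ :=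
  mul_pos (mul_pos (by linarith) (by linarith)) (mul_pos (by linarith) (by linarith))

/-- Split the windows at l = 1/ρ. Short ones contribute ρ^{-2} ∫ l^{2H₀-2} dl over l ≤ 1/ρ,
convergent since H₀ > 1/2; long ones ρ^{-3} ∫ l^{2H₀-3} dl over l > 1/ρ, convergent since H₀ < 1.
Both are of order ρ^{-1-2H₀}. -/
lemma temporalEnergy_le_rpow {H₀ : ℝ} (h : 1 / 2 < H₀) (h' : H₀ < 1) {t : ℝ} (ht : 0 ≤ t) :
    ∃ C, ∀ ρ, 1 ≤ ρ → temporalEnergy H₀ t ρ ≤ C * ρ ^ (-(1 + 2 * H₀)) := by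
  have hw := windowConst_pos h h'
  set w := windowConst H₀ with hwdef
  refine ⟨w * (1 + t) / (2 * H₀ - 1) + 4 * w * (1 + t) / (2 - 2 * H₀), fun ρ hρ => ?_⟩
  have hρ0 : 0 < ρ := one_pos.trans_le hρ
  have hρi : 0 < ρ⁻¹ := inv_pos.2 hρ0
  have n1 : 0 < 2 * H₀ - 1 := by linarith
  have n2 : 0 < 2 - 2 * H₀ := by linarith
  have hpt1 : ∀ l ∈ Set.Ioc 0 ρ⁻¹, ENNReal.ofReal (windowWeight H₀ l) *
      ∫⁻ v, ENNReal.ofReal (windowValue t ρ v l ^ 2)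
        ≤ ENNReal.ofReal (w * (1 + t) / ρ ^ 2 * l ^ (2 * H₀ - 2)) := by
    intro l hl
    have hl0 : 0 < l := hl.1
    have hl1 : l ≤ 1 := hl.2.trans (inv_le_one_of_one_le₀ hρ)
    have hW : 0 ≤ windowWeight H₀ l := mul_nonneg hw.le (by positivity)
    refine (mul_le_mul_right (lintegral_windowValue_le (by positivity)
      fun v => abs_windowValue_le hρ0 hl0.le) _).trans ?_
    rw [← ENNReal.ofReal_mul hW]
    refine ENNReal.ofReal_le_ofReal ?_
    have e : windowWeight H₀ l * ((l / ρ) ^ 2 * (l + t))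
        = w * (l + t) / ρ ^ 2 * (l ^ (2 * H₀ - 4) * l ^ (2 : ℝ)) := by
      rw [windowWeight, hwdef, windowConst, Real.rpow_two]; ring
    rw [e, ← Real.rpow_add hl0, show 2 * H₀ - 4 + 2 = 2 * H₀ - 2 by ring]
    gcongr
  have hpt2 : ∀ l ∈ Set.Ioi ρ⁻¹, ENNReal.ofReal (windowWeight H₀ l) *
      ∫⁻ v, ENNReal.ofReal (windowValue t ρ v l ^ 2)
        ≤ ENNReal.ofReal (4 * w * (1 + t) / ρ ^ 3 * l ^ (2 * H₀ - 3)) := by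
    intro l hl
    have hl' : ρ⁻¹ < l := hl
    have hl0 : 0 < l := hρi.trans hl'
    have hW : 0 ≤ windowWeight H₀ l := mul_nonneg hw.le (by positivity)
    refine (mul_le_mul_right (lintegral_windowValue_le (by positivity)
      fun v => abs_windowValue_le_sq t ρ v l) _).trans ?_
    rw [← ENNReal.ofReal_mul hW]
    refine ENNReal.ofReal_le_ofReal ?_
    have hlρ : 1 ≤ l * ρ := by
      rw [inv_lt_iff_one_lt_mul₀ hρ0] at hl'; exact hl'.le
    -- From ρ ≥ 1 and lρ ≥ 1. The loss is harmless: at the critical length l = 1/ρ both sides are of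
    -- order one.
    have hlt : l + t ≤ (1 + t) * ρ * l := by nlinarith
    have e2 : l ^ (2 * H₀ - 3) = l ^ (2 * H₀ - 4) * l := by
      rw [show 2 * H₀ - 3 = (2 * H₀ - 4) + 1 by ring, Real.rpow_add hl0, Real.rpow_one]
    calc windowWeight H₀ l * ((2 / ρ ^ 2) ^ 2 * (l + t))
        ≤ windowWeight H₀ l * ((2 / ρ ^ 2) ^ 2 * ((1 + t) * ρ * l)) := by gcongr
      _ = _ := by
        rw [e2, windowWeight, hwdef, windowConst]
        field_simp
        ring
  have hI1 : IntegrableOn (fun l : ℝ => w * (1 + t) / ρ ^ 2 * l ^ (2 * H₀ - 2))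
      (Set.Ioc 0 ρ⁻¹) := by
    have h := intervalIntegral.intervalIntegrable_rpow' (a := 0) (b := ρ⁻¹)
      (by linarith : -1 < 2 * H₀ - 2)
    rw [intervalIntegrable_iff_integrableOn_Ioc_of_le hρi.le] at h
    exact h.const_mul _
  have hI2 : IntegrableOn (fun l : ℝ => 4 * w * (1 + t) / ρ ^ 3 * l ^ (2 * H₀ - 3))
      (Set.Ioi ρ⁻¹) := (integrableOn_Ioi_rpow_of_lt (by linarith) hρi).const_mul _
  have hv1 : ∫ l in Set.Ioc 0 ρ⁻¹, w * (1 + t) / ρ ^ 2 * l ^ (2 * H₀ - 2)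
      = w * (1 + t) / (2 * H₀ - 1) * ρ ^ (-(1 + 2 * H₀)) := by
    rw [integral_const_mul, ← intervalIntegral.integral_of_le hρi.le,
      integral_rpow (Or.inl (by linarith)), show 2 * H₀ - 2 + 1 = 2 * H₀ - 1 by ring,
      Real.zero_rpow n1.ne', sub_zero, Real.inv_rpow hρ0.le, ← Real.rpow_neg hρ0.le,
      show -(1 + 2 * H₀) = -(2 * H₀ - 1) + (-2 : ℝ) by ring, Real.rpow_add hρ0,
      Real.rpow_neg hρ0.le 2, Real.rpow_two]
    field_simp
  have hv2 : ∫ l in Set.Ioi ρ⁻¹, 4 * w * (1 + t) / ρ ^ 3 * l ^ (2 * H₀ - 3)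
      = 4 * w * (1 + t) / (2 - 2 * H₀) * ρ ^ (-(1 + 2 * H₀)) := by
    rw [integral_const_mul, integral_Ioi_rpow_of_lt (by linarith) hρi,
      show 2 * H₀ - 3 + 1 = -(2 - 2 * H₀) by ring, Real.inv_rpow hρ0.le, Real.rpow_neg hρ0.le,
      inv_inv, show -(1 + 2 * H₀) = (2 - 2 * H₀) + (-3 : ℝ) by ring, Real.rpow_add hρ0,
      Real.rpow_neg hρ0.le 3, show (3 : ℝ) = (3 : ℕ) by norm_num, Real.rpow_natCast]
    field_simp
  have hnn : 0 ≤ (w * (1 + t) / (2 * H₀ - 1) + 4 * w * (1 + t) / (2 - 2 * H₀)) *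
      ρ ^ (-(1 + 2 * H₀)) := by positivity
  rw [← ENNReal.ofReal_le_ofReal_iff hnn, ofReal_temporalEnergy h h' ht hρ0,
    ← Set.Ioc_union_Ioi_eq_Ioi hρi.le]
  refine (lintegral_union_le _ _ _).trans ?_
  refine (add_le_add (setLIntegral_mono' measurableSet_Ioc hpt1)
    (setLIntegral_mono' measurableSet_Ioi hpt2)).trans (le_of_eq ?_)
  rw [← ofReal_integral_eq_lintegral_ofReal hI1, ← ofReal_integral_eq_lintegral_ofReal hI2, hv1,
    hv2, ← ENNReal.ofReal_add (by positivity) (by positivity), add_mul]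
  · filter_upwards [ae_restrict_mem measurableSet_Ioi] with l hl
    have : 0 < l := hρi.trans hl
    show 0 ≤ 4 * w * (1 + t) / ρ ^ 3 * l ^ (2 * H₀ - 3)
    positivity
  · filter_upwards [ae_restrict_mem measurableSet_Ioc] with l hl
    have : 0 < l := hl.1
    show 0 ≤ w * (1 + t) / ρ ^ 2 * l ^ (2 * H₀ - 2)
    positivity

/-- With t = 2, v ≤ 1 and l ≤ 1 the window lies inside (0,2] and is not truncated. The difference of
cosines is then a product of two sines, one of which is sin(ρl/2) with ρl/2 in [1/2, 1], so at least
1/4. -/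
lemma sq_windowValue_ge {ρ v l : ℝ} (hρ : 2 ≤ ρ) (hv : v ∈ Set.Ioc (0 : ℝ) 1)
    (hl : l ∈ Set.Icc (1 / ρ) (2 / ρ)) :
    Real.sin (2 * ρ - ρ * l / 2 - ρ * v) ^ 2 / (4 * ρ ^ 4) ≤ windowValue 2 ρ v l ^ 2 := by
  have hρ0 : 0 < ρ := by linarith
  have hl0 : 0 < l := lt_of_lt_of_le (by positivity) hl.1
  have hl1 : ρ * l ≤ 2 := by have := hl.2; rwa [le_div_iff₀ hρ0, mul_comm] at this
  have hl2 : 1 ≤ ρ * l := by have := hl.1; rwa [div_le_iff₀ hρ0, mul_comm] at this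
  have hl3 : l ≤ 1 := by nlinarith
  have e1 : max v 0 = v := max_eq_left hv.1.le
  have e2 : min (v + l) 2 = v + l := min_eq_left (by linarith [hv.2])
  have e3 : max v (v + l) = v + l := max_eq_right (by linarith)
  have hs : 1 / 4 ≤ Real.sin (ρ * l / 2) := by
    have := Real.sin_gt_sub_cube (x := ρ * l / 2) (by linarith)
    nlinarith [sq_nonneg (ρ * l / 2), mul_nonneg (show 0 ≤ ρ * l / 2 by linarith)
      (show 0 ≤ 1 - (ρ * l / 2) ^ 2 by nlinarith)]
  have hs2 : 1 / 16 ≤ Real.sin (ρ * l / 2) ^ 2 := by nlinarith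
  have e4 : windowValue 2 ρ v l ^ 2
      = 4 * Real.sin (ρ * l / 2) ^ 2 * Real.sin (2 * ρ - ρ * l / 2 - ρ * v) ^ 2 / ρ ^ 4 := by
    rw [windowValue, e1, e2, e3, Real.cos_sub_cos,
      show (2 * ρ - ρ * (v + l) + (2 * ρ - ρ * v)) / 2 = 2 * ρ - ρ * l / 2 - ρ * v by ring,
      show (2 * ρ - ρ * (v + l) - (2 * ρ - ρ * v)) / 2 = -(ρ * l / 2) by ring, Real.sin_neg]
    ring
  rw [e4, div_le_div_iff₀ (by positivity) (by positivity)]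
  have h5 := sq_nonneg (Real.sin (2 * ρ - ρ * l / 2 - ρ * v))
  have h6 : Real.sin (2 * ρ - ρ * l / 2 - ρ * v) ^ 2 * 1 ≤
      Real.sin (2 * ρ - ρ * l / 2 - ρ * v) ^ 2 * (16 * Real.sin (ρ * l / 2) ^ 2) := by
    gcongr; linarith
  calc _ = (Real.sin (2 * ρ - ρ * l / 2 - ρ * v) ^ 2 * 1) * ρ ^ 4 := by ring
    _ ≤ (Real.sin (2 * ρ - ρ * l / 2 - ρ * v) ^ 2 * (16 * Real.sin (ρ * l / 2) ^ 2)) * ρ ^ 4 := by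
        gcongr
    _ = _ := by ring

/-- The remaining sin² depends on v; its average over (0,1] is at least (ρ-1)/(2ρ) ≥ 1/4, which is
where ρ ≥ 2 is used. -/
lemma lintegral_windowValue_ge {ρ l : ℝ} (hρ : 2 ≤ ρ) (hl : l ∈ Set.Icc (1 / ρ) (2 / ρ)) :
    ENNReal.ofReal (1 / (16 * ρ ^ 4)) ≤ ∫⁻ v, ENNReal.ofReal (windowValue 2 ρ v l ^ 2) := by
  have hρ0 : 0 < ρ := by linarith
  have hc : Continuous fun v => Real.sin (2 * ρ - ρ * l / 2 - ρ * v) ^ 2 / (4 * ρ ^ 4) := by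
    fun_prop
  have hi : IntegrableOn (fun v => Real.sin (2 * ρ - ρ * l / 2 - ρ * v) ^ 2 / (4 * ρ ^ 4))
      (Set.Ioc 0 1) := (hc.intervalIntegrable 0 1).1
  refine le_trans ?_ (setLIntegral_le_lintegral (Set.Ioc (0 : ℝ) 1) _)
  refine le_trans ?_ (setLIntegral_mono' measurableSet_Ioc fun v hv =>
    ENNReal.ofReal_le_ofReal (sq_windowValue_ge hρ hv hl))
  rw [← ofReal_integral_eq_lintegral_ofReal hi (Eventually.of_forall fun v => by positivity)]
  refine ENNReal.ofReal_le_ofReal ?_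
  rw [← intervalIntegral.integral_of_le zero_le_one, intervalIntegral.integral_div,
    integral_sin_sub_sq hρ0.ne']
  have h1 := abs_le.1 (abs_sin_mul_cos_le (2 * ρ - ρ * l / 2 - ρ * 1))
  have h2 := abs_le.1 (abs_sin_mul_cos_le (2 * ρ - ρ * l / 2))
  have h3 : 1 / 4 ≤ (Real.sin (2 * ρ - ρ * l / 2 - ρ * 1) * Real.cos (2 * ρ - ρ * l / 2 - ρ * 1) -
      Real.sin (2 * ρ - ρ * l / 2) * Real.cos (2 * ρ - ρ * l / 2) + ρ * 1) / (2 * ρ) := by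
    rw [le_div_iff₀ (by positivity)]
    linarith [h1.1, h2.2]
  calc 1 / (16 * ρ ^ 4) = 1 / 4 / (4 * ρ ^ 4) := by field_simp; norm_num
    _ ≤ _ := by gcongr

/-- Windows with 1/ρ ≤ l ≤ 2/ρ already suffice: weight of order ρ^{4-2H₀}, range of l of length 1/ρ,
and squared values of order ρ^{-4}. -/
lemma rpow_le_temporalEnergy {H₀ : ℝ} (h : 1 / 2 < H₀) (h' : H₀ < 1) :
    ∃ c, 0 < c ∧ ∀ ρ, 2 ≤ ρ → c * ρ ^ (-(1 + 2 * H₀)) ≤ temporalEnergy H₀ 2 ρ := by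
  have hw := windowConst_pos h h'
  refine ⟨windowConst H₀ * 2 ^ (2 * H₀ - 4) / 16, by positivity, fun ρ hρ => ?_⟩
  have hρ0 : 0 < ρ := by linarith
  have hN := temporalEnergy_nonneg h.le h'.le (zero_le_two (α := ℝ)) hρ0.le
  rw [← ENNReal.ofReal_le_ofReal_iff hN, ofReal_temporalEnergy h h' zero_le_two hρ0]
  have hsub : Set.Icc (1 / ρ) (2 / ρ) ⊆ Set.Ioi 0 := fun l hl =>
    lt_of_lt_of_le (by positivity : 0 < 1 / ρ) hl.1
  have hpt : ∀ l ∈ Set.Icc (1 / ρ) (2 / ρ),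
      ENNReal.ofReal (windowConst H₀ * (2 / ρ) ^ (2 * H₀ - 4) * (1 / (16 * ρ ^ 4))) ≤
      ENNReal.ofReal (windowWeight H₀ l) * ∫⁻ v, ENNReal.ofReal (windowValue 2 ρ v l ^ 2) := by
    intro l hl
    have hl0 : 0 < l := hsub hl
    rw [ENNReal.ofReal_mul (by positivity)]
    refine mul_le_mul' (ENNReal.ofReal_le_ofReal ?_) (lintegral_windowValue_ge hρ hl)
    exact mul_le_mul_of_nonneg_left
      (Real.rpow_le_rpow_of_nonpos hl0 hl.2 (by linarith)) hw.le
  calc ENNReal.ofReal (windowConst H₀ * 2 ^ (2 * H₀ - 4) / 16 * ρ ^ (-(1 + 2 * H₀)))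
      = ∫⁻ _ in Set.Icc (1 / ρ) (2 / ρ), ENNReal.ofReal (windowConst H₀ *
          (2 / ρ) ^ (2 * H₀ - 4) * (1 / (16 * ρ ^ 4))) := by
        rw [setLIntegral_const, Real.volume_Icc, ← ENNReal.ofReal_mul (by positivity)]
        congr 1
        rw [Real.div_rpow zero_le_two hρ0.le,
          show -(1 + 2 * H₀) = -(2 * H₀ - 4) + (-(5 : ℕ) : ℝ) by push_cast; ring,
          Real.rpow_add hρ0, Real.rpow_neg hρ0.le, Real.rpow_neg hρ0.le, Real.rpow_natCast]
        field_simp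
        norm_num
    _ ≤ _ := setLIntegral_mono' measurableSet_Icc hpt
    _ ≤ _ := lintegral_mono_set hsub

end HighFrequency


/-! ### The solvability criterion -/

section Criterion

variable {d : ℕ} {H : Fin d → ℝ} {H₀ : ℝ}

/-- If the temporal energy decays like `ρ^{-p}`, up to oscillations, then the equation is solvable
if and only if `p` exceeds the homogeneity degree of the spectral measure. -/
theorem solvable_iff_specDim_lt {Ω : Type*} [MeasurableSpace Ω] {P : Measure Ω}
    [IsProbabilityMeasure P] {W : ℝ≥0 → Sp d → Ω → ℝ} (hW : IsFractionalField P H₀ H W)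
    (hd : 1 ≤ d) (hH₀ : 1 / 2 ≤ H₀) (hH₀' : H₀ ≤ 1) (hH : ∀ i, 0 < H i ∧ H i < 1) {p : ℝ}
    (hp : 1 ≤ p)
    (hupper : ∀ t : ℝ, 0 ≤ t → ∃ C, ∀ ρ, 1 ≤ ρ → temporalEnergy H₀ t ρ ≤ C * ρ ^ (-p))
    (hlower : ∃ t c ρ₀ a : ℝ, 0 ≤ t ∧ 0 < c ∧ 0 ≤ a ∧ ∀ ρ, ρ₀ ≤ ρ →
      c * ρ ^ (-p) ≤ temporalEnergy H₀ t ρ + temporalEnergy H₀ t (ρ + a)) :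
    Solvable P H₀ H W ↔ specDim H < p := by
  have hpolar : ∀ t : ℝ, ∫⁻ ξ, ENNReal.ofReal (temporalEnergy H₀ t ‖ξ‖) ∂spectralMeasure H
      = ∫⁻ ρ in Set.Ioi (0 : ℝ), ENNReal.ofReal (radialDensity H ρ) *
        ENNReal.ofReal (temporalEnergy H₀ t ρ) := fun t =>
    lintegral_norm_spectralMeasure hd hH (measurable_temporalEnergy H₀ t).ennreal_ofReal
  rw [solvable_iff_lintegral hW hd hH₀ hH₀' hH]
  simp_rw [hpolar]
  constructor
  · intro hfin
    obtain ⟨t, c, ρ₀, a, ht, hc, ha, h⟩ := hlower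
    exact specDim_lt_of_lintegral hd hH (measurable_temporalEnergy H₀ t) hp ha hc h (hfin ⟨t, ht⟩)
  · intro hlt t
    obtain ⟨C, hC⟩ := hupper t t.2
    exact lintegral_radialDensity_lt_top hd hH
      (fun ρ hρ _ => temporalEnergy_le hH₀ t.2 hρ.le) hC hlt

lemma temporalEnergy_half_le {t ρ : ℝ} (ht : 0 ≤ t) (hρ : 1 ≤ ρ) :
    temporalEnergy (1 / 2) t ρ ≤ (t + 1) * ρ ^ (-2 : ℝ) := by
  have hρ0 : 0 < ρ := one_pos.trans_le hρ
  have h := (abs_le.1 (abs_sin_mul_cos_le (t * ρ))).1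
  rw [temporalEnergy_half ht hρ0, Real.rpow_neg hρ0.le, Real.rpow_two, div_le_iff₀ (by positivity)]
  have e : (t + 1) * (ρ ^ 2)⁻¹ * (2 * ρ ^ 3) = (t + 1) * 2 * ρ := by field_simp
  rw [e]
  nlinarith [mul_nonneg ht hρ0.le]

lemma le_temporalEnergy_half {ρ : ℝ} (hρ : 1 ≤ ρ) :
    1 / 4 * ρ ^ (-2 : ℝ) ≤ temporalEnergy (1 / 2) 1 ρ := by
  have hρ0 : 0 < ρ := one_pos.trans_le hρ
  have h := (abs_le.1 (abs_sin_mul_cos_le (1 * ρ))).2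
  rw [temporalEnergy_half zero_le_one hρ0, Real.rpow_neg hρ0.le, Real.rpow_two,
    le_div_iff₀ (by positivity)]
  have e : 1 / 4 * (ρ ^ 2)⁻¹ * (2 * ρ ^ 3) = ρ / 2 := by field_simp; norm_num
  rw [e]
  linarith

lemma temporalEnergy_one_le {t ρ : ℝ} (ht : 0 ≤ t) (hρ : 1 ≤ ρ) :
    temporalEnergy 1 t ρ ≤ 4 * ρ ^ (-4 : ℝ) := by
  have hρ0 : 0 < ρ := one_pos.trans_le hρ
  rw [temporalEnergy_one ht hρ0, Real.rpow_neg hρ0.le, show (4 : ℝ) = (4 : ℕ) by norm_num,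
    Real.rpow_natCast, ← div_eq_mul_inv]
  gcongr
  push_cast
  nlinarith [Real.neg_one_le_cos (t * ρ), Real.cos_le_one (t * ρ)]

/-- The energy vanishes whenever ρ is a multiple of 2π, so no pointwise lower bound exists. Shifting
by π turns 1 - cos into 1 + cos, and the two squares sum to at least 2. The factor 16 comes from ρ +
π ≤ 2ρ. -/
lemma le_temporalEnergy_one {ρ : ℝ} (hρ : Real.pi ≤ ρ) :
    1 / 8 * ρ ^ (-4 : ℝ) ≤ temporalEnergy 1 1 ρ + temporalEnergy 1 1 (ρ + Real.pi) := by
  have hπ := Real.pi_pos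
  have hρ0 : 0 < ρ := hπ.trans_le hρ
  rw [temporalEnergy_one zero_le_one hρ0, temporalEnergy_one zero_le_one (by positivity), one_mul,
    one_mul, Real.cos_add_pi, sub_neg_eq_add, Real.rpow_neg hρ0.le,
    show (4 : ℝ) = (4 : ℕ) by norm_num, Real.rpow_natCast]
  have h1 : (1 - Real.cos ρ) ^ 2 / (16 * ρ ^ 4) ≤ (1 - Real.cos ρ) ^ 2 / ρ ^ 4 := by
    gcongr; nlinarith [pow_pos hρ0 4]
  have h2 : (1 + Real.cos ρ) ^ 2 / (16 * ρ ^ 4) ≤ (1 + Real.cos ρ) ^ 2 / (ρ + Real.pi) ^ 4 := by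
    gcongr
    calc (ρ + Real.pi) ^ 4 ≤ (2 * ρ) ^ 4 := by gcongr; linarith
      _ = 16 * ρ ^ 4 := by ring
  refine le_trans ?_ (add_le_add h1 h2)
  rw [← add_div, le_div_iff₀ (by positivity)]
  have e : 1 / 8 * (ρ ^ 4)⁻¹ * (16 * ρ ^ 4) = 2 := by field_simp; norm_num
  rw [e]
  nlinarith [sq_nonneg (Real.cos ρ)]

end Criterion

end FracWave

theorem theorem1p1 {d : ℕ} (hd : 1 ≤ d) {H₀ : ℝ} (hH₀ : 1 / 2 ≤ H₀) (hH₀' : H₀ ≤ 1)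
    {H : Fin d → ℝ} (hH : ∀ i, 0 < H i ∧ H i < 1)
    {Ω : Type*} [MeasurableSpace Ω] (P : MeasureTheory.Measure Ω)
    [MeasureTheory.IsProbabilityMeasure P]
    (W : NNReal → FracWave.Sp d → Ω → ℝ) (hW : FracWave.IsFractionalField P H₀ H W) :
    (∃ u : ℝ → NNReal → FracWave.Sp d → Ω → ℝ, FracWave.IsMollifiedSolution P H₀ H W u) ∧
    (H₀ = 1 / 2 → (FracWave.Solvable P H₀ H W ↔ (∑ i, H i) > (d : ℝ) - 1)) ∧
    (H₀ = 1 → (FracWave.Solvable P H₀ H W ↔ (∑ i, H i) > (d : ℝ) - 2)) ∧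
    (1 / 2 < H₀ ∧ H₀ < 1 →
      (FracWave.Solvable P H₀ H W ↔ (∑ i, H i) + H₀ > (d : ℝ) - 1 / 2)) := by
  have hs := FracWave.specDim_eq H
  refine ⟨FracWave.exists_isMollifiedSolution hW hd hH₀ hH₀' hH, ?_, ?_, ?_⟩
  · rintro rfl
    -- The argument `one_le_two` fixes p = 2. There is no oscillation to compensate, so the shift is
    -- 0 and the second energy is dropped by positivity.
    rw [FracWave.solvable_iff_specDim_lt hW hd hH₀ hH₀' hH one_le_two
      (fun t ht => ⟨t + 1, fun ρ hρ => FracWave.temporalEnergy_half_le ht hρ⟩)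
      ⟨1, 1 / 4, 1, 0, zero_le_one, by norm_num, le_rfl, fun ρ hρ => ?_⟩, hs]
    · constructor <;> intro h <;> linarith
    · exact (FracWave.le_temporalEnergy_half hρ).trans (le_add_of_nonneg_right
        (FracWave.temporalEnergy_nonneg hH₀ hH₀' zero_le_one (by linarith)))
  · rintro rfl
    rw [FracWave.solvable_iff_specDim_lt hW hd hH₀ hH₀' hH (p := 4) (by norm_num)
      (fun t ht => ⟨4, fun ρ hρ => FracWave.temporalEnergy_one_le ht hρ⟩)
      ⟨1, 1 / 8, Real.pi, Real.pi, zero_le_one, by norm_num, Real.pi_pos.le,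
        fun ρ hρ => FracWave.le_temporalEnergy_one hρ⟩, hs]
    constructor <;> intro h <;> linarith
  · rintro ⟨h, h'⟩
    obtain ⟨c, hc, hlow⟩ := FracWave.rpow_le_temporalEnergy h h'
    -- The condition 2d - 2|H| < 1 + 2H₀ is the claim after halving. The lower bound is only needed
    -- at the single time t = 2.
    rw [FracWave.solvable_iff_specDim_lt hW hd hH₀ hH₀' hH (p := 1 + 2 * H₀) (by linarith)
      (fun t ht => FracWave.temporalEnergy_le_rpow h h' ht)
      ⟨2, c, 2, 0, zero_le_two, hc, le_rfl, fun ρ hρ => ?_⟩, hs]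
    · constructor <;> intro h <;> linarith
    · exact (hlow ρ hρ).trans (le_add_of_nonneg_right
        (FracWave.temporalEnergy_nonneg hH₀ hH₀' zero_le_two (by linarith)))
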